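/- Fix $d\ge 2$, let $\mathcal{E}=\{\pm e_1,\dots,\pm e_d\}$ be the set of unit vectors of $\mathbb{Z}^d$, let $\mathcal{P}$ be the set of probability measures on $\mathcal{E}$, and let $\mu$ be an arbitrary probability measure on $\mathcal{P}$ (no ellipticity is assumed). Let $\omega=(\omega_x)_{x\in\mathbb{Z}^d}$ be an i.i.d. environment with law $\nu=\mu^{\otimes\mathbb{Z}^d}$. Given $\omega$, let $(X_n)_{n\ge 0}$ be the Markov chain on $\mathbb{Z}^d$ with $X_0=0$ that jumps from $x$ to $x+e$ with probability $\omega_x(e)$, $e\in\mathcal{E}$; write $\mathbb{P}_\omega$ for its law and $P$ for the annealed law, i.e. the joint law of $(\omega,X)$ obtained by choosing $\omega$ according to $\nu$ and then $X$ according to $\mathbb{P}_\omega$. For $\ell\in\mathbb{R}^d\setminus\{0\}$ let $A_+(\ell)=\{X_n\cdot\ell\to+\infty\}$ and $A_-(\ell)=\{X_n\cdot\ell\to-\infty\}$. Then for every $\ell\in\mathbb{R}^d\setminus\{0\}$ there exist deterministic real numbers $v_+(\ell)$ and $v_-(\ell)$ such that $$\lim_{n\to\infty}\frac{X_n\cdot\ell}{n}=v_+(\ell)\mathbf{1}_{A_+(\ell)}+v_-(\ell)\mathbf{1}_{A_-(\ell)}\qquad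 P\text{-almost surely}.$$ Moreover, there exist deterministic vectors $v_1,v_2\in\mathbb{R}^d$ (possibly equal) such that, $P$-almost surely, $X_n/n$ converges as $n\to\infty$ and its limit belongs to $\{v_1,v_2\}$. -/

import Mathlib

open MeasureTheory ProbabilityTheory Filter Topology

namespace RWRE

/-- The integer lattice `ℤ^d`, with its (discrete) product `σ`-algebra. -/
abbrev Lattice (d : ℕ) : Type := Fin d → ℤ

/-- The set `{± e_i : i = 1, …, d}` of unit vectors of `ℤ^d`. -/
abbrev UnitStep (d : ℕ) : Type :=
  {e : Lattice d // ∃ i : Fin d, e = Pi.single i 1 ∨ e = -Pi.single i 1}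

/-- Environments: to each site of `ℤ^d` a probability measure on the unit vectors is attached.
No ellipticity is imposed. The `σ`-algebra is the product one. -/
abbrev Env (d : ℕ) : Type := Lattice d → ProbabilityMeasure (UnitStep d)

/-- The law `μ^{⊗ ℤ^d}` of an i.i.d. environment whose single-site law is `μ`. -/
noncomputable def envLaw {d : ℕ} (μ : Measure (ProbabilityMeasure (UnitStep d)))
    [IsProbabilityMeasure μ] : Measure (Env d) :=
  Measure.infinitePi fun _ : Lattice d => μ

instance {d : ℕ} (μ : Measure (ProbabilityMeasure (UnitStep d))) [IsProbabilityMeasure μ] :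
    IsProbabilityMeasure (envLaw μ) := by
  unfold envLaw; infer_instance

/-- The one-step transition kernel in the environment `ω`: from `x`, jump to `x + e` with
probability `ω x {e}`. -/
noncomputable def stepKernel {d : ℕ} (ω : Env d) : Kernel (Lattice d) (Lattice d) where
  toFun x := (ω x : Measure (UnitStep d)).map fun e => x + e.1
  measurable' := Measurable.of_discrete

instance {d : ℕ} (ω : Env d) : IsMarkovKernel (stepKernel ω) :=
  ⟨fun x => Measure.isProbabilityMeasure_map
    (μ := (ω x : Measure (UnitStep d))) (f := fun e => x + e.1)
    (Measurable.of_discrete).aemeasurable⟩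

/-- The transition kernel at time `n` of the walk, as a kernel which takes the whole past up to
time `n` but only uses the position at time `n`. -/
noncomputable def walkKernel {d : ℕ} (ω : Env d) (n : ℕ) :
    Kernel (Finset.Iic n → Lattice d) (Lattice d) :=
  (stepKernel ω).comap (fun h => h ⟨n, Finset.mem_Iic.2 le_rfl⟩) (measurable_pi_apply _)

instance {d : ℕ} (ω : Env d) (n : ℕ) : IsMarkovKernel (walkKernel ω n) := by
  unfold walkKernel; infer_instance

/-- The quenched law: the law, on the space of paths `ℕ → ℤ^d`, of the Markov chain started at the
origin with transition kernel `stepKernel ω`. -/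
noncomputable def quenchedLaw {d : ℕ} (ω : Env d) : Measure (ℕ → Lattice d) :=
  Kernel.trajMeasure (X := fun _ => Lattice d) (Measure.dirac 0) (walkKernel ω)

instance {d : ℕ} (ω : Env d) : IsProbabilityMeasure (quenchedLaw ω) := by
  unfold quenchedLaw; infer_instance

lemma measurable_stepKernel {d : ℕ} (x : Lattice d) :
    Measurable fun ω : Env d => stepKernel ω x :=
  (Measure.measurable_map _ Measurable.of_discrete).comp
    (measurable_subtype_coe.comp (measurable_pi_apply x))

lemma measurable_quenchedLaw_restrict {d : ℕ} (n : ℕ) :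
    Measurable fun ω : Env d =>
      (quenchedLaw ω).map (Preorder.frestrictLe (π := fun _ => Lattice d) n) := by
  induction n with
  | zero =>
    have h : ∀ ω : Env d,
        (quenchedLaw ω).map (Preorder.frestrictLe (π := fun _ => Lattice d) 0) =
          (Measure.dirac (0 : Lattice d)).map
            (MeasurableEquiv.piUnique (fun _ : Finset.Iic 0 => Lattice d)).symm := by
      intro ω
      rw [quenchedLaw, Kernel.trajMeasure, Measure.map_comp _ _ (by fun_prop),
        Kernel.traj_map_frestrictLe, Kernel.partialTraj_self, Measure.id_comp]
    simp_rw [h]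
    exact measurable_const
  | succ n ih =>
    let g : (Finset.Iic n → Lattice d) × Lattice d → (Finset.Iic (n + 1) → Lattice d) :=
      fun p i => if hi : i.1 ≤ n then p.1 ⟨i.1, Finset.mem_Iic.2 hi⟩ else p.2
    have hg : Measurable g := Measurable.of_discrete
    have hcomp : (Preorder.frestrictLe (π := fun _ => Lattice d) (n + 1)) =
        g ∘ fun x : ℕ → Lattice d =>
          (Preorder.frestrictLe (π := fun _ => Lattice d) n x, x (n + 1)) := by
      funext x i
      by_cases hi : i.1 ≤ n
      · simp [g, hi]
      · have h1 : i.1 = n + 1 := by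
          have := Finset.mem_Iic.1 i.2
          omega
        simp [g, h1]
    have h : ∀ ω : Env d,
        (quenchedLaw ω).map (Preorder.frestrictLe (π := fun _ => Lattice d) (n + 1)) =
          (((quenchedLaw ω).map (Preorder.frestrictLe (π := fun _ => Lattice d) n)) ⊗ₘ
            walkKernel ω n).map g := by
      intro ω
      rw [quenchedLaw, Kernel.map_frestrictLe_trajMeasure_compProd_eq_map_trajMeasure, hcomp,
        Measure.map_map hg (by fun_prop)]
    simp_rw [h]
    refine (Measure.measurable_map g hg).comp ?_
    refine Measure.measurable_of_measurable_coe _ fun s hs => ?_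
    simp_rw [Measure.compProd_apply hs, lintegral_countable']
    refine Measurable.tsum fun a => Measurable.mul ?_ ?_
    · exact (Measure.measurable_coe (measurable_prodMk_left hs)).comp
        (measurable_stepKernel (a ⟨n, Finset.mem_Iic.2 le_rfl⟩))
    · exact (Measure.measurable_coe (measurableSet_singleton a)).comp ih

lemma measurable_quenchedLaw {d : ℕ} : Measurable (quenchedLaw (d := d)) := by
  refine Measurable.measure_of_isPiSystem_of_isProbabilityMeasure
    generateFrom_measurableCylinders.symm isPiSystem_measurableCylinders ?_
  intro t ht
  obtain ⟨s, S, hS, rfl⟩ := (mem_measurableCylinders t).1 ht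
  have hs : s ⊆ Finset.Iic (s.sup id) := fun i hi =>
    Finset.mem_Iic.2 (Finset.le_sup (f := id) hi)
  have hm : MeasurableSet
      ((Finset.restrict₂ (π := fun _ : ℕ => Lattice d) hs) ⁻¹' S) :=
    Finset.measurable_restrict₂ (X := fun _ : ℕ => Lattice d) hs hS
  have hf : Measurable
      (Preorder.frestrictLe (π := fun _ : ℕ => Lattice d) (s.sup id)) := by fun_prop
  have hpre : ∀ ω : Env d, quenchedLaw ω (cylinder s S) =
      (quenchedLaw ω).map (Preorder.frestrictLe (π := fun _ : ℕ => Lattice d) (s.sup id))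
        ((Finset.restrict₂ (π := fun _ : ℕ => Lattice d) hs) ⁻¹' S) := by
    intro ω
    rw [Measure.map_apply hf hm]
    rfl
  simp_rw [hpre]
  exact (Measure.measurable_coe hm).comp (measurable_quenchedLaw_restrict (s.sup id))

/-- The quenched laws, as a kernel from environments to paths. -/
noncomputable def quenchedKernel (d : ℕ) : Kernel (Env d) (ℕ → Lattice d) where
  toFun := quenchedLaw
  measurable' := measurable_quenchedLaw

instance (d : ℕ) : IsMarkovKernel (quenchedKernel d) :=
  ⟨fun ω => inferInstanceAs (IsProbabilityMeasure (quenchedLaw ω))⟩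

/-- The annealed law: the joint law of the environment and of the walk `(ω, X)`, where `ω` is
i.i.d. with single-site law `μ` and, given `ω`, the path `X` has the quenched law. -/
noncomputable def annealedLaw {d : ℕ} (μ : Measure (ProbabilityMeasure (UnitStep d)))
    [IsProbabilityMeasure μ] : Measure (Env d × (ℕ → Lattice d)) :=
  envLaw μ ⊗ₘ quenchedKernel d

instance {d : ℕ} (μ : Measure (ProbabilityMeasure (UnitStep d))) [IsProbabilityMeasure μ] :
    IsProbabilityMeasure (annealedLaw μ) := by
  unfold annealedLaw; infer_instance

/-- A lattice point seen as a vector of `ℝ^d`. -/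
def toReal {d : ℕ} (x : Lattice d) : Fin d → ℝ := fun i => (x i : ℝ)

/-- The set `A₊(ℓ)` of paths with `X_n · ℓ → +∞`. -/
def Aplus {d : ℕ} (ℓ : Fin d → ℝ) : Set (ℕ → Lattice d) :=
  {X | Tendsto (fun n => toReal (X n) ⬝ᵥ ℓ) atTop atTop}

/-- The set `A₋(ℓ)` of paths with `X_n · ℓ → -∞`. -/
def Aminus {d : ℕ} (ℓ : Fin d → ℝ) : Set (ℕ → Lattice d) :=
  {X | Tendsto (fun n => toReal (X n) ⬝ᵥ ℓ) atTop atBot}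

end RWRE

/-!
The walk is encoded by its steps, and all events are read under the annealed law `stepAnn` of the
steps. For a homomorphism `φ` from the lattice to the reals, a *fresh* time is one at which the
walk reaches a new strict maximum in the direction `φ`. The steps up to a fresh time only involve
the environment behind the walk, and an event which forces the walk to stay at or above its level
only involves the environment ahead; hence past and future are independent at fresh times
(`stepAnn_fresh`), and by Lévy's zero-one law an event ahead of positive probability occurs after
infinitely many of them (`fresh_trials`). No ellipticity is needed for this.

*Zero-one laws.* A shift-invariant event which occurs with positive probability for a walk that
never goes below its starting level occurs almost surely when the walk is unbounded above, and the
walk then tends to infinity (`invariant_of_unb`). If the walk tends to `+∞` and to `-∞` in the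
direction `φ` with positive probability each, then almost surely one of the two happens
(`up_or_down`).

*Speed under transience.* Let `lam` be a coordinate or its opposite. On the event that the walk
tends to infinity in the direction `lam`, it has regeneration times, which cut the walk into
independent blocks with the same law. The mean height of a block is finite by a renewal argument
(`sum_gap_le`): the events "`i` is a regeneration level and the next one is above `k`", `i ≤ k`,
are disjoint. The law of large numbers, where the mean duration of a block may be infinite, yields
the speed (`exists_speed_of_up`).

*Speed without transience.* If the walk almost surely does not tend to infinity in the direction
`lam`, then it has no positive speed in this direction (`speed_nonpos_of_up_null`). A walk started
at the level `m` is then unlikely to climb to the level `m + M`, for a large `M`, with a bounded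
number of crossings of the level `m`; the point is that this holds uniformly over the environment
below the level `m` (`climb_bound`). Consequently the mean of `2⁻ᴺ` is at most a small `η`, where
`N` is the number of crossings of the level `m` before the level `m + M` is reached, and `η ^ J`
bounds the corresponding mean over `J` successive blocks of `M` levels. The blocks can be based at
any of the `M` residues modulo `M`, and a step crosses only one level. So a walk which climbs `J`
blocks within `C * J * M` steps makes at most `C * J` crossings of the base levels of one of these
residues, an event of probability at most `M * 2 ^ (C * J) * η ^ J`, which is summable for a small
`η`.

*Conclusion.* The two speed results, applied to the coordinates and their opposites, show that the
walk has a velocity `V`. By the zero-one law `V` is constant on the event that the walk tends to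
infinity in the direction of `ℓ`, and this event contains `{V · ℓ > 0}`; this proves the first
claim. It also implies that two distinct nonzero values `u`, `w` of `V` satisfy `u · w < 0`:
otherwise both have a positive component along `u` or along `u + w`. The walk then tends to
infinity in the directions `u` and `-u` with positive probability each, so almost surely one of the
two happens and `V` is `u` or `w`. If there are no two such values, `V` takes at most one value
other than zero.
-/


namespace RWRE

/-! ### Sequences of steps -/

section

/-- Sequences of steps. The walk starts at the origin, hence is encoded by its steps. -/
abbrev Steps (d : ℕ) : Type := ℕ → UnitStep d

instance {d : ℕ} : Finite (UnitStep d) := by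
  have h : {e : Lattice d | ∃ i : Fin d, e = Pi.single i 1 ∨ e = -Pi.single i 1}.Finite := by
    have : {e : Lattice d | ∃ i : Fin d, e = Pi.single i 1 ∨ e = -Pi.single i 1} =
        ⋃ i : Fin d, ({Pi.single i 1, -Pi.single i 1} : Set (Lattice d)) := by
      ext e; simp
    rw [this]
    exact Set.finite_iUnion fun i => Set.toFinite _
  exact h.to_subtype

noncomputable instance {d : ℕ} : Fintype (UnitStep d) := Fintype.ofFinite _

instance {d : ℕ} [NeZero d] : Inhabited (UnitStep d) := ⟨⟨Pi.single 0 1, 0, Or.inl rfl⟩⟩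

/-- The position, after `n` steps, of the walk started at the origin. -/
def pos {d : ℕ} (s : Steps d) (n : ℕ) : Lattice d := ∑ i ∈ Finset.range n, (s i).1

/-- The sequence of the steps after time `n`. -/
def shift {d : ℕ} (n : ℕ) (s : Steps d) : Steps d := fun k => s (n + k)

/-- The cylinder of the walks whose first `n` steps are those of `s`. -/
def cyl {d : ℕ} (n : ℕ) (s : Steps d) : Set (Steps d) := {t | ∀ i < n, t i = s i}

/-- The quenched probability that the first `n` steps are those of `s`. -/
noncomputable def pathWeight {d : ℕ} (ω : Env d) (n : ℕ) (s : Steps d) : ENNReal :=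
  ∏ i ∈ Finset.range n, (ω (pos s i) : Measure (UnitStep d)) {s i}

/-- The environment seen from the site `x`. -/
def translate {d : ℕ} (x : Lattice d) (ω : Env d) : Env d := fun y => ω (x + y)

open Classical in
/-- The steps of a path; an increment which is not a unit vector is replaced by a default step. -/
noncomputable def stepsOf {d : ℕ} [NeZero d] (X : ℕ → Lattice d) : Steps d := fun n =>
  if h : ∃ i : Fin d, X (n + 1) - X n = Pi.single i 1 ∨ X (n + 1) - X n = -Pi.single i 1
  then ⟨X (n + 1) - X n, h⟩ else default

variable {d : ℕ}

@[simp] lemma pos_zero (s : Steps d) : pos s 0 = 0 := by simp [pos]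
lemma pos_succ (s : Steps d) (n : ℕ) : pos s (n + 1) = pos s n + (s n).1 := by
  simp [pos, Finset.sum_range_succ]
lemma pos_add (s : Steps d) (n k : ℕ) : pos s (n + k) = pos s n + pos (shift n s) k := by
  simp [pos, shift, Finset.sum_range_add]
lemma shift_shift (m n : ℕ) (s : Steps d) : shift m (shift n s) = shift (n + m) s := by
  funext k; simp [shift, add_assoc]
@[simp] lemma shift_zero (s : Steps d) : shift 0 s = s := by
  funext k; simp [shift]
lemma pos_succ' (s : Steps d) (n : ℕ) : pos s (n + 1) = (s 0).1 + pos (shift 1 s) n := by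
  rw [add_comm n 1, pos_add, pos_succ]; simp
lemma pos_congr {s t : Steps d} {n : ℕ} (h : ∀ i < n, s i = t i) : pos s n = pos t n :=
  Finset.sum_congr rfl fun i hi => by rw [h i (Finset.mem_range.1 hi)]

@[fun_prop] lemma measurable_pos (n : ℕ) : Measurable fun s : Steps d => pos s n := by
  unfold pos
  exact Finset.measurable_sum _ fun i _ =>
    (Measurable.of_discrete (f := fun e : UnitStep d => e.1)).comp (measurable_pi_apply i)
@[fun_prop] lemma measurable_shift (n : ℕ) : Measurable (shift (d := d) n) :=
  measurable_pi_lambda _ fun _ => measurable_pi_apply _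
lemma measurableSet_cyl (n : ℕ) (s : Steps d) : MeasurableSet (cyl n s) := by
  have : cyl n s = ⋂ i ∈ Finset.range n, {t | t i = s i} := by ext; simp [cyl]
  rw [this]
  exact Finset.measurableSet_biInter _ fun i _ =>
    measurableSet_eq_fun (measurable_pi_apply i) measurable_const
@[fun_prop] lemma measurable_translate (x : Lattice d) : Measurable (translate (d := d) x) :=
  measurable_pi_lambda _ fun _ => measurable_pi_apply _
lemma measurable_prob (x : Lattice d) (e : UnitStep d) :
    Measurable fun ω : Env d => (ω x : Measure (UnitStep d)) {e} :=
  (Measure.measurable_coe (measurableSet_singleton e)).comp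
    (measurable_subtype_coe.comp (measurable_pi_apply x))

lemma measurable_stepsOf [NeZero d] : Measurable (stepsOf (d := d)) := by
  classical
  refine measurable_pi_lambda _ fun n => ?_
  have : (fun X : ℕ → Lattice d => stepsOf X n) = (fun e : Lattice d =>
      if h : ∃ i : Fin d, e = Pi.single i 1 ∨ e = -Pi.single i 1 then
        (⟨e, h⟩ : UnitStep d) else default) ∘ fun X => X (n + 1) - X n := rfl
  rw [this]
  exact Measurable.of_discrete.comp (by fun_prop)

/-- The Markov property of the quenched law at a fixed time, for a target set `B (X n)` which may
depend on the current position. -/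
lemma quenchedLaw_next (ω : Env d) (n : ℕ) {A : Set (ℕ → Lattice d)}
    (hA : DependsOn (fun X => X ∈ A) (Set.Iic n)) (B : Lattice d → Set (Lattice d)) :
    quenchedLaw ω (A ∩ {X | X (n + 1) ∈ B (X n)}) =
      ∫⁻ X in A, stepKernel ω (X n) (B (X n)) ∂quenchedLaw ω := by
  classical
  set A' : Set (Finset.Iic n → Lattice d) := {h | (fun i => if hi : i ∈ Finset.Iic n then
    h ⟨i, hi⟩ else 0) ∈ A} with hA'
  have hAA : ∀ X : ℕ → Lattice d,
      Preorder.frestrictLe (π := fun _ => Lattice d) n X ∈ A' ↔ X ∈ A := by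
    intro X
    have := hA (x := fun i => if hi : i ∈ Finset.Iic n then X i else 0) (y := X) (by
      intro i hi
      have : i ≤ n := hi
      simp [this])
    simp only [hA', Set.mem_ofPred_eq]
    exact iff_of_eq this
  have key := Kernel.map_frestrictLe_trajMeasure_compProd_eq_map_trajMeasure
    (X := fun _ => Lattice d) (μ₀ := Measure.dirac 0) (κ := walkKernel ω) (a := n)
  change ((quenchedLaw ω).map (Preorder.frestrictLe (π := fun _ => Lattice d) n)) ⊗ₘ
    walkKernel ω n = (quenchedLaw ω).map _ at key
  let T : Set ((Finset.Iic n → Lattice d) × Lattice d) :=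
    {p | p.1 ∈ A' ∧ p.2 ∈ B (p.1 ⟨n, Finset.mem_Iic.2 le_rfl⟩)}
  have hT : MeasurableSet T := MeasurableSet.of_discrete
  have h1 := congrArg (fun m => m T) key
  rw [Measure.map_apply (by fun_prop) hT, Measure.compProd_apply hT,
    lintegral_map (measurable_of_countable _) (by fun_prop)] at h1
  have h2 : (fun X : ℕ → Lattice d =>
      (Preorder.frestrictLe (π := fun _ => Lattice d) n X, X (n + 1))) ⁻¹' T =
      A ∩ {X | X (n + 1) ∈ B (X n)} := by
    ext X
    simp only [T, Set.mem_preimage, Set.mem_ofPred_eq, hAA, Set.mem_inter_iff]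
    rfl
  rw [h2] at h1
  have hAm : MeasurableSet A := by
    have : A = Preorder.frestrictLe (π := fun _ => Lattice d) n ⁻¹' A' := by
      ext X; exact (hAA X).symm
    rw [this]
    exact (show Measurable (Preorder.frestrictLe (π := fun _ => Lattice d) n) by fun_prop)
      MeasurableSet.of_discrete
  rw [← h1, ← lintegral_indicator hAm]
  refine lintegral_congr fun X => ?_
  by_cases hX : X ∈ A
  · rw [Set.indicator_of_mem hX]
    change (stepKernel ω (X n)) _ = _
    congr 1
    ext y
    simp only [T, Set.mem_preimage, Set.mem_ofPred_eq, (hAA X).2 hX, true_and]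
    rfl
  · rw [Set.indicator_of_notMem hX]
    have : Prod.mk (Preorder.frestrictLe (π := fun _ => Lattice d) n X) ⁻¹' T = ∅ := by
      ext y
      simp [T, hAA, hX]
    rw [this]; simp

end

/-! ### The quenched law of the steps -/

section

variable {d : ℕ}

lemma cyl_succ (n : ℕ) (s : Steps d) : cyl (n + 1) s = cyl n s ∩ {t | t n = s n} := by
  ext t
  simp only [cyl, Set.mem_ofPred_eq, Set.mem_inter_iff, Nat.lt_succ_iff_lt_or_eq, or_imp,
    forall_and, forall_eq]

lemma pathWeight_succ (ω : Env d) (n : ℕ) (s : Steps d) :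
    pathWeight ω (n + 1) s = (ω 0 : Measure (UnitStep d)) {s 0} *
      pathWeight (translate (s 0).1 ω) n (shift 1 s) := by
  rw [pathWeight, Finset.prod_range_succ', mul_comm]
  congr 1
  refine Finset.prod_congr rfl fun i _ => ?_
  rw [pos_succ', translate, shift, add_comm 1 i]

lemma translate_translate (x y : Lattice d) (ω : Env d) :
    translate x (translate y ω) = translate (y + x) ω := by
  funext z; simp [translate, add_assoc]

lemma translate_zero (ω : Env d) : translate 0 ω = ω := by
  funext z; simp [translate]

lemma quenchedLaw_start (ω : Env d) : ∀ᵐ X ∂quenchedLaw ω, X 0 = 0 := by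
  have h : (quenchedLaw ω).map (Preorder.frestrictLe (π := fun _ => Lattice d) 0) =
          (Measure.dirac (0 : Lattice d)).map
            (MeasurableEquiv.piUnique (fun _ : Finset.Iic 0 => Lattice d)).symm := by
    rw [quenchedLaw, Kernel.trajMeasure, Measure.map_comp _ _ (by fun_prop),
      Kernel.traj_map_frestrictLe, Kernel.partialTraj_self, Measure.id_comp]
  have h1 : ∀ᵐ x ∂((quenchedLaw ω).map (Preorder.frestrictLe (π := fun _ => Lattice d) 0)),
      x ⟨0, Finset.mem_Iic.2 le_rfl⟩ = 0 := by
    rw [h, ae_map_iff (by fun_prop) MeasurableSet.of_discrete, ae_dirac_eq]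
    rfl
  exact ae_of_ae_map (by fun_prop) h1

variable [NeZero d]

/-- Almost surely the path is recovered from its steps. -/
lemma quenchedLaw_ae_path (ω : Env d) : ∀ᵐ X ∂quenchedLaw ω, X = pos (stepsOf X) := by
  have h : ∀ n : ℕ, ∀ᵐ X ∂quenchedLaw ω,
      ∃ i : Fin d, X (n + 1) - X n = Pi.single i 1 ∨ X (n + 1) - X n = -Pi.single i 1 := by
    intro n
    have := quenchedLaw_next ω n (A := Set.univ) (fun _ _ _ => rfl)
      (fun x => {y | ¬ ∃ i : Fin d, y - x = Pi.single i 1 ∨ y - x = -Pi.single i 1})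
    rw [Set.univ_inter] at this
    rw [ae_iff]
    refine this.trans ?_
    rw [lintegral_eq_zero_iff' (Measurable.aemeasurable ?_)]
    · refine Eventually.of_forall fun X => ?_
      change ((ω (X n) : Measure (UnitStep d)).map fun e => X n + e.1) _ = 0
      rw [Measure.map_apply Measurable.of_discrete MeasurableSet.of_discrete]
      convert measure_empty (μ := (ω (X n) : Measure (UnitStep d)))
      ext e
      exact iff_of_false (fun h => h (by simpa using e.2)) id
    · exact (Measurable.of_discrete (f := fun x : Lattice d => stepKernel ω x
        {y | ¬ ∃ i : Fin d, y - x = Pi.single i 1 ∨ y - x = -Pi.single i 1})).comp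
        (measurable_pi_apply n)
  filter_upwards [quenchedLaw_start ω, ae_all_iff.2 h] with X h0 hX
  funext n
  induction n with
  | zero => simpa using h0
  | succ n ih =>
    rw [pos_succ, ← ih, stepsOf, dif_pos (hX n)]
    simp

/-- The quenched law of the sequence of steps of the walk. -/
noncomputable def stepLaw (ω : Env d) : Measure (Steps d) := (quenchedLaw ω).map stepsOf

instance (ω : Env d) : IsProbabilityMeasure (stepLaw ω) :=
  Measure.isProbabilityMeasure_map measurable_stepsOf.aemeasurable

lemma stepLaw_cyl (ω : Env d) (n : ℕ) (s : Steps d) :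
    stepLaw ω (cyl n s) = pathWeight ω n s := by
  classical
  induction n with
  | zero => simp [cyl, pathWeight]
  | succ n ih =>
    rw [pathWeight, Finset.prod_range_succ, ← pathWeight, ← ih, stepLaw,
      Measure.map_apply measurable_stepsOf (measurableSet_cyl _ _),
      Measure.map_apply measurable_stepsOf (measurableSet_cyl _ _), cyl_succ]
    let st : Lattice d → Lattice d → UnitStep d := fun x y =>
      if h : ∃ i : Fin d, y - x = Pi.single i 1 ∨ y - x = -Pi.single i 1
      then ⟨y - x, h⟩ else default
    have key := quenchedLaw_next ω n (A := stepsOf ⁻¹' cyl n s) (by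
      intro X Y hXY
      have : ∀ i < n, stepsOf X i = stepsOf Y i := by
        intro i hi
        have h1 := hXY i (show i ≤ n by omega)
        have h2 := hXY (i + 1) (show i + 1 ≤ n by omega)
        simp only [stepsOf, h1, h2]
      simp only [cyl, Set.mem_preimage, Set.mem_ofPred_eq, eq_iff_iff]
      exact forall₂_congr fun i hi => by rw [this i hi])
      (fun x => {y | st x y = s n})
    have hset : stepsOf ⁻¹' (cyl n s ∩ {t | t n = s n}) =
        stepsOf ⁻¹' cyl n s ∩ {X : ℕ → Lattice d | X (n + 1) ∈ {y | st (X n) y = s n}} := rfl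
    rw [hset, key]
    have hk : ∀ x : Lattice d, stepKernel ω x {y | st x y = s n} =
        (ω x : Measure (UnitStep d)) {s n} := by
      intro x
      change ((ω x : Measure (UnitStep d)).map fun e => x + e.1) _ = _
      rw [Measure.map_apply Measurable.of_discrete MeasurableSet.of_discrete]
      congr 1
      ext e
      have : ∃ i : Fin d, (x + e.1) - x = Pi.single i 1 ∨ (x + e.1) - x = -Pi.single i 1 := by
        simpa using e.2
      simp only [Set.mem_preimage, Set.mem_ofPred_eq, st, dif_pos this, Set.mem_singleton_iff]
      rw [← Subtype.coe_inj, ← Subtype.coe_inj]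
      simp
    simp_rw [hk]
    have hm := measurable_stepsOf (measurableSet_cyl n s)
    rw [setLIntegral_congr_fun_ae (g := fun _ => (ω (pos s n) : Measure (UnitStep d)) {s n}) hm,
      setLIntegral_const, mul_comm]
    filter_upwards [quenchedLaw_ae_path ω] with X hX hXc
    have : X n = pos s n := by
      conv_lhs => rw [hX]
      exact pos_congr hXc
    rw [this]

/-- Extension of a finite sequence of steps to an infinite one. -/
noncomputable def extend {n : ℕ} (v : Fin n → UnitStep d) : Steps d := fun i =>
  if h : i < n then v ⟨i, h⟩ else default

lemma extend_restrict (n : ℕ) (s : Steps d) :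
    ∀ i < n, extend (fun j : Fin n => s j) i = s i := by
  intro i hi
  simp [extend, hi]

lemma biUnion_cyl {n : ℕ} {B : Set (Steps d)}
    (hB : DependsOn (fun s => s ∈ B) (Set.Iio n)) :
    B = ⋃ v ∈ (Set.toFinite {v : Fin n → UnitStep d | extend v ∈ B}).toFinset,
      cyl n (extend v) := by
  ext s
  simp only [Set.Finite.mem_toFinset, Set.mem_ofPred_eq, Set.mem_iUnion, exists_prop]
  constructor
  · intro hs
    refine ⟨fun j => s j, ?_, fun i hi => (extend_restrict n s i hi).symm⟩
    exact (iff_of_eq (hB fun i hi => extend_restrict n s i hi)).2 hs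
  · rintro ⟨v, hv, hsv⟩
    exact (iff_of_eq (hB fun i hi => hsv i hi)).2 hv

lemma pairwiseDisjoint_cyl {n : ℕ} (T : Set (Fin n → UnitStep d)) :
    T.PairwiseDisjoint fun v => cyl n (extend v) := by
  intro v _ w _ hvw
  rw [Function.onFun, Set.disjoint_left]
  intro s hs ht
  refine hvw (funext fun i => ?_)
  have h1 := hs i.1 i.2
  have h2 := ht i.1 i.2
  simpa [extend] using h1.symm.trans h2

lemma measurableSet_of_dependsOn {n : ℕ} {B : Set (Steps d)}
    (hB : DependsOn (fun s => s ∈ B) (Set.Iio n)) : MeasurableSet B := by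
  rw [biUnion_cyl hB]
  exact Finset.measurableSet_biUnion _ fun v _ => measurableSet_cyl _ _

/-- A measure of a set that depends on the first `n` steps is a finite sum over the cylinders of
length `n`. -/
lemma measure_inter_eq_sum (ρ : Measure (Steps d)) {n : ℕ} {B G : Set (Steps d)}
    (hB : DependsOn (fun s => s ∈ B) (Set.Iio n)) (hG : MeasurableSet G) :
    ρ (B ∩ G) = ∑ v ∈ (Set.toFinite {v : Fin n → UnitStep d | extend v ∈ B}).toFinset,
      ρ (cyl n (extend v) ∩ G) := by
  conv_lhs => rw [biUnion_cyl hB]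
  rw [Set.iUnion₂_inter, measure_biUnion_finset]
  · intro v hv w hw hvw
    exact (pairwiseDisjoint_cyl _ hv hw hvw).mono Set.inter_subset_left Set.inter_subset_left
  · exact fun v _ => (measurableSet_cyl _ _).inter hG

/-- Finite measures on step sequences are determined by their values on cylinders. -/
lemma ext_of_cyl {ρ σ : Measure (Steps d)} [IsFiniteMeasure ρ]
    (h : ∀ n s, ρ (cyl n s) = σ (cyl n s)) : ρ = σ := by
  have hdep : ∀ (n : ℕ) (B : Set (Steps d)), DependsOn (fun s => s ∈ B) (Set.Iio n) →
      ρ B = σ B := by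
    intro n B hB
    have h1 := measure_inter_eq_sum ρ hB MeasurableSet.univ
    have h2 := measure_inter_eq_sum σ hB MeasurableSet.univ
    simp only [Set.inter_univ] at h1 h2
    rw [h1, h2]
    exact Finset.sum_congr rfl fun v _ => h _ _
  refine ext_of_generate_finite _ generateFrom_measurableCylinders.symm
    isPiSystem_measurableCylinders ?_ (hdep 0 _ fun _ _ _ => rfl)
  intro t ht
  obtain ⟨S, T, hT, rfl⟩ := (mem_measurableCylinders t).1 ht
  refine hdep (S.sup id + 1) _ fun s s' hss => ?_
  have : S.restrict s = S.restrict s' := by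
    funext i
    exact hss i.1 (Nat.lt_succ_of_le (Finset.le_sup (f := id) i.2))
  simp only [mem_cylinder, this]

/-- The Markov property after one step, as an identity of measures. -/
lemma stepLaw_restrict_map (ω : Env d) (e : UnitStep d) :
    ((stepLaw ω).restrict {s | s 0 = e}).map (shift 1) =
      (ω 0 : Measure (UnitStep d)) {e} • stepLaw (translate e.1 ω) := by
  refine ext_of_cyl fun n s => ?_
  rw [Measure.map_apply (measurable_shift 1) (measurableSet_cyl _ _),
    Measure.restrict_apply (measurable_shift 1 (measurableSet_cyl _ _)),
    Measure.smul_apply, stepLaw_cyl, smul_eq_mul]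
  let s' : Steps d := fun i => if i = 0 then e else s (i - 1)
  have h1 : shift 1 ⁻¹' cyl n s ∩ {s | s 0 = e} = cyl (n + 1) s' := by
    ext t
    simp only [cyl, shift, Set.mem_inter_iff, Set.mem_preimage, Set.mem_ofPred_eq, s']
    constructor
    · rintro ⟨h2, h3⟩ i hi
      rcases i with _ | i
      · simpa using h3
      · simpa [add_comm] using h2 i (by omega)
    · intro h2
      refine ⟨fun i hi => ?_, by simpa using h2 0 (by omega)⟩
      simpa [add_comm] using h2 (i + 1) (by omega)
  have h4 : shift 1 s' = s := by
    funext i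
    have : 1 + i ≠ 0 := by omega
    simp [shift, s']
  rw [h1, stepLaw_cyl, pathWeight_succ, h4]
  rfl

/-- The Markov property after one step. -/
lemma stepLaw_markov_one (ω : Env d) (e : UnitStep d) {G : Set (Steps d)}
    (hG : MeasurableSet G) :
    stepLaw ω ({s | s 0 = e} ∩ shift 1 ⁻¹' G) =
      (ω 0 : Measure (UnitStep d)) {e} * stepLaw (translate e.1 ω) G := by
  have := congrArg (fun m => m G) (stepLaw_restrict_map ω e)
  simp only [Measure.map_apply (measurable_shift 1) hG,
      Measure.restrict_apply (measurable_shift 1 hG),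
      Measure.smul_apply, smul_eq_mul] at this
  rw [Set.inter_comm, this]

/-- The Markov property: after following the first `n` steps of `s`, the walk starts afresh in the
environment seen from its current position. -/
lemma stepLaw_markov (ω : Env d) (n : ℕ) (s : Steps d) {G : Set (Steps d)}
    (hG : MeasurableSet G) :
    stepLaw ω (cyl n s ∩ shift n ⁻¹' G) =
      pathWeight ω n s * stepLaw (translate (pos s n) ω) G := by
  induction n generalizing ω s with
  | zero =>
    have : shift (d := d) 0 = id := funext shift_zero
    simp [cyl, pathWeight, this, translate_zero]
  | succ n ih =>
    have h1 : cyl (n + 1) s ∩ shift (n + 1) ⁻¹' G =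
        {t | t 0 = s 0} ∩ shift 1 ⁻¹' (cyl n (shift 1 s) ∩ shift n ⁻¹' G) := by
      ext t
      simp only [cyl, Set.mem_inter_iff, Set.mem_preimage, Set.mem_ofPred_eq, shift_shift,
        add_comm 1 n]
      constructor
      · rintro ⟨h2, h3⟩
        exact ⟨h2 0 (by omega), fun i hi => h2 _ (by omega), h3⟩
      · rintro ⟨h2, h3, h4⟩
        refine ⟨fun i hi => ?_, h4⟩
        rcases i with _ | i
        · exact h2
        · simpa [shift, add_comm] using h3 i (by omega)
    rw [h1, stepLaw_markov_one _ _ ((measurableSet_cyl _ _).inter (measurable_shift n hG)), ih,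
      pathWeight_succ, translate_translate, pos_succ', mul_assoc]

end

/-! ### Independence at fresh times -/

section

variable {d : ℕ}

lemma measurePreserving_translate (μ : Measure (ProbabilityMeasure (UnitStep d)))
    [IsProbabilityMeasure μ] (x : Lattice d) :
    MeasurePreserving (translate x) (envLaw μ) (envLaw μ) :=
  ⟨measurable_translate x, Measure.map_infinitePi_infinitePi_of_inj
    (P := fun _ : Lattice d => μ) (f := fun y => x + y) (add_right_injective x)⟩

lemma measurable_of_dependsOn_env [Nonempty (Env d)] {f : Env d → ENNReal} {U : Set (Lattice d)}
    (hf : Measurable f) (hU : DependsOn f U) :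
    Measurable[⨆ i ∈ U, MeasurableSpace.comap (fun ω : Env d => ω i) inferInstance] f := by
  classical
  obtain ⟨ω₀⟩ := ‹Nonempty (Env d)›
  have h1 : f = f ∘ fun ω i => if i ∈ U then ω i else ω₀ i := by
    funext ω
    exact hU fun i hi => by simp [hi]
  rw [h1]
  refine hf.comp ?_
  refine @measurable_pi_lambda _ _ _ (_) _ _ fun i => ?_
  by_cases hi : i ∈ U
  · simp only [hi, if_true]
    exact Measurable.mono (comap_measurable _) (le_iSup₂ (f := fun i (_ : i ∈ U) =>
      MeasurableSpace.comap (fun ω : Env d => ω i) inferInstance) i hi) le_rfl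
  · simp only [hi, if_false]
    exact @measurable_const _ _ _ (_) _

/-- Functions of disjoint parts of an i.i.d. environment are independent. -/
lemma lintegral_mul_of_dependsOn (μ : Measure (ProbabilityMeasure (UnitStep d)))
    [IsProbabilityMeasure μ] {f g : Env d → ENNReal} (hf : Measurable f) (hg : Measurable g)
    {U V : Set (Lattice d)} (hU : DependsOn f U) (hV : DependsOn g V) (hUV : Disjoint U V) :
    ∫⁻ ω, f ω * g ω ∂envLaw μ = (∫⁻ ω, f ω ∂envLaw μ) * ∫⁻ ω, g ω ∂envLaw μ := by
  have : Nonempty (Env d) := (envLaw μ).nonempty_of_neZero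
  have hle : ∀ i : Lattice d, MeasurableSpace.comap (fun ω : Env d => ω i) inferInstance ≤
      (inferInstance : MeasurableSpace (Env d)) := fun i => (measurable_pi_apply i).comap_le
  have hind : iIndepFun (fun (i : Lattice d) (ω : Env d) => ω i) (envLaw μ) :=
    iIndepFun_infinitePi (X := fun (_ : Lattice d) (p : ProbabilityMeasure (UnitStep d)) => p)
      (fun _ => measurable_id)
  have := indep_iSup_of_disjoint hle hind hUV
  exact lintegral_mul_eq_lintegral_mul_lintegral_of_independent_measurableSpace
    (iSup₂_le fun i _ => hle i) (iSup₂_le fun i _ => hle i) this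
    (measurable_of_dependsOn_env hf hU) (measurable_of_dependsOn_env hg hV)

/-- `n` is a time at which the walk reaches a new strict maximum in the direction `φ`. -/
def Fresh (φ : Lattice d →+ ℝ) (n : ℕ) (s : Steps d) : Prop :=
  ∀ k < n, φ (pos s k) < φ (pos s n)

/-- The walks that never go below their starting level in the direction `φ`. -/
def Stay (φ : Lattice d →+ ℝ) : Set (Steps d) := {s | ∀ n, 0 ≤ φ (pos s n)}

lemma measurableSet_stay (φ : Lattice d →+ ℝ) : MeasurableSet (Stay φ) := by
  have : Stay φ = ⋂ n, (fun s => pos s n) ⁻¹' {x | 0 ≤ φ x} := by ext; simp [Stay]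
  rw [this]
  exact MeasurableSet.iInter fun n => measurable_pos n MeasurableSet.of_discrete

lemma pathWeight_dependsOn {φ : Lattice d →+ ℝ} {n : ℕ} {s : Steps d} (h : Fresh φ n s) :
    DependsOn (fun ω => pathWeight ω n s) {y | φ y < φ (pos s n)} := by
  intro ω ω' hω
  refine Finset.prod_congr rfl fun i hi => ?_
  rw [hω (pos s i) (h i (Finset.mem_range.1 hi))]

lemma measurable_pathWeight (n : ℕ) (s : Steps d) :
    Measurable fun ω : Env d => pathWeight ω n s :=
  Finset.measurable_prod _ fun _ _ => measurable_prob _ _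

variable [NeZero d]

lemma measurable_stepLaw : Measurable (stepLaw (d := d)) :=
  (Measure.measurable_map _ measurable_stepsOf).comp measurable_quenchedLaw

lemma measurable_stepLaw_apply {G : Set (Steps d)} (hG : MeasurableSet G) :
    Measurable fun ω => stepLaw ω G :=
  (Measure.measurable_coe hG).comp measurable_stepLaw

variable (μ : Measure (ProbabilityMeasure (UnitStep d))) [IsProbabilityMeasure μ]

/-- The annealed law of the sequence of steps of the walk. -/
noncomputable def stepAnn : Measure (Steps d) :=
  (annealedLaw μ).map fun p => stepsOf p.2

instance : IsProbabilityMeasure (stepAnn μ) :=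
  Measure.isProbabilityMeasure_map (measurable_stepsOf.comp measurable_snd).aemeasurable

lemma stepAnn_apply {G : Set (Steps d)} (hG : MeasurableSet G) :
    stepAnn μ G = ∫⁻ ω, stepLaw ω G ∂envLaw μ := by
  have hm : Measurable fun p : Env d × (ℕ → Lattice d) => stepsOf p.2 :=
    measurable_stepsOf.comp measurable_snd
  rw [stepAnn, Measure.map_apply hm hG, annealedLaw, Measure.compProd_apply (hm hG)]
  refine lintegral_congr fun ω => ?_
  rw [stepLaw, Measure.map_apply measurable_stepsOf hG]
  rfl

/-- An almost sure property of the annealed walk may be checked on its steps. -/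
lemma annealedLaw_ae {p : (ℕ → Lattice d) → Prop} (h : ∀ᵐ s ∂stepAnn μ, p (pos s)) :
    ∀ᵐ q ∂annealedLaw μ, p q.2 := by
  have hm : Measurable fun q : Env d × (ℕ → Lattice d) => stepsOf q.2 :=
    measurable_stepsOf.comp measurable_snd
  have h1 := ae_of_ae_map hm.aemeasurable h
  have h2 : ∀ᵐ q ∂annealedLaw μ, q.2 = pos (stepsOf q.2) := by
    refine Measure.ae_compProd_of_ae_ae ?_ (Eventually.of_forall fun ω => quenchedLaw_ae_path ω)
    refine measurableSet_eq_fun measurable_snd (measurable_pi_lambda _ fun n => ?_)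
    exact (measurable_pos n).comp hm
  filter_upwards [h1, h2] with q hq hq'
  rwa [hq']

lemma lintegral_stepLaw_translate (x : Lattice d) {G : Set (Steps d)} (hG : MeasurableSet G) :
    ∫⁻ ω, stepLaw (translate x ω) G ∂envLaw μ = stepAnn μ G := by
  rw [stepAnn_apply μ hG,
    (measurePreserving_translate μ x).lintegral_comp (measurable_stepLaw_apply hG)]

/-- Almost sure properties of the walk also hold for the walk seen from any later time: the
quenched law of the latter is dominated by a finite sum of translates. -/
lemma quasiMeasurePreserving_shift (n : ℕ) :
    Measure.QuasiMeasurePreserving (shift n) (stepAnn μ) (stepAnn μ) := by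
  refine ⟨measurable_shift n, Measure.AbsolutelyContinuous.mk fun G hG h0 => ?_⟩
  rw [Measure.map_apply (measurable_shift n) hG, stepAnn_apply μ (measurable_shift n hG)]
  have h1 : ∀ ω, stepLaw ω (shift n ⁻¹' G) ≤
      ∑ v : Fin n → UnitStep d, stepLaw (translate (pos (extend v) n) ω) G := by
    intro ω
    have h2 := measure_inter_eq_sum (stepLaw ω) (n := n) (B := Set.univ) (fun _ _ _ => rfl)
      (measurable_shift n hG)
    rw [Set.univ_inter] at h2
    rw [h2]
    refine (Finset.sum_le_sum_of_subset (Finset.subset_univ _)).trans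
      (Finset.sum_le_sum fun v _ => ?_)
    rw [stepLaw_markov _ _ _ hG, ← stepLaw_cyl]
    exact mul_le_of_le_one_left' prob_le_one
  refine le_antisymm ((lintegral_mono h1).trans ?_) zero_le
  rw [lintegral_finsetSum]
  · simp_rw [lintegral_stepLaw_translate μ _ hG, h0]
    simp
  · exact fun v _ => (measurable_stepLaw_apply hG).comp (measurable_translate _)

/-- At a fresh time, the future of the walk is independent of the past, provided that its
quenched law only involves the half-space ahead of the walk. -/
lemma stepAnn_fresh {φ : Lattice d →+ ℝ} {n : ℕ} {B G : Set (Steps d)}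
    (hB : DependsOn (fun s => s ∈ B) (Set.Iio n)) (hBf : ∀ s ∈ B, Fresh φ n s)
    (hG : MeasurableSet G) (hGd : DependsOn (fun ω => stepLaw ω G) {y | 0 ≤ φ y}) :
    stepAnn μ (B ∩ shift n ⁻¹' G) = stepAnn μ B * stepAnn μ G := by
  have hsG := measurable_shift n hG
  have hB0 := measure_inter_eq_sum (stepAnn μ) hB MeasurableSet.univ
  simp only [Set.inter_univ] at hB0
  rw [hB0, measure_inter_eq_sum _ hB hsG, Finset.sum_mul]
  refine Finset.sum_congr rfl fun v hv => ?_
  have hv' : extend v ∈ B := by simpa using hv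
  rw [stepAnn_apply μ ((measurableSet_cyl _ _).inter hsG), stepAnn_apply μ (measurableSet_cyl _ _)]
  simp_rw [stepLaw_markov _ _ _ hG, stepLaw_cyl]
  rw [lintegral_mul_of_dependsOn μ (measurable_pathWeight _ _)
    (g := fun ω => stepLaw (translate (pos (extend v) n) ω) G)
    ((measurable_stepLaw_apply hG).comp (measurable_translate _))
    (pathWeight_dependsOn (hBf _ hv')) (V := {y | φ (pos (extend v) n) ≤ φ y}) ?_ ?_,
    ← lintegral_stepLaw_translate μ (pos (extend v) n) hG]
  · intro ω ω' h
    refine hGd fun y hy => h _ ?_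
    simpa using hy
  · rw [Set.disjoint_left]
    intro y hy
    exact not_le.2 (show φ y < _ from hy)

/-- As long as the walk stays in the half-space ahead of its starting point, it does not see the
environment in the other half-space. -/
lemma stepLaw_stay_dependsOn (φ : Lattice d →+ ℝ) {G : Set (Steps d)} (hG : MeasurableSet G) :
    DependsOn (fun ω => stepLaw ω (G ∩ Stay φ)) {y | 0 ≤ φ y} := by
  intro ω ω' hω
  let T : ℕ → Set (Steps d) := fun N => {s | ∀ k ≤ N, 0 ≤ φ (pos s k)}
  have hT : Stay φ = ⋂ N, T N := by
    ext s
    simp only [Stay, T, Set.mem_ofPred_eq, Set.mem_iInter]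
    exact ⟨fun h N k _ => h k, fun h n => h n n le_rfl⟩
  have hTdep : ∀ N, DependsOn (fun s => s ∈ T N) (Set.Iio N) := by
    intro N s s' h
    simp only [T, Set.mem_ofPred_eq, eq_iff_iff]
    refine forall₂_congr fun k hk => ?_
    rw [pos_congr fun i hi => h i (show i < N by omega)]
  have key : (stepLaw ω).restrict (Stay φ) = (stepLaw ω').restrict (Stay φ) := by
    refine ext_of_cyl fun n s => ?_
    rw [Measure.restrict_apply (measurableSet_cyl _ _),
      Measure.restrict_apply (measurableSet_cyl _ _)]
    have hlim : ∀ ρ : Measure (Steps d), IsProbabilityMeasure ρ →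
        Tendsto (fun N => ρ (cyl n s ∩ T N)) atTop (𝓝 (ρ (cyl n s ∩ Stay φ))) := by
      intro ρ _
      rw [hT, Set.inter_iInter]
      refine tendsto_measure_iInter_atTop (fun N => ((measurableSet_cyl _ _).inter
        (measurableSet_of_dependsOn (hTdep N))).nullMeasurableSet) ?_ ⟨0, measure_ne_top _ _⟩
      intro N N' hN t ht
      exact ⟨ht.1, fun k hk => ht.2 k (hk.trans hN)⟩
    refine tendsto_nhds_unique (hlim (stepLaw ω) inferInstance)
      ((hlim (stepLaw ω') inferInstance).congr' ?_)
    filter_upwards [eventually_ge_atTop n] with N hN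
    have hdep : DependsOn (fun t => t ∈ cyl n s ∩ T N) (Set.Iio N) := by
      intro t t' h
      have h1 := hTdep N h
      have h2 : t ∈ cyl n s ↔ t' ∈ cyl n s :=
        forall₂_congr fun i hi => by rw [h i (show i < N by omega)]
      simp only [Set.mem_inter_iff, eq_iff_iff]
      exact and_congr h2 (iff_of_eq h1)
    have h1 := measure_inter_eq_sum (stepLaw ω) hdep MeasurableSet.univ
    have h2 := measure_inter_eq_sum (stepLaw ω') hdep MeasurableSet.univ
    simp only [Set.inter_univ] at h1 h2
    rw [h1, h2]
    refine Finset.sum_congr rfl fun v hv => ?_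
    have hv' : extend v ∈ cyl n s ∩ T N := by simpa using hv
    rw [stepLaw_cyl, stepLaw_cyl]
    refine Finset.prod_congr rfl fun i hi => ?_
    rw [hω _ (hv'.2 i (Finset.mem_range.1 hi).le)]
  have := congrArg (fun m => m G) key
  simpa only [Measure.restrict_apply hG] using this

end

/-! ### Infinitely many trials -/

section

variable {d : ℕ}

/-- The filtration generated by the steps of the walk; at time `n` it knows the first `n` steps. -/
def stepFiltration (d : ℕ) : Filtration ℕ (inferInstance : MeasurableSpace (Steps d)) where
  seq n := MeasurableSpace.comap (fun (s : Steps d) (i : Fin n) => s i) inferInstance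
  mono' m n hmn := by
    have : (fun (s : Steps d) (i : Fin m) => s i) =
        (fun (v : Fin n → UnitStep d) (i : Fin m) => v (Fin.castLE hmn i)) ∘
          fun (s : Steps d) (i : Fin n) => s i := rfl
    beta_reduce
    rw [this, ← MeasurableSpace.comap_comp]
    exact MeasurableSpace.comap_mono (Measurable.comap_le (by fun_prop))
  le' n := Measurable.comap_le (by fun_prop)

lemma le_iSup_stepFiltration :
    (inferInstance : MeasurableSpace (Steps d)) ≤ ⨆ n, stepFiltration d n := by
  refine iSup_le fun i => le_trans ?_ (le_iSup _ (i + 1))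
  change MeasurableSpace.comap ((fun v : Fin (i + 1) → UnitStep d => v (Fin.last i)) ∘
    fun (s : Steps d) (j : Fin (i + 1)) => s j) _ ≤ _
  rw [← MeasurableSpace.comap_comp]
  exact MeasurableSpace.comap_mono (Measurable.comap_le (measurable_pi_apply _))

lemma dependsOn_of_stepFiltration {n : ℕ} {B : Set (Steps d)}
    (hB : MeasurableSet[stepFiltration d n] B) : DependsOn (fun s => s ∈ B) (Set.Iio n) := by
  obtain ⟨C, -, rfl⟩ := hB
  intro s s' h
  have : (fun i : Fin n => s i) = fun i : Fin n => s' i := funext fun i => h i i.2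
  simp only [Set.mem_preimage, this]

lemma stepFiltration_of_dependsOn [NeZero d] {n : ℕ} {B : Set (Steps d)}
    (hB : DependsOn (fun s => s ∈ B) (Set.Iio n)) : MeasurableSet[stepFiltration d n] B := by
  refine ⟨{v | extend v ∈ B}, MeasurableSet.of_discrete, ?_⟩
  ext s
  exact iff_of_eq (hB fun i hi => extend_restrict n s i hi)

lemma fresh_dependsOn (φ : Lattice d →+ ℝ) (n : ℕ) :
    DependsOn (fun s => s ∈ {s : Steps d | Fresh φ n s}) (Set.Iio n) := by
  intro s s' h
  simp only [Set.mem_ofPred_eq, Fresh, eq_iff_iff]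
  rw [pos_congr h]
  refine forall₂_congr fun k hk => ?_
  rw [pos_congr fun i hi => h i (show i < n by omega)]

variable [NeZero d] (μ : Measure (ProbabilityMeasure (UnitStep d))) [IsProbabilityMeasure μ]

/-- By Lévy's zero-one law, a walk with infinitely many fresh times realizes, after infinitely many
of them, any event of positive probability that only looks at the half-space ahead. -/
lemma fresh_trials (φ : Lattice d →+ ℝ) {G : Set (Steps d)} (hG : MeasurableSet G)
    (hGd : DependsOn (fun ω => stepLaw ω G) {y | 0 ≤ φ y}) (hpos : stepAnn μ G ≠ 0) :
    ∀ᵐ s ∂stepAnn μ, (∀ n₀, ∃ n ≥ n₀, Fresh φ n s) →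
      ∀ n₀, ∃ n ≥ n₀, Fresh φ n s ∧ shift n s ∈ G := by
  have hfm : ∀ n, MeasurableSet {s : Steps d | Fresh φ n s} := fun n =>
    measurableSet_of_dependsOn (fresh_dependsOn φ n)
  have main : ∀ n₀, ∀ᵐ s ∂stepAnn μ, (∀ n₀, ∃ n ≥ n₀, Fresh φ n s) →
      ∃ n ≥ n₀, Fresh φ n s ∧ shift n s ∈ G := by
    intro n₀
    set E : Set (Steps d) := {s | ∃ n ≥ n₀, Fresh φ n s ∧ shift n s ∈ G} with hE
    have hEm : MeasurableSet E := by
      have : E = ⋃ n ≥ n₀, {s | Fresh φ n s} ∩ shift n ⁻¹' G := by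
        ext s; simp [hE, and_left_comm]
      rw [this]
      exact MeasurableSet.iUnion fun n => MeasurableSet.iUnion fun _ =>
        (hfm n).inter (measurable_shift n hG)
    set f : Steps d → ℝ := E.indicator fun _ => 1 with hf
    have hfi : Integrable f (stepAnn μ) := (integrable_const 1).indicator hEm
    set c : ℝ := (stepAnn μ).real G with hc
    have hc0 : 0 < c := ENNReal.toReal_pos hpos (measure_ne_top _ _)
    have hle : ∀ n, ∀ᵐ s ∂stepAnn μ, n₀ ≤ n → Fresh φ n s →
        c ≤ ((stepAnn μ)[f | stepFiltration d n]) s := by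
      intro n
      by_cases hn : n₀ ≤ n
      swap
      · exact Eventually.of_forall fun s h => absurd h hn
      set g : Steps d → ℝ :=
        ({s | Fresh φ n s} ∩ shift n ⁻¹' G).indicator fun _ => 1 with hg
      have hgm : MeasurableSet ({s | Fresh φ n s} ∩ shift n ⁻¹' G) :=
        (hfm n).inter (measurable_shift n hG)
      have hgi : Integrable g (stepAnn μ) := (integrable_const 1).indicator hgm
      have hgf : g ≤ᵐ[stepAnn μ] f := by
        refine Eventually.of_forall fun s => ?_
        exact Set.indicator_le_indicator_of_subset (show _ ⊆ E from fun t ht => ⟨n, hn, ht⟩)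
          (fun _ => zero_le_one) s
      have hmF := stepFiltration_of_dependsOn (fresh_dependsOn φ n)
      -- at a fresh time, the future is independent of the past, with the annealed law itself
      have heq : ({s | Fresh φ n s}.indicator fun _ => c) =ᵐ[stepAnn μ]
          (stepAnn μ)[g | stepFiltration d n] := by
        refine ae_eq_condExp_of_forall_setIntegral_eq ((stepFiltration d).le n) hgi ?_ ?_ ?_
        · exact fun B _ _ => ((integrable_const c).indicator (hfm n)).integrableOn
        · intro B hB _
          have hB' := (stepFiltration d).le n B hB
          rw [setIntegral_indicator (hfm n), setIntegral_indicator hgm]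
          simp only [setIntegral_const, smul_eq_mul, mul_one]
          have := stepAnn_fresh μ (dependsOn_of_stepFiltration (hB.inter hmF))
            (fun s hs => hs.2) hG hGd
          rw [← Set.inter_assoc, measureReal_def, measureReal_def, this, ENNReal.toReal_mul]
          rfl
        · exact (stronglyMeasurable_const.indicator hmF).aestronglyMeasurable
      filter_upwards [heq, condExp_mono (m := stepFiltration d n) hgi hfi hgf] with s h1 h2 _ hs
      rw [← h1, Set.indicator_of_mem (show s ∈ {s | Fresh φ n s} from hs)] at h2
      exact h2
    have hlev := hfi.tendsto_ae_condExp (ℱ := stepFiltration d)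
      ((stronglyMeasurable_const.indicator hEm).mono le_iSup_stepFiltration)
    filter_upwards [hlev, ae_all_iff.2 hle] with s h1 h2 hs
    by_contra hsE
    have hsE' : f s = 0 := Set.indicator_of_notMem (show s ∉ E from hsE) _
    rw [hsE'] at h1
    obtain ⟨N, hN⟩ := eventually_atTop.1 (h1.eventually (gt_mem_nhds hc0))
    obtain ⟨n, hn, hn'⟩ := hs (max N n₀)
    exact absurd (h2 n (le_of_max_le_right hn) hn') (not_le.2 (hN n (le_of_max_le_left hn)))
  filter_upwards [ae_all_iff.2 main] with s hs h n₀
  exact hs n₀ h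

end

/-! ### Zero-one laws for directional transience -/

section

variable {d : ℕ}

/-- The walks that tend to `+∞` in the direction `φ`. -/
def Up (φ : Lattice d →+ ℝ) : Set (Steps d) :=
  {s | Tendsto (fun n => φ (pos s n)) atTop atTop}

/-- The walks that are unbounded above in the direction `φ`. -/
def Unb (φ : Lattice d →+ ℝ) : Set (Steps d) := {s | ∀ K : ℝ, ∃ n, K < φ (pos s n)}

lemma measurable_hom (φ : Lattice d →+ ℝ) (n : ℕ) : Measurable fun s : Steps d => φ (pos s n) :=
  Measurable.of_discrete.comp (measurable_pos n)

lemma measurableSet_up (φ : Lattice d →+ ℝ) : MeasurableSet (Up φ) :=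
  measurableSet_tendsto _ (measurable_hom φ)

lemma up_subset_unb (φ : Lattice d →+ ℝ) : Up φ ⊆ Unb φ := fun _ hs K =>
  (hs.eventually (eventually_gt_atTop K)).exists

lemma shift_mem_stay {φ : Lattice d →+ ℝ} {n : ℕ} {s : Steps d} :
    shift n s ∈ Stay φ ↔ ∀ k, φ (pos s n) ≤ φ (pos s (n + k)) := by
  simp [Stay, pos_add]

lemma shift_mem_up {φ : Lattice d →+ ℝ} {n : ℕ} {s : Steps d} : shift n s ∈ Up φ ↔ s ∈ Up φ := by
  simp only [Up, Set.mem_ofPred_eq]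
  rw [← tendsto_add_atTop_iff_nat (f := fun k => φ (pos s k)) n]
  simp only [add_comm _ n, pos_add, map_add]
  refine ⟨fun h => tendsto_atTop_add_const_left _ _ h, fun h => ?_⟩
  simpa using tendsto_atTop_add_const_left atTop (-φ (pos s n)) h

lemma up_exists_stay {φ : Lattice d →+ ℝ} {s : Steps d} (hs : s ∈ Up φ) :
    ∃ n, shift n s ∈ Stay φ := by
  rw [Up, Set.mem_ofPred_eq, ← Nat.cofinite_eq_atTop] at hs
  obtain ⟨n, hn⟩ := hs.exists_forall_le
  exact ⟨n, shift_mem_stay.2 fun k => hn _⟩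

lemma exists_fresh_of_unb {φ : Lattice d →+ ℝ} {s : Steps d} (hs : s ∈ Unb φ) (n₀ : ℕ) :
    ∃ n ≥ n₀, Fresh φ n s := by
  classical
  obtain ⟨K, hK⟩ := ((Finset.range (n₀ + 1)).image fun k => φ (pos s k)).bddAbove
  have hK' : ∀ k ≤ n₀, φ (pos s k) ≤ K := fun k hk =>
    hK (by simpa using ⟨k, hk, rfl⟩)
  refine ⟨Nat.find (hs K), ?_, fun k hk => ?_⟩
  · by_contra h
    exact absurd (Nat.find_spec (hs K)) (not_lt.2 (hK' _ (not_le.1 h).le))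
  · exact lt_of_le_of_lt (not_lt.1 (Nat.find_min (hs K) hk)) (Nat.find_spec (hs K))

/-- The walks whose first `K` steps are all equal to `e`. -/
def runs (e : UnitStep d) (K : ℕ) : Set (Steps d) := cyl K fun _ => e

lemma pos_const (e : UnitStep d) (n : ℕ) : pos (fun _ => e) n = n • e.1 := by simp [pos]

lemma mem_finite_range_shift {m : ℕ} {s : Steps d} :
    (Set.range (pos (shift m s))).Finite ↔ (Set.range (pos s)).Finite := by
  constructor
  · intro h
    refine ((Set.finite_Iio m).image (pos s) |>.union (h.image fun x => pos s m + x)).subset ?_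
    rintro _ ⟨n, rfl⟩
    rcases lt_or_ge n m with hn | hn
    · exact Or.inl ⟨n, hn, rfl⟩
    · obtain ⟨k, rfl⟩ := Nat.exists_eq_add_of_le hn
      exact Or.inr ⟨_, ⟨k, rfl⟩, (pos_add s m k).symm⟩
  · intro h
    refine (h.image fun x => x - pos s m).subset ?_
    rintro _ ⟨k, rfl⟩
    exact ⟨_, ⟨m + k, rfl⟩, by simp [pos_add]⟩

lemma measurableSet_finite_range :
    MeasurableSet {s : Steps d | (Set.range (pos s)).Finite} := by
  have : {s : Steps d | (Set.range (pos s)).Finite} =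
      ⋃ A : Finset (Lattice d), ⋂ n, (fun s => pos s n) ⁻¹' (A : Set (Lattice d)) := by
    ext s
    simp only [Set.mem_ofPred_eq, Set.mem_iUnion, Set.mem_iInter, Set.mem_preimage]
    constructor
    · exact fun h => ⟨h.toFinset, fun n => by simp⟩
    · rintro ⟨A, hA⟩
      exact A.finite_toSet.subset (by rintro _ ⟨n, rfl⟩; exact hA n)
  rw [this]
  exact MeasurableSet.iUnion fun A => MeasurableSet.iInter fun n =>
    measurable_pos n MeasurableSet.of_discrete

/-- The coordinate `i` as a real-valued homomorphism on the lattice. -/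
def coordHom (i : Fin d) : Lattice d →+ ℝ := (Int.castAddHom ℝ).comp (Pi.evalAddMonoidHom _ i)

lemma coordHom_apply (i : Fin d) (x : Lattice d) : coordHom i x = (x i : ℝ) := rfl

lemma unb_of_infinite_range {s : Steps d} (h : ¬ (Set.range (pos s)).Finite) :
    ∃ i : Fin d, s ∈ Unb (coordHom i) ∨ s ∈ Unb (-coordHom i) := by
  by_contra! hc
  refine h ?_
  have h1 : ∀ i : Fin d, ∃ K : ℤ, ∀ n, pos s n i ≤ K := by
    intro i
    have := (hc i).1
    simp only [Unb, Set.mem_ofPred_eq, not_forall, not_exists, not_lt] at this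
    obtain ⟨K, hK⟩ := this
    refine ⟨⌈K⌉, fun n => ?_⟩
    have h2 := (hK n).trans (Int.le_ceil K)
    rw [coordHom_apply] at h2
    exact_mod_cast h2
  have h2 : ∀ i : Fin d, ∃ K : ℤ, ∀ n, K ≤ pos s n i := by
    intro i
    have := (hc i).2
    simp only [Unb, Set.mem_ofPred_eq, not_forall, not_exists, not_lt] at this
    obtain ⟨K, hK⟩ := this
    refine ⟨-⌈K⌉, fun n => ?_⟩
    have h2 := (hK n).trans (Int.le_ceil K)
    rw [AddMonoidHom.neg_apply, coordHom_apply] at h2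
    have h3 : -(pos s n i) ≤ ⌈K⌉ := by exact_mod_cast h2
    linarith
  choose K hK using h1
  choose L hL using h2
  refine (Set.finite_Icc L K).subset ?_
  rintro _ ⟨n, rfl⟩
  exact ⟨fun i => hL i n, fun i => hK i n⟩

lemma unitStep_eq_of_coord_pos {e : UnitStep d} {i : Fin d} (h : 0 < e.1 i) :
    e.1 = Pi.single i 1 := by
  obtain ⟨j, hj | hj⟩ := e.2 <;> rw [hj] at h ⊢ <;> by_cases hij : i = j
  · rw [hij]
  · simp [hij] at h
  · subst hij; simp at h
  · simp [hij] at h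

lemma unitStep_eq_of_coord_neg {e : UnitStep d} {i : Fin d} (h : e.1 i < 0) :
    e.1 = -Pi.single i 1 := by
  obtain ⟨j, hj | hj⟩ := e.2 <;> rw [hj] at h ⊢ <;> by_cases hij : i = j
  · subst hij; simp at h
  · simp [hij] at h
  · rw [hij]
  · simp [hij] at h

/-- A walk with arbitrarily long runs of a step `e` leaves every slab transversal to `e`. -/
lemma unb_of_runs {φ : Lattice d →+ ℝ} {e : UnitStep d} (he : 0 < φ e.1) {s : Steps d}
    (hs : ∀ K, ∃ n, shift n s ∈ runs e K) : s ∈ Unb φ ∨ s ∈ Unb (-φ) := by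
  by_contra! hc
  simp only [Unb, Set.mem_ofPred_eq, not_forall, not_exists, not_lt, AddMonoidHom.neg_apply] at hc
  obtain ⟨⟨A, hA⟩, ⟨B, hB⟩⟩ := hc
  obtain ⟨K, hK⟩ := exists_nat_gt ((A + B) / φ e.1)
  rw [div_lt_iff₀ he] at hK
  obtain ⟨n, hn⟩ := hs K
  have h1 : φ (pos s (n + K)) = φ (pos s n) + K * φ e.1 := by
    rw [pos_add, map_add, pos_congr hn, pos_const, map_nsmul, nsmul_eq_mul]
  have := hA (n + K)
  have := hB n
  linarith

variable [NeZero d] (μ : Measure (ProbabilityMeasure (UnitStep d))) [IsProbabilityMeasure μ]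

lemma ae_shift {p : Steps d → Prop} (h : ∀ᵐ s ∂stepAnn μ, p s) :
    ∀ᵐ s ∂stepAnn μ, ∀ n, p (shift n s) :=
  ae_all_iff.2 fun n => (quasiMeasurePreserving_shift μ n).ae h

/-- A shift-invariant event which has positive probability together with the existence of a point
of minimal height in the direction `φ` occurs almost surely when the walk is unbounded above in
this direction, in which case the walk moreover tends to infinity. -/
lemma invariant_of_unb (φ : Lattice d →+ ℝ) {F : Set (Steps d)} (hF : MeasurableSet F)
    (hinv : ∀ n s, shift n s ∈ F ↔ s ∈ F)
    (hpos : ¬ ∀ᵐ s ∂stepAnn μ, s ∈ F → ∀ n, shift n s ∉ Stay φ) :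
    ∀ᵐ s ∂stepAnn μ, s ∈ Unb φ → s ∈ F ∧ s ∈ Up φ := by
  have h0 : stepAnn μ (F ∩ Stay φ) ≠ 0 := by
    intro h0
    refine hpos ?_
    filter_upwards [ae_shift μ (measure_eq_zero_iff_ae_notMem.1 h0)] with s hs hsF n hn
    exact hs n ⟨(hinv n s).2 hsF, hn⟩
  filter_upwards [fresh_trials μ φ (hF.inter (measurableSet_stay φ))
    (stepLaw_stay_dependsOn φ hF) h0] with s hs hu
  have h1 := hs (exists_fresh_of_unb hu)
  refine ⟨?_, tendsto_atTop.2 fun K => ?_⟩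
  · obtain ⟨n, -, -, hn⟩ := h1 0
    exact (hinv n s).1 hn.1
  · obtain ⟨n₀, hn₀⟩ := hu K
    obtain ⟨n, hn, hfr, hst⟩ := h1 n₀
    have h2 : K ≤ φ (pos s n) := by
      rcases hn.lt_or_eq with h | h
      · exact (hn₀.trans (hfr n₀ h)).le
      · rw [← h]; exact hn₀.le
    filter_upwards [eventually_ge_atTop n] with k hk
    obtain ⟨j, rfl⟩ := Nat.exists_eq_add_of_le hk
    exact h2.trans (shift_mem_stay.1 hst.2 j)

/-- If the walk goes to infinity in the direction `φ` with positive probability, then it does so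
almost surely on the event that it is unbounded above. -/
lemma up_of_unb (φ : Lattice d →+ ℝ) (hpos : stepAnn μ (Up φ) ≠ 0) :
    ∀ᵐ s ∂stepAnn μ, s ∈ Unb φ → s ∈ Up φ := by
  refine (invariant_of_unb μ φ (measurableSet_up φ) (fun _ _ => shift_mem_up)
    fun h => hpos ?_).mono fun s hs hu => (hs hu).2
  rw [measure_eq_zero_iff_ae_notMem]
  filter_upwards [h] with s hs hsU
  obtain ⟨n, hn⟩ := up_exists_stay hsU
  exact hs hsU n hn

lemma exists_step_of_up (φ : Lattice d →+ ℝ) (hpos : stepAnn μ (Up φ) ≠ 0) :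
    ∃ e : UnitStep d, 0 < φ e.1 ∧ stepAnn μ {s | s 0 = e} ≠ 0 := by
  by_contra! hc
  refine hpos ?_
  rw [measure_eq_zero_iff_ae_notMem]
  have h1 : ∀ᵐ s ∂stepAnn μ, φ (s 0).1 ≤ 0 := by
    have : ∀ e : UnitStep d, ∀ᵐ s ∂stepAnn μ, 0 < φ e.1 → s 0 ≠ e := by
      intro e
      by_cases he : 0 < φ e.1
      · filter_upwards [measure_eq_zero_iff_ae_notMem.1 (hc e he)] with s hs _ using hs
      · exact Eventually.of_forall fun s h => absurd h he
    filter_upwards [ae_all_iff.2 this] with s hs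
    by_contra h
    exact hs (s 0) (not_le.1 h) rfl
  filter_upwards [ae_shift μ h1] with s hs hsU
  have h2 : ∀ n, φ (pos s n) ≤ 0 := by
    intro n
    induction n with
    | zero => simp
    | succ n ih =>
      rw [pos_succ, map_add]
      have := hs n
      simp only [shift, add_zero] at this
      linarith
  obtain ⟨n, hn⟩ := up_subset_unb φ hsU 0
  exact absurd hn (not_lt.2 (h2 n))

lemma stepAnn_runs_ne_zero (θ : Lattice d →+ ℝ) {e : UnitStep d} (hθ : 0 < θ e.1)
    (he : stepAnn μ {s | s 0 = e} ≠ 0) (K : ℕ) : stepAnn μ (runs e K) ≠ 0 := by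
  induction K with
  | zero => simp [runs, cyl]
  | succ K ih =>
    have h1 : runs e (K + 1) = {s | s 0 = e} ∩ shift 1 ⁻¹' runs e K := by
      ext s
      simp only [runs, cyl, shift, Set.mem_ofPred_eq, Set.mem_inter_iff, Set.mem_preimage]
      constructor
      · exact fun h => ⟨h 0 (by omega), fun i hi => h _ (by omega)⟩
      · rintro ⟨h2, h3⟩ i hi
        rcases i with _ | i
        · exact h2
        · rw [add_comm]; exact h3 i (by omega)
    rw [h1, stepAnn_fresh μ (φ := θ) (n := 1) (G := runs e K) ?_ ?_ (measurableSet_cyl _ _)]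
    · exact mul_ne_zero he ih
    · intro ω ω' h
      simp only [runs, stepLaw_cyl]
      refine Finset.prod_congr rfl fun i _ => ?_
      rw [h]
      rw [pos_const, Set.mem_ofPred_eq, map_nsmul]
      positivity
    · intro s s' h
      simp only [Set.mem_ofPred_eq, h 0 (show 0 < 1 by omega)]
    · intro s hs k hk
      obtain rfl : k = 0 := by omega
      have hs' : s 0 = e := hs
      simpa [pos_succ, hs'] using hθ

/-- If the walk is unbounded above in the direction `ψ`, it makes arbitrarily long runs of any
possible step `e` that does not point backwards. -/
lemma exists_runs (ψ θ : Lattice d →+ ℝ) {e : UnitStep d} (hψ : 0 ≤ ψ e.1) (hθ : 0 < θ e.1)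
    (he : stepAnn μ {s | s 0 = e} ≠ 0) :
    ∀ᵐ s ∂stepAnn μ, s ∈ Unb ψ → ∀ K, ∃ n, shift n s ∈ runs e K := by
  have h1 : ∀ K, ∀ᵐ s ∂stepAnn μ, s ∈ Unb ψ → ∃ n, shift n s ∈ runs e K := by
    intro K
    filter_upwards [fresh_trials μ ψ (measurableSet_cyl K fun _ => e) (by
      intro ω ω' h
      simp only [stepLaw_cyl]
      refine Finset.prod_congr rfl fun i _ => ?_
      rw [h]
      rw [pos_const, Set.mem_ofPred_eq, map_nsmul]
      positivity) (stepAnn_runs_ne_zero μ θ hθ he K)] with s hs hu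
    obtain ⟨n, -, -, hn⟩ := hs (exists_fresh_of_unb hu) 0
    exact ⟨n, hn⟩
  filter_upwards [ae_all_iff.2 h1] with s hs hu K using hs K hu

/-- If the walk goes to `+∞` and to `-∞` in the direction `φ` with positive probability each, then
almost surely one of the two occurs. -/
lemma up_or_down (φ : Lattice d →+ ℝ) (h₁ : stepAnn μ (Up φ) ≠ 0)
    (h₂ : stepAnn μ (Up (-φ)) ≠ 0) : ∀ᵐ s ∂stepAnn μ, s ∈ Up φ ∨ s ∈ Up (-φ) := by
  -- If the range were finite with positive probability, `invariant_of_unb` would make it finite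
  -- almost surely on `Up φ`, which is absurd.
  have hinf : ∀ᵐ s ∂stepAnn μ, ¬ (Set.range (pos s)).Finite := by
    by_contra hc
    have key := invariant_of_unb μ φ measurableSet_finite_range (fun n s => mem_finite_range_shift)
      (fun h => hc (by
        filter_upwards [h] with s hs hfin
        have hne : ((fun x => φ x) '' Set.range (pos s)).Finite := hfin.image _
        obtain ⟨_, ⟨_, ⟨n, rfl⟩, rfl⟩, hn⟩ := Set.exists_min_image _ id hne
          ⟨_, _, ⟨0, rfl⟩, rfl⟩
        exact hs hfin n (shift_mem_stay.2 fun k => hn _ ⟨_, ⟨n + k, rfl⟩, rfl⟩)))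
    refine h₁ (measure_eq_zero_iff_ae_notMem.2 ?_)
    filter_upwards [key] with s hs hu
    have hfin := (hs (up_subset_unb φ hu)).1
    obtain ⟨K, hK⟩ := (Set.Finite.image (fun x => φ x) hfin).bddAbove
    obtain ⟨n, hn⟩ := up_subset_unb φ hu K
    exact absurd (hK ⟨_, ⟨n, rfl⟩, rfl⟩) (not_le.2 hn)
  -- An infinite range makes some coordinate unbounded in one of its directions. One of the two
  -- possible steps `e₁`, `e₂` does not point backwards for this direction, and its long runs make
  -- the walk leave every slab of the direction `φ`.
  obtain ⟨e₁, he₁, hp₁⟩ := exists_step_of_up μ φ h₁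
  obtain ⟨e₂, he₂, hp₂⟩ := exists_step_of_up μ (-φ) h₂
  have hrun : ∀ ψ : Lattice d →+ ℝ, (0 ≤ ψ e₁.1 ∨ 0 ≤ ψ e₂.1) →
      ∀ᵐ s ∂stepAnn μ, s ∈ Unb ψ → s ∈ Unb φ ∨ s ∈ Unb (-φ) := by
    rintro ψ (h | h)
    · filter_upwards [exists_runs μ ψ φ h he₁ hp₁] with s hs hu using unb_of_runs he₁ (hs hu)
    · filter_upwards [exists_runs μ ψ (-φ) h he₂ hp₂] with s hs hu
      simpa [or_comm] using unb_of_runs he₂ (hs hu)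
  have hne : e₁.1 ≠ e₂.1 := by
    intro h
    rw [h] at he₁
    rw [AddMonoidHom.neg_apply] at he₂
    linarith
  have hcoord : ∀ i : Fin d, ∀ᵐ s ∂stepAnn μ,
      (s ∈ Unb (coordHom i) ∨ s ∈ Unb (-coordHom i)) → s ∈ Unb φ ∨ s ∈ Unb (-φ) := by
    intro i
    have hp : 0 ≤ coordHom i e₁.1 ∨ 0 ≤ coordHom i e₂.1 := by
      by_contra! hc
      simp only [coordHom_apply, Int.cast_lt_zero] at hc
      exact hne ((unitStep_eq_of_coord_neg hc.1).trans (unitStep_eq_of_coord_neg hc.2).symm)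
    have hm : 0 ≤ (-coordHom i) e₁.1 ∨ 0 ≤ (-coordHom i) e₂.1 := by
      by_contra! hc
      simp only [AddMonoidHom.neg_apply, coordHom_apply, Left.neg_neg_iff, Int.cast_pos] at hc
      exact hne ((unitStep_eq_of_coord_pos hc.1).trans (unitStep_eq_of_coord_pos hc.2).symm)
    filter_upwards [hrun _ hp, hrun _ hm] with s h3 h4 h5 using h5.elim h3 h4
  filter_upwards [hinf, ae_all_iff.2 hcoord, up_of_unb μ φ h₁, up_of_unb μ (-φ) h₂]
    with s h3 h4 h5 h6
  obtain ⟨i, hi⟩ := unb_of_infinite_range h3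
  exact (h4 i hi).imp h5 h6

end

/-! ### Laws of large numbers for blocks -/

section

section Blocks
variable {Ω β : Type*} [MeasurableSpace Ω] [MeasurableSpace β] {P : Measure Ω}
  {T : Ω → Ω} {Y : Ω → β}

/-- The strong law of large numbers for the blocks `Y, Y ∘ T, Y ∘ T ∘ T, …` cut out by a
measure-preserving map `T` which is independent of the first block `Y`. -/
lemma strong_law_blocks (hT : MeasurePreserving T P P) (hY : Measurable Y)
    (hind : IndepFun Y T P) {f : β → ℝ} (hf : Measurable f)
    (hint : Integrable (fun ω => f (Y ω)) P) :
    ∀ᵐ ω ∂P, Tendsto (fun n : ℕ => (∑ i ∈ Finset.range n, f (Y (T^[i] ω))) / n) atTop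
      (𝓝 (∫ ω, f (Y ω) ∂P)) := by
  have hfY : Measurable fun ω => f (Y ω) := hf.comp hY
  refine strong_law_ae_real (fun i ω => f (Y (T^[i] ω))) hint ?_ ?_
  · have hlt : ∀ i j, i < j → IndepFun (fun ω => f (Y (T^[i] ω))) (fun ω => f (Y (T^[j] ω))) P := by
      intro i j hij
      obtain ⟨k, rfl⟩ := Nat.exists_eq_add_of_lt hij
      have h0 : IndepFun (fun ω => f (Y ω)) (fun ω => f (Y (T^[k] (T ω)))) P :=
        hind.comp hf (hfY.comp (hT.iterate k).measurable)
      rw [indepFun_iff_measure_inter_preimage_eq_mul] at h0 ⊢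
      intro A B hA hB
      have h1 := h0 A B hA hB
      have hTi := hT.iterate i
      have hA' : MeasurableSet ((fun ω => f (Y ω)) ⁻¹' A) := hfY hA
      have hB' : MeasurableSet ((fun ω => f (Y (T^[k] (T ω)))) ⁻¹' B) :=
        (hfY.comp ((hT.iterate k).measurable.comp hT.measurable)) hB
      have e1 : (fun ω => f (Y (T^[i] ω))) ⁻¹' A = T^[i] ⁻¹' ((fun ω => f (Y ω)) ⁻¹' A) := rfl
      have e2 : (fun ω => f (Y (T^[i + k + 1] ω))) ⁻¹' B =
          T^[i] ⁻¹' ((fun ω => f (Y (T^[k] (T ω)))) ⁻¹' B) := by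
        ext ω
        simp only [Set.mem_preimage]
        rw [show i + k + 1 = (k + 1) + i by omega, Function.iterate_add_apply,
          Function.iterate_succ_apply]
      rw [e1, e2, ← Set.preimage_inter, hTi.measure_preimage (hA'.inter hB').nullMeasurableSet,
        hTi.measure_preimage hA'.nullMeasurableSet, hTi.measure_preimage hB'.nullMeasurableSet, h1]
    intro i j hij
    rcases lt_or_gt_of_ne hij with h | h
    · exact hlt i j h
    · exact (hlt j i h).symm
  · intro i
    refine ⟨(hfY.comp (hT.iterate i).measurable).aemeasurable, hfY.aemeasurable, ?_⟩
    have : (fun ω => f (Y (T^[i] ω))) = (fun ω => f (Y ω)) ∘ T^[i] := rfl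
    rw [this, ← Measure.map_map hfY (hT.iterate i).measurable, (hT.iterate i).map_eq]
    rfl

/-- In the situation of `strong_law_blocks`, nonnegative variables with infinite mean have averages
tending to infinity. -/
lemma strong_law_blocks_atTop [IsProbabilityMeasure P] (hT : MeasurePreserving T P P)
    (hY : Measurable Y)
    (hind : IndepFun Y T P) {f : β → ℝ} (hf : Measurable f) (hf0 : ∀ b, 0 ≤ f b)
    (hint : ¬ Integrable (fun ω => f (Y ω)) P) :
    ∀ᵐ ω ∂P, Tendsto (fun n : ℕ => (∑ i ∈ Finset.range n, f (Y (T^[i] ω))) / n) atTop atTop := by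
  have hfY : Measurable fun ω => f (Y ω) := hf.comp hY
  have hmi : ∀ N : ℕ, Integrable (fun ω => min (f (Y ω)) N) P := by
    intro N
    refine Integrable.of_bound (hfY.min measurable_const).aestronglyMeasurable N
      (Eventually.of_forall fun ω => ?_)
    rw [Real.norm_of_nonneg (le_min (hf0 _) (Nat.cast_nonneg N))]
    exact min_le_right _ _
  have h1 : ∀ N : ℕ, ∀ᵐ ω ∂P, Tendsto
      (fun n : ℕ => (∑ i ∈ Finset.range n, min (f (Y (T^[i] ω))) N) / n) atTop
      (𝓝 (∫ ω, min (f (Y ω)) N ∂P)) := fun N =>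
    strong_law_blocks hT hY hind (f := fun b => min (f b) N) (hf.min measurable_const) (hmi N)
  have h2 : ∀ K : ℝ, ∃ N : ℕ, K < ∫ ω, min (f (Y ω)) N ∂P := by
    by_contra! hc
    obtain ⟨K, hK⟩ := hc
    refine hint ⟨hfY.aestronglyMeasurable, ?_⟩
    rw [hasFiniteIntegral_iff_ofReal (Eventually.of_forall fun ω => hf0 _)]
    have h3 : ∀ ω, ENNReal.ofReal (f (Y ω)) ≤
        liminf (fun N : ℕ => ENNReal.ofReal (min (f (Y ω)) N)) atTop := by
      intro ω
      refine le_liminf_of_le (by isBoundedDefault) ?_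
      obtain ⟨N, hN⟩ := exists_nat_ge (f (Y ω))
      filter_upwards [eventually_ge_atTop N] with n hn
      rw [min_eq_left (hN.trans (by exact_mod_cast hn))]
    calc ∫⁻ ω, ENNReal.ofReal (f (Y ω)) ∂P
        ≤ ∫⁻ ω, liminf (fun N : ℕ => ENNReal.ofReal (min (f (Y ω)) N)) atTop ∂P :=
          lintegral_mono h3
      _ ≤ liminf (fun N : ℕ => ∫⁻ ω, ENNReal.ofReal (min (f (Y ω)) N) ∂P) atTop :=
          lintegral_liminf_le fun N => (hfY.min measurable_const).ennreal_ofReal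
      _ ≤ ENNReal.ofReal K := by
          refine liminf_le_of_le (by isBoundedDefault) fun b hb => ?_
          obtain ⟨N, hN⟩ := hb.exists
          refine hN.trans ?_
          rw [← ofReal_integral_eq_lintegral_ofReal (hmi N)
            (Eventually.of_forall fun ω => le_min (hf0 _) (Nat.cast_nonneg N))]
          exact ENNReal.ofReal_le_ofReal (hK N)
      _ < ⊤ := ENNReal.ofReal_lt_top
  filter_upwards [ae_all_iff.2 h1] with ω hω
  refine tendsto_atTop.2 fun K => ?_
  obtain ⟨N, hN⟩ := h2 K
  filter_upwards [(hω N).eventually (lt_mem_nhds hN)] with n hn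
  refine hn.le.trans ?_
  gcongr
  exact min_le_left _ _

end Blocks

/-- A function squeezed between the values `L k ≤ L (k+1)` on the time interval `[τ k, τ (k+1)]` is
asymptotically linear as soon as `L k / k` and `k / τ k` converge. -/
lemma tendsto_div_of_blocks {τ : ℕ → ℕ} (hτ : StrictMono τ) (hτ0 : τ 0 = 0) {L x : ℕ → ℝ}
    {γ κ : ℝ} (hL : Tendsto (fun k : ℕ => L k / k) atTop (𝓝 γ))
    (hk : Tendsto (fun k : ℕ => (k : ℝ) / τ k) atTop (𝓝 κ)) (hL0 : ∀ k, 0 ≤ L k)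
    (hx : ∀ k n, τ k ≤ n → n ≤ τ (k + 1) → L k ≤ x n ∧ x n ≤ L (k + 1)) :
    Tendsto (fun n : ℕ => x n / n) atTop (𝓝 (γ * κ)) := by
  classical
  have hex : ∀ n : ℕ, ∃ k, τ k ≤ n ∧ n < τ (k + 1) := by
    intro n
    have h1 : ∃ k, n < τ (k + 1) := ⟨n, (Nat.lt_succ_self n).trans_le (hτ.le_apply)⟩
    refine ⟨Nat.find h1, ?_, Nat.find_spec h1⟩
    rcases Nat.eq_zero_or_pos (Nat.find h1) with h | h
    · rw [h, hτ0]; exact Nat.zero_le _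
    · have := Nat.find_min h1 (Nat.pred_lt h.ne')
      rw [Nat.pred_eq_sub_one, Nat.sub_add_cancel h] at this
      exact not_lt.1 this
  choose k hk1 hk2 using hex
  have hktop : Tendsto k atTop atTop := by
    refine tendsto_atTop.2 fun K => ?_
    filter_upwards [eventually_ge_atTop (τ K)] with n hn
    by_contra h
    exact absurd (hk2 n) (not_lt.2 ((hτ.monotone (Nat.succ_le_of_lt (not_le.1 h))).trans hn))
  have hq : Tendsto (fun j : ℕ => (j : ℝ) / (j + 1)) atTop (𝓝 1) :=
    tendsto_natCast_div_add_atTop 1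
  have hq' : Tendsto (fun j : ℕ => ((j : ℝ) + 1) / j) atTop (𝓝 1) := by
    have := hq.inv₀ one_ne_zero
    simpa using this
  have hlow : Tendsto (fun j : ℕ => L j / τ (j + 1)) atTop (𝓝 (γ * κ)) := by
    have h1 := (hL.mul hq).mul ((tendsto_add_atTop_iff_nat 1).2 hk)
    rw [mul_one] at h1
    refine h1.congr' ?_
    filter_upwards [eventually_ge_atTop 1] with j hj
    have hj' : (j : ℝ) ≠ 0 := by positivity
    have hj'' : (j : ℝ) + 1 ≠ 0 := by positivity
    push_cast
    field_simp
  have hup : Tendsto (fun j : ℕ => L (j + 1) / τ j) atTop (𝓝 (γ * κ)) := by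
    have h1 := (((tendsto_add_atTop_iff_nat 1).2 hL).mul hq').mul hk
    rw [mul_one] at h1
    refine h1.congr' ?_
    filter_upwards [eventually_ge_atTop 1] with j hj
    have hj' : (j : ℝ) ≠ 0 := by positivity
    have hj'' : (j : ℝ) + 1 ≠ 0 := by positivity
    push_cast
    field_simp
  refine tendsto_of_tendsto_of_tendsto_of_le_of_le' (hlow.comp hktop) (hup.comp hktop) ?_ ?_
  · filter_upwards [eventually_ge_atTop 1] with n hn
    have hn' : (0 : ℝ) < n := by exact_mod_cast hn
    have h1 := hx (k n) n (hk1 n) (hk2 n).le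
    have h2 : (n : ℝ) ≤ τ (k n + 1) := by exact_mod_cast (hk2 n).le
    exact div_le_div₀ ((hL0 _).trans h1.1) h1.1 hn' h2
  · filter_upwards [hktop.eventually_ge_atTop 1] with n hn
    have h1 := hx (k n) n (hk1 n) (hk2 n).le
    have h0 : 0 < τ (k n) := lt_of_lt_of_le (by omega) hτ.le_apply
    have h0' : (0 : ℝ) < τ (k n) := by exact_mod_cast h0
    have h2 : (τ (k n) : ℝ) ≤ n := by exact_mod_cast hk1 n
    exact div_le_div₀ (hL0 _) h1.2 h0' h2

end

/-! ### Regeneration times -/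

section

variable {d : ℕ}

/-- `n` is a regeneration time of the walk: a positive time at which the walk reaches a new maximum
below which it never goes again. -/
def Reg (φ : Lattice d →+ ℝ) (n : ℕ) (s : Steps d) : Prop :=
  1 ≤ n ∧ Fresh φ n s ∧ shift n s ∈ Stay φ

/-- The first regeneration time, with value `0` if there is none. -/
noncomputable def reg (φ : Lattice d →+ ℝ) (s : Steps d) : ℕ := sInf {n | Reg φ n s}

/-- The walk seen from its first regeneration time. -/
noncomputable def regShift (φ : Lattice d →+ ℝ) (s : Steps d) : Steps d := shift (reg φ s) s

/-- The walks that never go below their starting level and tend to infinity. -/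
def Good (φ : Lattice d →+ ℝ) : Set (Steps d) := Up φ ∩ Stay φ

/-- The condition on the first `n` steps which, for a walk in `Good φ` after time `n`, means that
the walk is in `Good φ` with `n` as first regeneration time; see `good_and_reg_eq_iff`. It says that
no earlier fresh time remains a candidate by time `n`. -/
def Adm (φ : Lattice d →+ ℝ) (n : ℕ) (s : Steps d) : Prop :=
  1 ≤ n ∧ Fresh φ n s ∧ (∀ k ≤ n, 0 ≤ φ (pos s k)) ∧
    ∀ k, 1 ≤ k → k < n → Fresh φ k s → ∃ j, k < j ∧ j ≤ n ∧ φ (pos s j) < φ (pos s k)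

lemma measurableSet_good (φ : Lattice d →+ ℝ) : MeasurableSet (Good φ) :=
  (measurableSet_up φ).inter (measurableSet_stay φ)

lemma fresh_congr {φ : Lattice d →+ ℝ} {n : ℕ} {s t : Steps d} (h : ∀ i < n, s i = t i) :
    Fresh φ n s ↔ Fresh φ n t := iff_of_eq (fresh_dependsOn φ n h)

lemma adm_dependsOn (φ : Lattice d →+ ℝ) (n : ℕ) :
    DependsOn (fun s => s ∈ {s : Steps d | Adm φ n s}) (Set.Iio n) := by
  intro s t h
  have hp : ∀ k ≤ n, pos s k = pos t k := fun k hk =>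
    pos_congr fun i hi => h i (show i < n by omega)
  have hf : ∀ k ≤ n, (Fresh φ k s ↔ Fresh φ k t) := fun k hk =>
    fresh_congr fun i hi => h i (show i < n by omega)
  simp only [Set.mem_ofPred_eq, Adm, eq_iff_iff]
  refine and_congr Iff.rfl (and_congr (hf n le_rfl) (and_congr ?_ ?_))
  · exact forall₂_congr fun k hk => by rw [hp k hk]
  · refine forall_congr' fun k => imp_congr_right fun _ => forall_congr' fun hk =>
      imp_congr (hf k hk.le) (exists_congr fun j => and_congr_right fun _ =>
        and_congr_right fun hj => ?_)
    rw [hp j hj, hp k hk.le]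

lemma fresh_add {φ : Lattice d →+ ℝ} {n m : ℕ} {s : Steps d} (hm : 1 ≤ m) (hn : Fresh φ n s) :
    Fresh φ m (shift n s) ↔ Fresh φ (n + m) s := by
  constructor
  · intro h k hk
    have hadd : ∀ j, φ (pos s (n + j)) = φ (pos s n) + φ (pos (shift n s) j) := fun j => by
      rw [pos_add, map_add]
    rcases lt_or_ge k n with hkn | hkn
    · have h1 := hn k hkn
      have h2 := h 0 hm
      rw [pos_zero, map_zero] at h2
      rw [hadd]
      linarith
    · obtain ⟨j, rfl⟩ := Nat.exists_eq_add_of_le hkn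
      rw [hadd, hadd]
      linarith [h j (by omega)]
  · intro h k hk
    have := h (n + k) (by omega)
    simp only [pos_add, map_add] at this
    linarith

lemma reg_add {φ : Lattice d →+ ℝ} {n m : ℕ} {s : Steps d} (hm : 1 ≤ m) (hn : Fresh φ n s) :
    Reg φ m (shift n s) ↔ Reg φ (n + m) s := by
  simp only [Reg, fresh_add hm hn, shift_shift]
  refine and_congr_left fun _ => ?_
  omega

lemma reg_spec {φ : Lattice d →+ ℝ} {s : Steps d} (h : ∃ n, Reg φ n s) : Reg φ (reg φ s) s :=
  Nat.sInf_mem h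

lemma reg_le {φ : Lattice d →+ ℝ} {n : ℕ} {s : Steps d} (h : Reg φ n s) : reg φ s ≤ n :=
  Nat.sInf_le h

lemma reg_eq_zero {φ : Lattice d →+ ℝ} {s : Steps d} (h : ¬ ∃ n, Reg φ n s) : reg φ s = 0 := by
  have : {n | Reg φ n s} = ∅ := Set.eq_empty_of_forall_notMem fun n hn => h ⟨n, hn⟩
  rw [reg, this, Nat.sInf_empty]

lemma shift_mem_good {φ : Lattice d →+ ℝ} {n : ℕ} {s : Steps d} (hs : s ∈ Up φ)
    (h : shift n s ∈ Stay φ) : shift n s ∈ Good φ := ⟨shift_mem_up.2 hs, h⟩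

lemma good_and_reg_eq_iff {φ : Lattice d →+ ℝ} {n : ℕ} (hn : 1 ≤ n) {s : Steps d} :
    s ∈ Good φ ∧ reg φ s = n ↔ Adm φ n s ∧ shift n s ∈ Good φ := by
  constructor
  · rintro ⟨hs, rfl⟩
    have hex : ∃ n, Reg φ n s := by
      by_contra h
      rw [reg_eq_zero h] at hn
      omega
    obtain ⟨h1, h2, h3⟩ := reg_spec hex
    refine ⟨⟨h1, h2, fun k _ => hs.2 k, fun k hk1 hk2 hk3 => ?_⟩, shift_mem_good hs.1 h3⟩
    by_contra! hc
    refine absurd (reg_le (φ := φ) (n := k) (s := s) ⟨hk1, hk3, shift_mem_stay.2 fun j => ?_⟩)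
      (not_le.2 hk2)
    rcases Nat.eq_zero_or_pos j with rfl | hj
    · exact le_rfl
    rcases le_or_gt (k + j) (reg φ s) with hkj | hkj
    · exact hc _ (by omega) hkj
    · obtain ⟨i, hi⟩ := Nat.exists_eq_add_of_le hkj.le
      rw [hi]
      exact (h2 k hk2).le.trans (shift_mem_stay.1 h3 i)
  · rintro ⟨⟨h1, h2, h3, h4⟩, h5⟩
    have hreg : Reg φ n s := ⟨h1, h2, h5.2⟩
    refine ⟨⟨shift_mem_up.1 h5.1, fun k => ?_⟩, le_antisymm (reg_le hreg) ?_⟩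
    · rcases le_or_gt k n with hk | hk
      · exact h3 k hk
      · obtain ⟨i, rfl⟩ := Nat.exists_eq_add_of_le hk.le
        exact (h3 n le_rfl).trans (shift_mem_stay.1 h5.2 i)
    · by_contra! hc
      obtain ⟨g1, g2, g3⟩ := reg_spec ⟨n, hreg⟩
      obtain ⟨j, hj1, -, hj3⟩ := h4 _ g1 hc g2
      obtain ⟨i, rfl⟩ := Nat.exists_eq_add_of_le hj1.le
      exact absurd (shift_mem_stay.1 g3 i) (not_le.2 hj3)

lemma measurableSet_reg (φ : Lattice d →+ ℝ) (n : ℕ) [NeZero d] :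
    MeasurableSet {s : Steps d | Reg φ n s} := by
  have : {s : Steps d | Reg φ n s} =
      if 1 ≤ n then {s | Fresh φ n s} ∩ shift n ⁻¹' Stay φ else ∅ := by
    ext s
    split_ifs with h <;> simp [Reg, h]
  rw [this]
  split_ifs
  · exact (measurableSet_of_dependsOn (fresh_dependsOn φ n)).inter
      (measurable_shift n (measurableSet_stay φ))
  · exact MeasurableSet.empty

lemma measurable_reg (φ : Lattice d →+ ℝ) [NeZero d] : Measurable (reg φ) := by
  refine measurable_to_countable' fun n => ?_
  have : reg φ ⁻¹' {n} = ({s | Reg φ n s} ∩ ⋂ k ∈ Finset.range n, {s | Reg φ k s}ᶜ) ∪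
      ({s | n = 0} ∩ ⋂ k, {s | Reg φ k s}ᶜ) := by
    ext s
    simp only [Set.mem_preimage, Set.mem_singleton_iff, Set.mem_union, Set.mem_inter_iff,
      Set.mem_ofPred_eq, Set.mem_iInter, Finset.mem_range, Set.mem_compl_iff]
    constructor
    · rintro rfl
      by_cases h : ∃ n, Reg φ n s
      · exact Or.inl ⟨reg_spec h, fun k hk hk' => absurd (reg_le hk') (not_le.2 hk)⟩
      · exact Or.inr ⟨reg_eq_zero h, not_exists.1 h⟩
    · rintro (⟨h1, h2⟩ | ⟨rfl, h2⟩)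
      · refine le_antisymm (reg_le h1) ?_
        by_contra! hc
        exact h2 _ hc (reg_spec ⟨n, h1⟩)
      · exact reg_eq_zero (not_exists.2 h2)
  rw [this]
  refine ((measurableSet_reg φ n).inter (Finset.measurableSet_biInter _ fun k _ =>
    (measurableSet_reg φ k).compl)).union ((MeasurableSet.const _).inter
      (MeasurableSet.iInter fun k => (measurableSet_reg φ k).compl))

lemma measurable_regShift (φ : Lattice d →+ ℝ) [NeZero d] : Measurable (regShift φ) := by
  have h : Measurable fun p : ℕ × Steps d => shift p.1 p.2 :=
    measurable_from_prod_countable_right fun n => measurable_shift n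
  exact h.comp ((measurable_reg φ).prodMk measurable_id)

/-- The first regeneration time and the position at that time. -/
noncomputable def regBlock (φ : Lattice d →+ ℝ) (s : Steps d) : ℕ × Lattice d :=
  (reg φ s, pos s (reg φ s))

lemma measurable_regBlock (φ : Lattice d →+ ℝ) [NeZero d] : Measurable (regBlock φ) := by
  have h : Measurable fun p : ℕ × Steps d => pos p.2 p.1 :=
    measurable_from_prod_countable_right fun n => measurable_pos n
  exact (measurable_reg φ).prodMk (h.comp ((measurable_reg φ).prodMk measurable_id))

/-- The `k`-th regeneration time. -/
noncomputable def regTime (φ : Lattice d →+ ℝ) (s : Steps d) (k : ℕ) : ℕ :=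
  ∑ j ∈ Finset.range k, reg φ ((regShift φ)^[j] s)

lemma iterate_regShift (φ : Lattice d →+ ℝ) (s : Steps d) (k : ℕ) :
    (regShift φ)^[k] s = shift (regTime φ s k) s := by
  induction k with
  | zero => simp [regTime]
  | succ k ih =>
    rw [Function.iterate_succ_apply']
    conv_lhs => rw [regShift]
    conv_lhs => arg 2; rw [ih]
    rw [shift_shift, regTime, regTime, Finset.sum_range_succ]

lemma pos_regTime (φ : Lattice d →+ ℝ) (s : Steps d) (k : ℕ) :
    pos s (regTime φ s k) = ∑ j ∈ Finset.range k, (regBlock φ ((regShift φ)^[j] s)).2 := by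
  induction k with
  | zero => simp [regTime]
  | succ k ih =>
    rw [Finset.sum_range_succ, ← ih, regTime, Finset.sum_range_succ, ← regTime, pos_add,
      ← iterate_regShift]
    rfl

/-- Between two consecutive regeneration times, the height of the walk lies between the heights at
these two times. -/
lemma regTime_bounds {φ : Lattice d →+ ℝ} {s : Steps d} (hs : ∀ j, (regShift φ)^[j] s ∈ Stay φ)
    (hr : ∀ j, ∃ n, Reg φ n ((regShift φ)^[j] s)) {k n : ℕ} (h1 : regTime φ s k ≤ n)
    (h2 : n ≤ regTime φ s (k + 1)) :
    φ (pos s (regTime φ s k)) ≤ φ (pos s n) ∧ φ (pos s n) ≤ φ (pos s (regTime φ s (k + 1))) := by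
  obtain ⟨m, rfl⟩ := Nat.exists_eq_add_of_le h1
  have h3 := hs k
  rw [iterate_regShift] at h3
  refine ⟨shift_mem_stay.1 h3 m, ?_⟩
  have e : regTime φ s (k + 1) = regTime φ s k + reg φ (shift (regTime φ s k) s) := by
    rw [regTime, Finset.sum_range_succ, ← regTime, iterate_regShift]
  have h4 := reg_spec (hr k)
  rw [iterate_regShift] at h4
  rw [e] at h2 ⊢
  rcases h2.lt_or_eq with h | h
  · have := h4.2.1 m (by omega)
    simp only [pos_add, map_add]
    linarith
  · rw [h]

variable [NeZero d] (μ : Measure (ProbabilityMeasure (UnitStep d))) [IsProbabilityMeasure μ]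

lemma good_ne_zero {φ : Lattice d →+ ℝ} (hpos : stepAnn μ (Up φ) ≠ 0) :
    stepAnn μ (Good φ) ≠ 0 := by
  intro h
  refine hpos (measure_eq_zero_iff_ae_notMem.2 ?_)
  filter_upwards [ae_shift μ (measure_eq_zero_iff_ae_notMem.1 h)] with s hs hu
  obtain ⟨n, hn⟩ := up_exists_stay hu
  exact hs n (shift_mem_good hu hn)

lemma good_dependsOn (φ : Lattice d →+ ℝ) {G : Set (Steps d)} (hG : MeasurableSet G) :
    DependsOn (fun ω => stepLaw ω (Good φ ∩ G)) {y | 0 ≤ φ y} := by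
  have : Good φ ∩ G = (Up φ ∩ G) ∩ Stay φ := by rw [Good, Set.inter_right_comm]
  rw [this]
  exact stepLaw_stay_dependsOn φ ((measurableSet_up φ).inter hG)

/-- A walk in `Good φ` has fresh times, and `Good φ` has the same chance to occur after each. -/
lemma ae_exists_reg (φ : Lattice d →+ ℝ) :
    ∀ᵐ s ∂stepAnn μ, s ∈ Good φ → ∃ n, Reg φ n s := by
  by_cases h : stepAnn μ (Good φ) = 0
  · filter_upwards [measure_eq_zero_iff_ae_notMem.1 h] with s hs hs' using absurd hs' hs
  have hd := good_dependsOn φ MeasurableSet.univ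
  rw [Set.inter_univ] at hd
  filter_upwards [fresh_trials μ φ (measurableSet_good φ) hd h] with s hs hg
  obtain ⟨n, hn, hf, hn'⟩ := hs (exists_fresh_of_unb (up_subset_unb φ hg.1)) 1
  exact ⟨n, hn, hf, hn'.2⟩

/-- The path up to the first regeneration time and the future after it are independent, and the
future is distributed as the whole walk, on the event `Good φ`. -/
lemma stepAnn_reg {φ : Lattice d →+ ℝ} {n : ℕ} (hn : 1 ≤ n) {D G : Set (Steps d)}
    (hD : DependsOn (fun s => s ∈ D) (Set.Iio n)) (hG : MeasurableSet G) :
    stepAnn μ (Good φ ∩ ({s | reg φ s = n} ∩ D ∩ regShift φ ⁻¹' G)) =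
      stepAnn μ ({s | Adm φ n s} ∩ D) * stepAnn μ (Good φ ∩ G) := by
  rw [← stepAnn_fresh μ (φ := φ) (n := n) _ _ ((measurableSet_good φ).inter hG)
    (good_dependsOn φ hG)]
  · congr 1
    ext s
    have := good_and_reg_eq_iff (φ := φ) hn (s := s)
    simp only [Set.mem_inter_iff, Set.mem_ofPred_eq, Set.mem_preimage, regShift]
    constructor
    · rintro ⟨h1, ⟨h2, h3⟩, h4⟩
      obtain ⟨h5, h6⟩ := this.1 ⟨h1, h2⟩
      rw [h2] at h4
      exact ⟨⟨h5, h3⟩, h6, h4⟩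
    · rintro ⟨⟨h5, h3⟩, h6, h4⟩
      obtain ⟨h1, h2⟩ := this.2 ⟨h5, h6⟩
      rw [← h2] at h4
      exact ⟨h1, ⟨h2, h3⟩, h4⟩
  · intro s t h
    have h1 := adm_dependsOn φ n h
    have h2 := hD h
    simp only [Set.mem_inter_iff, eq_iff_iff] at h1 h2 ⊢
    exact and_congr h1 h2
  · exact fun s hs => hs.1.2.1

/-- The annealed law conditioned on the event `Good φ`. -/
noncomputable def goodLaw (φ : Lattice d →+ ℝ) : Measure (Steps d) := (stepAnn μ)[|Good φ]

lemma goodLaw_apply (φ : Lattice d →+ ℝ) (A : Set (Steps d)) :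
    goodLaw μ φ A = (stepAnn μ (Good φ))⁻¹ * stepAnn μ (Good φ ∩ A) :=
  cond_apply (measurableSet_good φ) _ _

/-- Under `goodLaw` the walk seen from the first regeneration time is distributed as the walk itself
and is independent of the first block. -/
lemma goodLaw_regBlock {φ : Lattice d →+ ℝ} (hpos : stepAnn μ (Up φ) ≠ 0) (y : ℕ × Lattice d)
    {G : Set (Steps d)} (hG : MeasurableSet G) :
    goodLaw μ φ (regBlock φ ⁻¹' {y} ∩ regShift φ ⁻¹' G) =
      goodLaw μ φ (regBlock φ ⁻¹' {y}) * goodLaw μ φ G := by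
  obtain ⟨n, x⟩ := y
  have hp := good_ne_zero μ hpos
  have hp' : stepAnn μ (Good φ) ≠ ⊤ := measure_ne_top _ _
  rcases Nat.eq_zero_or_pos n with rfl | hn
  · have h0 : goodLaw μ φ (regBlock φ ⁻¹' {(0, x)}) = 0 := by
      rw [goodLaw_apply, mul_eq_zero]
      refine Or.inr (measure_eq_zero_iff_ae_notMem.2 ?_)
      filter_upwards [ae_exists_reg μ φ] with s hs hc
      have h1 := (reg_spec (hs hc.1)).1
      have h2 : reg φ s = 0 := congrArg Prod.fst hc.2
      omega
    rw [h0, zero_mul]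
    exact measure_mono_null Set.inter_subset_left h0
  · have hset : regBlock φ ⁻¹' {(n, x)} = {s | reg φ s = n} ∩ {s | pos s n = x} := by
      ext s
      simp only [regBlock, Set.mem_preimage, Set.mem_singleton_iff, Prod.mk.injEq,
        Set.mem_inter_iff, Set.mem_ofPred_eq]
      exact and_congr_right fun h => by rw [h]
    have hD : DependsOn (fun s => s ∈ {s : Steps d | pos s n = x}) (Set.Iio n) := by
      intro s t h
      simp only [Set.mem_ofPred_eq]
      rw [pos_congr h]
    have k1 := stepAnn_reg μ (φ := φ) hn hD hG
    have k2 := stepAnn_reg μ (φ := φ) hn hD MeasurableSet.univ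
    rw [Set.preimage_univ, Set.inter_univ, Set.inter_univ] at k2
    rw [goodLaw_apply, goodLaw_apply, goodLaw_apply, hset, k1, k2]
    have := ENNReal.inv_mul_cancel hp hp'
    calc (stepAnn μ (Good φ))⁻¹ * (stepAnn μ ({s | Adm φ n s} ∩ {s | pos s n = x}) *
          stepAnn μ (Good φ ∩ G))
        = (stepAnn μ (Good φ))⁻¹ * stepAnn μ ({s | Adm φ n s} ∩ {s | pos s n = x}) * 1 *
          stepAnn μ (Good φ ∩ G) := by ring
      _ = _ := by rw [← this]; ring

lemma isProbabilityMeasure_goodLaw {φ : Lattice d →+ ℝ} (hpos : stepAnn μ (Up φ) ≠ 0) :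
    IsProbabilityMeasure (goodLaw μ φ) :=
  cond_isProbabilityMeasure (good_ne_zero μ hpos)

lemma goodLaw_regBlock_set {φ : Lattice d →+ ℝ} (hpos : stepAnn μ (Up φ) ≠ 0)
    (C : Set (ℕ × Lattice d)) {G : Set (Steps d)} (hG : MeasurableSet G) :
    goodLaw μ φ (regBlock φ ⁻¹' C ∩ regShift φ ⁻¹' G) =
      goodLaw μ φ (regBlock φ ⁻¹' C) * goodLaw μ φ G := by
  have hm := measurable_regBlock (d := d) φ
  have hG' := measurable_regShift φ hG
  have := isProbabilityMeasure_goodLaw μ hpos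
  have key : ((goodLaw μ φ).restrict (regShift φ ⁻¹' G)).map (regBlock φ) =
      goodLaw μ φ G • (goodLaw μ φ).map (regBlock φ) := by
    refine Measure.ext_of_singleton fun y => ?_
    rw [Measure.map_apply hm (measurableSet_singleton y),
      Measure.restrict_apply (hm (measurableSet_singleton y)), goodLaw_regBlock μ hpos y hG,
      Measure.smul_apply, Measure.map_apply hm (measurableSet_singleton y), smul_eq_mul, mul_comm]
  have h := congrArg (fun m => m C) key
  simp only [Measure.smul_apply, Measure.map_apply hm (MeasurableSet.of_discrete (s := C)),
    Measure.restrict_apply (hm (MeasurableSet.of_discrete (s := C))), smul_eq_mul] at h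
  rw [h, mul_comm]

lemma measurePreserving_regShift {φ : Lattice d →+ ℝ} (hpos : stepAnn μ (Up φ) ≠ 0) :
    MeasurePreserving (regShift φ) (goodLaw μ φ) (goodLaw μ φ) := by
  have := isProbabilityMeasure_goodLaw μ hpos
  refine ⟨measurable_regShift φ, Measure.ext fun G hG => ?_⟩
  rw [Measure.map_apply (measurable_regShift φ) hG]
  simpa using goodLaw_regBlock_set μ hpos Set.univ hG

lemma indepFun_regBlock {φ : Lattice d →+ ℝ} (hpos : stepAnn μ (Up φ) ≠ 0) :
    IndepFun (regBlock φ) (regShift φ) (goodLaw μ φ) := by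
  rw [indepFun_iff_measure_inter_preimage_eq_mul]
  intro C G _ hG
  rw [goodLaw_regBlock_set μ hpos C hG,
    (measurePreserving_regShift μ hpos).measure_preimage hG.nullMeasurableSet]

end

/-! ### The speed on the event of directional transience -/

section

variable {d : ℕ}

/-- An integer-valued homomorphism on the lattice, seen as a real-valued one. -/
def castHom (lam : Lattice d →+ ℤ) : Lattice d →+ ℝ := (Int.castAddHom ℝ).comp lam

lemma castHom_apply (lam : Lattice d →+ ℤ) (x : Lattice d) : castHom lam x = (lam x : ℝ) := rfl

lemma tendsto_speed_shift (φ : Lattice d →+ ℝ) (m : ℕ) (s : Steps d) (v : ℝ) :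
    Tendsto (fun n : ℕ => φ (pos (shift m s) n) / n) atTop (𝓝 v) ↔
      Tendsto (fun n : ℕ => φ (pos s n) / n) atTop (𝓝 v) := by
  have hc : Tendsto (fun n : ℕ => φ (pos s m) / n) atTop (𝓝 0) :=
    tendsto_const_div_atTop_nhds_zero_nat _
  have hq : Tendsto (fun n : ℕ => (n : ℝ) / (n + m)) atTop (𝓝 1) :=
    tendsto_natCast_div_add_atTop (m : ℝ)
  rw [← tendsto_add_atTop_iff_nat (f := fun n : ℕ => φ (pos s n) / n) m]
  constructor
  · intro h
    have h1 := (hc.add h).mul hq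
    rw [zero_add, mul_one] at h1
    refine h1.congr' ?_
    filter_upwards [eventually_ge_atTop 1] with n hn
    have hn' : (n : ℝ) ≠ 0 := by positivity
    have hn'' : (n : ℝ) + m ≠ 0 := by positivity
    rw [add_comm n m, pos_add, map_add]
    push_cast
    rw [add_comm (m : ℝ)]
    field_simp
  · intro h
    have h1 := (h.mul (hq.inv₀ one_ne_zero)).sub hc
    rw [inv_one, mul_one, sub_zero] at h1
    refine h1.congr' ?_
    filter_upwards [eventually_ge_atTop 1] with n hn
    have hn' : (n : ℝ) ≠ 0 := by positivity
    have hn'' : (n : ℝ) + m ≠ 0 := by positivity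
    rw [add_comm n m, pos_add, map_add]
    push_cast
    rw [add_comm (m : ℝ)]
    field_simp
    ring

/-- The walk hits the level `i` for the first time at time `n`, without having been at a negative
level before. -/
def Hit (lam : Lattice d →+ ℤ) (i n : ℕ) : Set (Steps d) :=
  {s | Fresh (castHom lam) n s ∧ lam (pos s n) = i ∧ ∀ m ≤ n, 0 ≤ castHom lam (pos s m)}

lemma hit_dependsOn (lam : Lattice d →+ ℤ) (i n : ℕ) :
    DependsOn (fun s => s ∈ Hit lam i n) (Set.Iio n) := by
  intro s t h
  have hp : ∀ k ≤ n, pos s k = pos t k := fun k hk =>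
    pos_congr fun j hj => h j (show j < n by omega)
  simp only [Hit, Set.mem_ofPred_eq, eq_iff_iff]
  rw [hp n le_rfl]
  refine and_congr (fresh_congr h) (and_congr_right fun _ => forall₂_congr fun k hk => ?_)
  rw [hp k hk]

lemma fresh_castHom {lam : Lattice d →+ ℤ} {n : ℕ} {s : Steps d} :
    Fresh (castHom lam) n s ↔ ∀ k < n, lam (pos s k) < lam (pos s n) := by
  simp [Fresh, castHom_apply]

/-- A walk with steps of height at most one that is unbounded above hits every level. -/
lemma exists_hit {lam : Lattice d →+ ℤ} (hlam : ∀ e : UnitStep d, |lam e.1| ≤ 1) {s : Steps d}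
    (hs : s ∈ Good (castHom lam)) (i : ℕ) : ∃ n, s ∈ Hit lam i n := by
  classical
  have hex : ∃ n, (i : ℤ) ≤ lam (pos s n) := by
    obtain ⟨n, hn⟩ := up_subset_unb _ hs.1 i
    rw [castHom_apply] at hn
    exact ⟨n, by exact_mod_cast hn.le⟩
  have h1 := Nat.find_spec hex
  have h2 : ∀ k < Nat.find hex, lam (pos s k) < i := fun k hk => not_le.1 (Nat.find_min hex hk)
  have h3 : lam (pos s (Nat.find hex)) = i := by
    refine le_antisymm ?_ h1
    rcases Nat.eq_zero_or_pos (Nat.find hex) with h | h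
    · rw [h, pos_zero, map_zero]; positivity
    · have h4 := h2 _ (Nat.pred_lt h.ne')
      obtain ⟨m, hm⟩ := Nat.exists_eq_succ_of_ne_zero h.ne'
      rw [hm, Nat.pred_succ] at h4
      rw [hm, Nat.succ_eq_add_one, pos_succ, map_add]
      have := (abs_le.1 (hlam (s m))).2
      linarith
  exact ⟨Nat.find hex, fresh_castHom.2 fun k hk => by rw [h3]; exact h2 k hk, h3,
    fun m _ => hs.2 m⟩

/-- The height gained between the starting point and the first regeneration time. -/
noncomputable def gap (lam : Lattice d →+ ℤ) (s : Steps d) : ℤ :=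
  lam (regBlock (castHom lam) s).2

lemma gap_nonneg (lam : Lattice d →+ ℤ) (s : Steps d) : 0 ≤ gap lam s := by
  by_cases h : ∃ n, Reg (castHom lam) n s
  · obtain ⟨h1, h2, -⟩ := reg_spec h
    have := fresh_castHom.1 h2 0 h1
    rw [pos_zero, map_zero] at this
    exact this.le
  · simp [gap, regBlock, reg_eq_zero h]

lemma gap_le {lam : Lattice d →+ ℤ} {s : Steps d} {n m : ℕ} (hnm : n < m)
    (hn : Fresh (castHom lam) n s) (hm : Fresh (castHom lam) m s)
    (hm' : shift m s ∈ Stay (castHom lam)) :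
    gap lam (shift n s) ≤ lam (pos s m) - lam (pos s n) := by
  obtain ⟨j, rfl⟩ := Nat.exists_eq_add_of_le hnm.le
  have hreg : Reg (castHom lam) j (shift n s) :=
    (reg_add (by omega) hn).2 ⟨by omega, hm, hm'⟩
  rw [pos_add, map_add, add_sub_cancel_left]
  rcases (reg_le hreg).lt_or_eq with h | h
  · exact (fresh_castHom.1 hreg.2.1 _ h).le
  · rw [gap, regBlock, h]

variable [NeZero d] (μ : Measure (ProbabilityMeasure (UnitStep d))) [IsProbabilityMeasure μ]

lemma measurable_gap (lam : Lattice d →+ ℤ) : Measurable (gap lam) :=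
  Measurable.of_discrete.comp (measurable_snd.comp (measurable_regBlock _))

/-- The renewal argument which bounds the mean gap between regeneration levels: for `i ≤ k` the
events "`i` is a regeneration level and the next one is above `k`" are disjoint. -/
lemma sum_gap_le {lam : Lattice d →+ ℤ} (hlam : ∀ e : UnitStep d, |lam e.1| ≤ 1)
    (hpos : stepAnn μ (Up (castHom lam)) ≠ 0) (k : ℕ) :
    ∑ j ∈ Finset.range k, stepAnn μ (Good (castHom lam) ∩ {s | (j : ℤ) < gap lam s}) ≤ 1 := by
  set φ := castHom lam with hφ
  have hp := good_ne_zero μ hpos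
  have hp' : stepAnn μ (Good φ) ≠ ⊤ := measure_ne_top _ _
  have hgm : ∀ j : ℕ, MeasurableSet {s : Steps d | (j : ℤ) < gap lam s} := fun j =>
    measurable_gap lam (MeasurableSet.of_discrete (s := {z | (j : ℤ) < z}))
  let A : ℕ → Set (Steps d) := fun j => Good φ ∩ {s | (j : ℤ) < gap lam s}
  have hA : ∀ j, MeasurableSet (A j) := fun j => (measurableSet_good φ).inter (hgm j)
  -- `Q i`: the level `i` is a regeneration level, and the next one is above `k - 1`
  let Q : ℕ → Set (Steps d) := fun i => ⋃ n, Hit lam i n ∩ shift n ⁻¹' A (k - 1 - i)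
  have hHm : ∀ i n, MeasurableSet (Hit lam i n) := fun i n =>
    measurableSet_of_dependsOn (hit_dependsOn lam i n)
  have hHd : ∀ i, Pairwise fun n m => Disjoint (Hit lam i n) (Hit lam i m) := by
    intro i n m hnm
    rw [Set.disjoint_left]
    rintro s ⟨h1, h2, -⟩ ⟨h3, h4, -⟩
    rcases lt_or_gt_of_ne hnm with h | h
    · have := fresh_castHom.1 h3 n h
      omega
    · have := fresh_castHom.1 h1 m h
      omega
  have hQm : ∀ i, MeasurableSet (Q i) := fun i =>
    MeasurableSet.iUnion fun n => (hHm i n).inter (measurable_shift n (hA _))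
  have hQ : ∀ i, stepAnn μ (Good φ) * stepAnn μ (A (k - 1 - i)) ≤ stepAnn μ (Q i) := by
    intro i
    have h1 : stepAnn μ (Q i) = ∑' n, stepAnn μ (Hit lam i n) * stepAnn μ (A (k - 1 - i)) := by
      rw [measure_iUnion]
      · exact tsum_congr fun n => stepAnn_fresh μ (hit_dependsOn lam i n) (fun s hs => hs.1)
          (hA _) (good_dependsOn φ (hgm _))
      · exact fun n m hnm => (hHd i hnm).mono Set.inter_subset_left Set.inter_subset_left
      · exact fun n => (hHm i n).inter (measurable_shift n (hA _))
    rw [h1, ENNReal.tsum_mul_right, ← measure_iUnion (hHd i) (hHm i)]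
    gcongr
    exact fun s hs => Set.mem_iUnion.2 (exists_hit hlam hs i)
  have hQG : ∀ i, Q i ⊆ Good φ := by
    intro i s hs
    obtain ⟨n, ⟨h1, h2, h3⟩, h4, -⟩ := Set.mem_iUnion.1 hs
    refine ⟨shift_mem_up.1 h4.1, fun m => ?_⟩
    rcases le_or_gt m n with hm | hm
    · exact h3 m hm
    · obtain ⟨j, rfl⟩ := Nat.exists_eq_add_of_le hm.le
      exact (h3 n le_rfl).trans (shift_mem_stay.1 h4.2 j)
  have hQlt : ∀ i i', i < i' → i' < k → Disjoint (Q i) (Q i') := by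
    intro i i' hii hi'
    rw [Set.disjoint_left]
    intro s hs hs'
    obtain ⟨n, ⟨h1, h2, -⟩, -, h4⟩ := Set.mem_iUnion.1 hs
    obtain ⟨m, ⟨g1, g2, -⟩, g3, -⟩ := Set.mem_iUnion.1 hs'
    have hnm : n < m := by
      by_contra! hc
      rcases hc.lt_or_eq with h | h
      · have := fresh_castHom.1 h1 m h
        omega
      · subst h; omega
    have h5 := gap_le hnm h1 g1 g3.2
    have h6 : ((k - 1 - i : ℕ) : ℤ) < gap lam (shift n s) := h4
    omega
  have hsum : ∑ i ∈ Finset.range k, stepAnn μ (Q i) ≤ stepAnn μ (Good φ) := by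
    rw [← measure_biUnion_finset _ fun i _ => hQm i]
    · exact measure_mono (Set.iUnion₂_subset fun i _ => hQG i)
    · intro i hi i' hi' hne
      rw [Finset.mem_coe, Finset.mem_range] at hi hi'
      rcases lt_or_gt_of_ne hne with h | h
      · exact hQlt i i' h hi'
      · exact (hQlt i' i h hi).symm
  have h1 : stepAnn μ (Good φ) * ∑ j ∈ Finset.range k, stepAnn μ (A j) ≤
      stepAnn μ (Good φ) * 1 := by
    rw [mul_one, ← Finset.sum_range_reflect, Finset.mul_sum]
    exact (Finset.sum_le_sum fun i _ => hQ i).trans hsum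
  exact (ENNReal.mul_le_mul_iff_right hp hp').1 h1

/-- The gap is integrable because its tail probabilities are those summed in `sum_gap_le`. -/
lemma integrable_gap {lam : Lattice d →+ ℤ} (hlam : ∀ e : UnitStep d, |lam e.1| ≤ 1)
    (hpos : stepAnn μ (Up (castHom lam)) ≠ 0) :
    Integrable (fun s => (gap lam s : ℝ)) (goodLaw μ (castHom lam)) := by
  have hgm : ∀ j : ℕ, MeasurableSet {s : Steps d | (j : ℤ) < gap lam s} := fun j =>
    measurable_gap lam (MeasurableSet.of_discrete (s := {z | (j : ℤ) < z}))
  refine ⟨(Measurable.of_discrete.comp (measurable_gap lam)).aestronglyMeasurable, ?_⟩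
  rw [hasFiniteIntegral_iff_ofReal
    (Eventually.of_forall fun s => show (0 : ℝ) ≤ gap lam s by exact_mod_cast gap_nonneg lam s)]
  have h1 : ∀ s, ENNReal.ofReal (gap lam s : ℝ) =
      ∑' j : ℕ, {s : Steps d | (j : ℤ) < gap lam s}.indicator (fun _ => (1 : ENNReal)) s := by
    intro s
    obtain ⟨m, hm⟩ := Int.eq_ofNat_of_zero_le (gap_nonneg lam s)
    rw [tsum_eq_sum (s := Finset.range m)]
    · have h2 : ∀ j ∈ Finset.range m,
          {s : Steps d | (j : ℤ) < gap lam s}.indicator (fun _ => (1 : ENNReal)) s = 1 := by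
        intro j hj
        refine Set.indicator_of_mem ?_ _
        rw [Set.mem_ofPred_eq, hm]
        exact_mod_cast Finset.mem_range.1 hj
      rw [Finset.sum_congr rfl h2]
      simp [hm]
    · intro j hj
      refine Set.indicator_of_notMem ?_ _
      rw [Set.mem_ofPred_eq, hm, Nat.cast_lt]
      simpa using hj
  simp_rw [h1]
  rw [lintegral_tsum fun j => (measurable_const.indicator (hgm j)).aemeasurable]
  refine lt_of_le_of_lt (ENNReal.tsum_le_of_sum_range_le
    (c := (stepAnn μ (Good (castHom lam)))⁻¹) fun k => ?_)
    (ENNReal.inv_lt_top.2 (pos_iff_ne_zero.2 (good_ne_zero μ hpos)))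
  simp_rw [lintegral_indicator_const (hgm _), one_mul, goodLaw_apply, ← Finset.mul_sum]
  exact mul_le_of_le_one_right' (sum_gap_le μ hlam hpos k)

/-- The walk has a speed in the direction `lam` when it goes to infinity in this direction. -/
lemma exists_speed_of_up {lam : Lattice d →+ ℤ} (hlam : ∀ e : UnitStep d, |lam e.1| ≤ 1) :
    ∀ᵐ s ∂stepAnn μ, s ∈ Up (castHom lam) →
      ∃ v : ℝ, Tendsto (fun n : ℕ => (lam (pos s n) : ℝ) / n) atTop (𝓝 v) := by
  set φ := castHom lam with hφ
  by_cases hpos : stepAnn μ (Up φ) = 0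
  · filter_upwards [measure_eq_zero_iff_ae_notMem.1 hpos] with s hs hs' using absurd hs' hs
  have hprob := isProbabilityMeasure_goodLaw μ hpos
  have hT := measurePreserving_regShift μ hpos
  have hind := indepFun_regBlock μ hpos
  have hY := measurable_regBlock (d := d) φ
  have hgood : ∀ᵐ s ∂goodLaw μ φ, s ∈ Good φ := ae_cond_mem (measurableSet_good φ)
  have hreg : ∀ᵐ s ∂goodLaw μ φ, ∃ n, Reg φ n s := by
    have h1 := (cond_absolutelyContinuous : goodLaw μ φ ≪ stepAnn μ).ae_le (ae_exists_reg μ φ)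
    filter_upwards [hgood, h1] with s h2 h3 using h3 h2
  have hgood' : ∀ᵐ s ∂goodLaw μ φ, ∀ j, (regShift φ)^[j] s ∈ Good φ :=
    ae_all_iff.2 fun j => (hT.iterate j).quasiMeasurePreserving.ae hgood
  have hreg' : ∀ᵐ s ∂goodLaw μ φ, ∀ j, ∃ n, Reg φ n ((regShift φ)^[j] s) :=
    ae_all_iff.2 fun j => (hT.iterate j).quasiMeasurePreserving.ae hreg
  have hgap := strong_law_blocks hT hY hind (f := fun y => (lam y.2 : ℝ)) Measurable.of_discrete
    (integrable_gap μ hlam hpos)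
  -- the mean duration of a block may be infinite, in which case `κ = 0`
  have htime : ∃ κ : ℝ, ∀ᵐ s ∂goodLaw μ φ,
      Tendsto (fun k : ℕ => (k : ℝ) / regTime φ s k) atTop (𝓝 κ) := by
    by_cases hint : Integrable (fun s => (((regBlock φ s).1 : ℕ) : ℝ)) (goodLaw μ φ)
    · refine ⟨(∫ s, (((regBlock φ s).1 : ℕ) : ℝ) ∂goodLaw μ φ)⁻¹, ?_⟩
      have h1 : 1 ≤ ∫ s, (((regBlock φ s).1 : ℕ) : ℝ) ∂goodLaw μ φ := by
        have h2 : ∫ _, (1 : ℝ) ∂goodLaw μ φ ≤ ∫ s, (((regBlock φ s).1 : ℕ) : ℝ) ∂goodLaw μ φ := by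
          refine integral_mono_ae (integrable_const _) hint ?_
          filter_upwards [hreg] with s hs
          exact_mod_cast (reg_spec hs).1
        simpa using h2
      filter_upwards [strong_law_blocks hT hY hind (f := fun y => (y.1 : ℝ))
        Measurable.of_discrete hint] with s hs
      have h3 := hs.inv₀ (by linarith)
      refine h3.congr fun k => ?_
      rw [inv_div, regTime]
      push_cast
      rfl
    · refine ⟨0, ?_⟩
      filter_upwards [strong_law_blocks_atTop hT hY hind (f := fun y => (y.1 : ℝ))
        Measurable.of_discrete (fun y => Nat.cast_nonneg _) hint] with s hs
      have h3 := hs.inv_tendsto_atTop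
      refine h3.congr fun k => ?_
      rw [Pi.inv_apply, inv_div, regTime]
      push_cast
      rfl
  obtain ⟨κ, hκ⟩ := htime
  have hconv : ∀ᵐ s ∂goodLaw μ φ,
      ∃ v : ℝ, Tendsto (fun n : ℕ => (lam (pos s n) : ℝ) / n) atTop (𝓝 v) := by
    filter_upwards [hgap, hκ, hgood', hreg'] with s h1 h2 h3 h4
    refine ⟨_, tendsto_div_of_blocks (τ := regTime φ s) (strictMono_nat_of_lt_succ fun k => ?_)
      (by simp [regTime]) (γ := ∫ s, (lam (regBlock φ s).2 : ℝ) ∂goodLaw μ φ)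
      (L := fun k => (lam (pos s (regTime φ s k)) : ℝ)) ?_ h2 ?_ ?_⟩
    · have := (reg_spec (h4 k)).1
      rw [regTime, regTime, Finset.sum_range_succ]
      omega
    · refine h1.congr fun k => ?_
      rw [pos_regTime, map_sum]
      push_cast
      rfl
    · intro k
      exact (h3 0).2 _
    · intro k n hk hn
      exact regTime_bounds (fun j => (h3 j).2) h4 hk hn
  have hconv' : ∀ᵐ s ∂stepAnn μ, s ∈ Good φ →
      ∃ v : ℝ, Tendsto (fun n : ℕ => (lam (pos s n) : ℝ) / n) atTop (𝓝 v) := by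
    rw [ae_iff, goodLaw_apply, mul_eq_zero, ENNReal.inv_eq_zero] at hconv
    filter_upwards [measure_eq_zero_iff_ae_notMem.1
      (hconv.resolve_left (measure_ne_top _ _))] with s hs hg
    by_contra hc
    exact hs ⟨hg, hc⟩
  filter_upwards [ae_shift μ hconv'] with s hs hu
  obtain ⟨n, hn⟩ := up_exists_stay hu
  obtain ⟨v, hv⟩ := hs n (shift_mem_good hu hn)
  exact ⟨v, (tendsto_speed_shift φ n s v).1 hv⟩

end

/-! ### Stopped kernels -/

section

variable {d : ℕ}

/-- The probability of the step `e` at the site `x`. -/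
noncomputable def stepProb (ω : Env d) (x : Lattice d) (e : UnitStep d) : ENNReal :=
  (ω x : Measure (UnitStep d)) {e}

lemma measurable_stepProb (x : Lattice d) (e : UnitStep d) :
    Measurable fun ω : Env d => stepProb ω x e := measurable_prob x e

lemma sum_stepProb (ω : Env d) (x : Lattice d) : ∑ e, stepProb ω x e = 1 := by
  have := sum_measure_singleton (μ := (ω x : Measure (UnitStep d))) (s := Finset.univ)
  rw [Finset.coe_univ, measure_univ] at this
  exact this

open Classical in
/-- The weight, in a fixed environment, of the paths from `x` to `y` of length at most `n` which
stop at `y` when they first enter the set `A`; a path of sites `x₀, x₁, …` carries the additional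
weight `c x₀ x₁ * c x₁ x₂ * ⋯`. -/
noncomputable def stopKer (A : Set (Lattice d)) (c : Lattice d → Lattice d → ENNReal) :
    ℕ → Env d → Lattice d → Lattice d → ENNReal
  | 0, _, x, y => if x ∈ A then (if y = x then 1 else 0) else 0
  | n + 1, ω, x, y => if x ∈ A then (if y = x then 1 else 0) else
      ∑ e : UnitStep d, stepProb ω x e * (c x (x + e.1) * stopKer A c n ω (x + e.1) y)

section stopKer
variable {A : Set (Lattice d)} {c : Lattice d → Lattice d → ENNReal} {n : ℕ} {ω : Env d}
  {x y : Lattice d}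

open Classical in
lemma stopKer_of_mem (hx : x ∈ A) : stopKer A c n ω x y = if y = x then 1 else 0 := by
  cases n <;> simp [stopKer, hx]

lemma stopKer_zero (hx : x ∉ A) : stopKer A c 0 ω x y = 0 := by simp [stopKer, hx]

lemma stopKer_succ (hx : x ∉ A) : stopKer A c (n + 1) ω x y =
    ∑ e : UnitStep d, stepProb ω x e * (c x (x + e.1) * stopKer A c n ω (x + e.1) y) := by
  simp [stopKer, hx]

lemma measurable_stopKer (n : ℕ) (x y : Lattice d) :
    Measurable fun ω => stopKer A c n ω x y := by
  classical
  induction n generalizing x with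
  | zero => exact measurable_const
  | succ n ih =>
    by_cases hx : x ∈ A
    · simp only [stopKer_of_mem hx]; exact measurable_const
    · simp only [stopKer_succ hx]
      exact Finset.measurable_sum _ fun e _ =>
        (measurable_stepProb x e).mul ((ih _).const_mul _)

/-- The stopped kernel does not see the environment in the set where the walk is stopped. -/
lemma stopKer_dependsOn (n : ℕ) (x y : Lattice d) :
    DependsOn (fun ω => stopKer A c n ω x y) Aᶜ := by
  intro ω ω' h
  induction n generalizing x with
  | zero => rfl
  | succ n ih =>
    by_cases hx : x ∈ A
    · simp only [stopKer_of_mem hx]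
    · have : ∀ e, stepProb ω x e = stepProb ω' x e := fun e => by
        rw [stepProb, stepProb, h x hx]
      simp only [stopKer_succ hx, this]
      exact Finset.sum_congr rfl fun e _ => by rw [show stopKer A c n ω _ y = _ from ih _]

lemma tsum_stopKer_of_mem (hx : x ∈ A) (g : Lattice d → ENNReal) :
    ∑' y, stopKer A c n ω x y * g y = g x := by
  classical
  simp only [stopKer_of_mem hx]
  rw [tsum_eq_single x fun y hy => by simp [hy]]
  simp

lemma tsum_stopKer_succ (hx : x ∉ A) (g : Lattice d → ENNReal) :
    ∑' y, stopKer A c (n + 1) ω x y * g y =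
      ∑ e : UnitStep d, stepProb ω x e *
        (c x (x + e.1) * ∑' y, stopKer A c n ω (x + e.1) y * g y) := by
  simp only [stopKer_succ hx, Finset.sum_mul]
  rw [Summable.tsum_finsetSum fun _ _ => ENNReal.summable]
  refine Finset.sum_congr rfl fun e _ => ?_
  rw [← ENNReal.tsum_mul_left, ← ENNReal.tsum_mul_left]
  exact tsum_congr fun y => by ring

lemma tsum_stopKer_le (hc : ∀ x y, c x y ≤ 1) (n : ℕ) (ω : Env d) (x : Lattice d) :
    ∑' y, stopKer A c n ω x y ≤ 1 := by
  have key : ∑' y, stopKer A c n ω x y * 1 ≤ 1 := by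
    induction n generalizing x with
    | zero =>
      by_cases hx : x ∈ A
      · exact (tsum_stopKer_of_mem hx fun _ => 1).le
      · simp [stopKer_zero hx]
    | succ n ih =>
      by_cases hx : x ∈ A
      · exact (tsum_stopKer_of_mem hx fun _ => 1).le
      · rw [tsum_stopKer_succ hx]
        refine le_trans (Finset.sum_le_sum fun e _ => ?_) (sum_stepProb ω x).le
        exact mul_le_of_le_one_right' (mul_le_one' (hc _ _) (ih _))
  simpa using key

/-- A function which is subharmonic outside `A` is dominated by the average of its values at the
entrance in `A`. -/
lemma le_tsum_stopKer {F : ℕ → Lattice d → ENNReal} (hmono : ∀ n x, F n x ≤ F (n + 1) x)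
    (h0 : ∀ x ∉ A, F 0 x = 0)
    (hrec : ∀ n, ∀ x ∉ A, F (n + 1) x ≤
      ∑ e : UnitStep d, stepProb ω x e * (c x (x + e.1) * F n (x + e.1))) (n : ℕ) (x : Lattice d) :
    F n x ≤ ∑' y, stopKer A c n ω x y * F n y := by
  by_cases hx : x ∈ A
  · rw [tsum_stopKer_of_mem hx]
  induction n generalizing x with
  | zero => rw [h0 x hx]; exact zero_le
  | succ n ih =>
    rw [tsum_stopKer_succ hx]
    refine (hrec n x hx).trans (Finset.sum_le_sum fun e _ => ?_)
    gcongr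
    have h1 : ∑' y, stopKer A c n ω (x + e.1) y * F n y ≤
        ∑' y, stopKer A c n ω (x + e.1) y * F (n + 1) y :=
      ENNReal.tsum_le_tsum fun y => by gcongr; exact hmono n y
    refine le_trans ?_ h1
    by_cases hx' : x + e.1 ∈ A
    · rw [tsum_stopKer_of_mem hx']
    · exact ih _ hx'

lemma stopKer_eq_zero (hy : y ∉ A) : stopKer A c n ω x y = 0 := by
  induction n generalizing x with
  | zero =>
    by_cases hx : x ∈ A
    · rw [stopKer_of_mem hx, if_neg fun h : y = x => hy (by rw [h]; exact hx)]
    · exact stopKer_zero hx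
  | succ n ih =>
    by_cases hx : x ∈ A
    · rw [stopKer_of_mem hx, if_neg fun h : y = x => hy (by rw [h]; exact hx)]
    · rw [stopKer_succ hx]
      simp [ih]

/-- Entering a half-space from below with steps of height at most one. -/
lemma stopKer_level {lam : Lattice d →+ ℤ} (hlam : ∀ e : UnitStep d, |lam e.1| ≤ 1) {m : ℤ}
    (hx : lam x ≤ m) (h : stopKer {z | m ≤ lam z} c n ω x y ≠ 0) : lam y = m := by
  induction n generalizing x with
  | zero =>
    by_cases hm : x ∈ {z | m ≤ lam z}
    · rw [stopKer_of_mem hm] at h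
      have hyx : y = x := by by_contra hyx; simp [hyx] at h
      rw [hyx]
      exact le_antisymm hx hm
    · exact absurd (stopKer_zero hm) h
  | succ n ih =>
    by_cases hm : x ∈ {z | m ≤ lam z}
    · rw [stopKer_of_mem hm] at h
      have hyx : y = x := by by_contra hyx; simp [hyx] at h
      rw [hyx]
      exact le_antisymm hx hm
    · rw [stopKer_succ hm] at h
      obtain ⟨e, -, he⟩ := Finset.exists_ne_zero_of_sum_ne_zero h
      refine ih ?_ (right_ne_zero_of_mul (right_ne_zero_of_mul he))
      rw [map_add]
      have := (abs_le.1 (hlam e)).2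
      have h2 : lam x < m := not_le.1 hm
      linarith

end stopKer

/-- The walks which, started at `x`, visit the set `B` without having been in `A` before. -/
def EnterBefore (A B : Set (Lattice d)) (x : Lattice d) : Set (Steps d) :=
  {s | ∃ k, x + pos s k ∈ B ∧ ∀ j < k, x + pos s j ∉ A}

lemma measurableSet_enterBefore (A B : Set (Lattice d)) (x : Lattice d) :
    MeasurableSet (EnterBefore A B x) := by
  have : EnterBefore A B x = ⋃ k, ((fun s => pos s k) ⁻¹' {y | x + y ∈ B} ∩
      ⋂ j ∈ Finset.range k, (fun s => pos s j) ⁻¹' {y | x + y ∉ A}) := by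
    ext s; simp [EnterBefore]
  rw [this]
  exact MeasurableSet.iUnion fun k => (measurable_pos k MeasurableSet.of_discrete).inter
    (Finset.measurableSet_biInter _ fun j _ => measurable_pos j MeasurableSet.of_discrete)

variable [NeZero d]

/-- The Markov property after one step, for nonnegative functions. -/
lemma lintegral_stepLaw_markov (ω : Env d) {g : UnitStep d → Steps d → ENNReal}
    (hg : ∀ e, Measurable (g e)) :
    ∫⁻ s, g (s 0) (shift 1 s) ∂stepLaw ω =
      ∑ e : UnitStep d, stepProb ω 0 e * ∫⁻ s, g e s ∂stepLaw (translate e.1 ω) := by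
  classical
  have hE : ∀ e : UnitStep d, MeasurableSet {s : Steps d | s 0 = e} := fun e =>
    measurableSet_eq_fun (measurable_pi_apply 0) measurable_const
  have h1 : ∀ s : Steps d, g (s 0) (shift 1 s) =
      ∑ e : UnitStep d, {s : Steps d | s 0 = e}.indicator (fun s => g e (shift 1 s)) s := by
    intro s
    rw [Finset.sum_eq_single (s 0)]
    · rw [Set.indicator_of_mem (by rfl)]
    · exact fun e _ he => Set.indicator_of_notMem
        (show s ∉ {s : Steps d | s 0 = e} from fun h => he (Eq.symm h)) _
    · simp
  simp_rw [h1]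
  rw [lintegral_finsetSum (f := fun (e : UnitStep d) (s : Steps d) =>
    {s : Steps d | s 0 = e}.indicator (fun s => g e (shift 1 s)) s) _
    fun e _ => ((hg e).comp (measurable_shift 1)).indicator (hE e)]
  refine Finset.sum_congr rfl fun e _ => ?_
  rw [lintegral_indicator (hE e), ← lintegral_map (hg e) (measurable_shift 1), stepLaw_restrict_map,
    lintegral_smul_measure]
  rfl

/-- Without additional weights, the stopped kernel is the law of the entrance point. -/
lemma sum_stopKer_le_stepLaw {A : Set (Lattice d)} (B : Set (Lattice d)) (n : ℕ) (ω : Env d)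
    (x : Lattice d) : ∑' y, stopKer A (fun _ _ => 1) n ω x y * B.indicator (fun _ => 1) y ≤
      stepLaw (translate x ω) (EnterBefore A B x) := by
  by_cases hx : x ∈ A
  · rw [tsum_stopKer_of_mem hx]
    by_cases hB : x ∈ B
    · have : EnterBefore A B x = Set.univ :=
        Set.eq_univ_of_forall fun s => ⟨0, by simpa using hB, by simp⟩
      rw [this, measure_univ, Set.indicator_of_mem hB]
    · rw [Set.indicator_of_notMem hB]; exact zero_le
  induction n generalizing x with
  | zero => simp [stopKer_zero hx]
  | succ n ih =>
    rw [tsum_stopKer_succ hx]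
    have h1 : ∫⁻ s, (EnterBefore A B (x + (s 0).1)).indicator 1 (shift 1 s)
        ∂stepLaw (translate x ω) ≤ stepLaw (translate x ω) (EnterBefore A B x) := by
      rw [← lintegral_indicator_one (measurableSet_enterBefore A B x)]
      refine lintegral_mono fun s => ?_
      by_cases hs : shift 1 s ∈ EnterBefore A B (x + (s 0).1)
      · have : s ∈ EnterBefore A B x := by
          obtain ⟨k, hk, hk'⟩ := hs
          refine ⟨k + 1, by rwa [pos_succ', ← add_assoc], fun j hj => ?_⟩
          rcases j with _ | j
          · simpa using hx
          · rw [pos_succ', ← add_assoc]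
            exact hk' j (by omega)
        rw [Set.indicator_of_mem this]
        exact Set.indicator_le_self' (fun _ _ => zero_le) _
      · rw [Set.indicator_of_notMem hs]; exact zero_le
    refine le_trans ?_ h1
    rw [lintegral_stepLaw_markov (translate x ω)
      (g := fun e s => (EnterBefore A B (x + e.1)).indicator 1 s)
      fun e => measurable_one.indicator (measurableSet_enterBefore A B _)]
    refine Finset.sum_le_sum fun e _ => ?_
    have h2 : stepProb (translate x ω) 0 e = stepProb ω x e := by simp [stepProb, translate]
    rw [h2, one_mul, lintegral_indicator_one (measurableSet_enterBefore A B _),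
      translate_translate]
    gcongr
    by_cases hx' : x + e.1 ∈ A
    · rw [tsum_stopKer_of_mem hx']
      by_cases hB : x + e.1 ∈ B
      · have : EnterBefore A B (x + e.1) = Set.univ :=
          Set.eq_univ_of_forall fun s => ⟨0, by simpa using hB, by simp⟩
        rw [this, measure_univ, Set.indicator_of_mem hB]
      · rw [Set.indicator_of_notMem hB]; exact zero_le
    · exact ih _ hx'

end

/-! ### Climbing with few crossings -/

section

variable {d : ℕ}

/-- The quenched probability that the walk started at `x` reaches the level `m + M` within `n`
steps, with at most `a` crossings from below the level `m` to this level. -/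
noncomputable def climb (lam : Lattice d →+ ℤ) (m : ℤ) (M : ℕ) :
    ℕ → ℕ → Env d → Lattice d → ENNReal
  | 0, _, _, x => if m + M ≤ lam x then 1 else 0
  | n + 1, a, ω, x => if m + M ≤ lam x then 1 else
      ∑ e : UnitStep d, stepProb ω x e *
        (if lam x < m ∧ m ≤ lam (x + e.1) then
          (if a = 0 then 0 else climb lam m M n (a - 1) ω (x + e.1))
        else climb lam m M n a ω (x + e.1))

section climb
variable {lam : Lattice d →+ ℤ} {m : ℤ} {M n a : ℕ} {ω : Env d} {x : Lattice d}

lemma climb_of_le (h : m + M ≤ lam x) : climb lam m M n a ω x = 1 := by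
  cases n <;> simp [climb, h]

lemma climb_zero (h : ¬ m + M ≤ lam x) : climb lam m M 0 a ω x = 0 := by simp [climb, h]

lemma climb_succ (h : ¬ m + M ≤ lam x) : climb lam m M (n + 1) a ω x =
    ∑ e : UnitStep d, stepProb ω x e *
        (if lam x < m ∧ m ≤ lam (x + e.1) then
          (if a = 0 then 0 else climb lam m M n (a - 1) ω (x + e.1))
        else climb lam m M n a ω (x + e.1)) := by simp [climb, h]

lemma measurable_climb (n a : ℕ) (x : Lattice d) :
    Measurable fun ω => climb lam m M n a ω x := by
  induction n generalizing a x with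
  | zero => exact measurable_const
  | succ n ih =>
    by_cases h : m + M ≤ lam x
    · simp only [climb_of_le h]; exact measurable_const
    · simp only [climb_succ h]
      refine Finset.measurable_sum _ fun e _ => (measurable_stepProb x e).mul ?_
      split_ifs
      · exact measurable_const
      · exact ih _ _
      · exact ih _ _

lemma climb_le_one (n a : ℕ) (x : Lattice d) : climb lam m M n a ω x ≤ 1 := by
  induction n generalizing a x with
  | zero => rw [climb]; split_ifs <;> simp
  | succ n ih =>
    by_cases h : m + M ≤ lam x
    · rw [climb_of_le h]
    · rw [climb_succ h]
      refine le_trans (Finset.sum_le_sum fun e _ => ?_) (sum_stepProb ω x).le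
      refine mul_le_of_le_one_right' ?_
      split_ifs
      · exact zero_le
      · exact ih _ _
      · exact ih _ _

lemma climb_mono (n a : ℕ) (x : Lattice d) :
    climb lam m M n a ω x ≤ climb lam m M (n + 1) a ω x := by
  induction n generalizing a x with
  | zero =>
    by_cases h : m + M ≤ lam x
    · rw [climb_of_le h, climb_of_le h]
    · rw [climb_zero h]; exact zero_le
  | succ n ih =>
    by_cases h : m + M ≤ lam x
    · rw [climb_of_le h, climb_of_le h]
    · rw [climb_succ h, climb_succ h]
      refine Finset.sum_le_sum fun e _ => ?_
      gcongr
      split_ifs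
      · exact le_rfl
      · exact ih _ _
      · exact ih _ _

/-- Above the level `m`, decompose the climb at the exit from the slab between `m` and `m + M`. -/
lemma climb_le_above (n a : ℕ) (x : Lattice d) : climb lam m M n a ω x ≤
    ∑' y, stopKer {z | lam z < m ∨ m + M ≤ lam z} (fun _ _ => 1) n ω x y *
      climb lam m M n a ω y := by
  refine le_tsum_stopKer (F := fun n x => climb lam m M n a ω x) (fun n x => climb_mono n a x)
    (fun x hx => ?_) (fun n x hx => ?_) n x
  · exact climb_zero fun h => hx (Or.inr h)
  · have h1 : ¬ lam x < m := fun h => hx (Or.inl h)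
    rw [climb_succ fun h => hx (Or.inr h)]
    simp [h1]

/-- Below the level `m`, decompose the climb at the return to the level `m`. -/
lemma climb_le_below (n a : ℕ) (hx : lam x < m) : climb lam m M n a ω x ≤
    ∑' y, stopKer {z | m ≤ lam z} (fun _ _ => 1) n ω x y *
      (if a = 0 then 0 else climb lam m M n (a - 1) ω y) := by
  have hF := le_tsum_stopKer (A := {z | m ≤ lam z}) (c := fun _ _ => 1) (ω := ω)
    (F := fun n x => if lam x < m then climb lam m M n a ω x else
      (if a = 0 then 0 else climb lam m M n (a - 1) ω x)) (fun n x => ?_) (fun x hx => ?_)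
      (fun n x hx => ?_) n x
  · simp only [hx, if_true] at hF
    refine hF.trans (ENNReal.tsum_le_tsum fun y => ?_)
    by_cases hy : y ∈ {z | m ≤ lam z}
    · rw [if_neg (not_lt.2 (show m ≤ lam y from hy))]
    · have : stopKer {z | m ≤ lam z} (fun _ _ => 1) n ω x y = 0 := stopKer_eq_zero hy
      rw [this, zero_mul, zero_mul]
  · split_ifs
    · exact climb_mono _ _ _
    · exact le_rfl
    · exact climb_mono _ _ _
  · have h1 : lam x < m := not_le.1 hx
    rw [if_pos h1, climb_zero]
    have : (0 : ℤ) ≤ M := Int.natCast_nonneg M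
    omega
  · have h1 : lam x < m := not_le.1 hx
    have h2 : ¬ m + M ≤ lam x := by
      have : (0 : ℤ) ≤ M := Int.natCast_nonneg M
      omega
    rw [if_pos h1, climb_succ h2]
    refine Finset.sum_le_sum fun e _ => ?_
    rw [one_mul]
    gcongr
    by_cases h3 : m ≤ lam (x + e.1)
    · rw [if_pos ⟨h1, h3⟩, if_neg (not_lt.2 h3)]
    · rw [if_neg (fun h => h3 h.2), if_pos (not_le.1 h3)]

end climb

variable [NeZero d] (μ : Measure (ProbabilityMeasure (UnitStep d))) [IsProbabilityMeasure μ]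

/-- If the walk does not go to infinity, it is unlikely to reach a high level without going below
its starting level. -/
lemma tendsto_escape {lam : Lattice d →+ ℤ} (hup : stepAnn μ (Up (castHom lam)) = 0) :
    Tendsto (fun M : ℕ => stepAnn μ
      (EnterBefore {z | lam z < 0 ∨ (M : ℤ) ≤ lam z} {z | (M : ℤ) ≤ lam z} 0)) atTop (𝓝 0) := by
  set φ := castHom lam with hφ
  -- never going below the starting level while being unbounded would force `Up φ` to have positive
  -- probability
  have hnull : ∀ᵐ s ∂stepAnn μ, ¬ (s ∈ Stay φ ∧ s ∈ Unb φ) := by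
    by_cases h : ∀ᵐ s ∂stepAnn μ, s ∈ Set.univ → ∀ n, shift n s ∉ Stay φ
    · filter_upwards [h] with s hs hc
      exact hs trivial 0 (by simpa using hc.1)
    · filter_upwards [invariant_of_unb μ φ MeasurableSet.univ (fun _ _ => Iff.rfl) h,
        measure_eq_zero_iff_ae_notMem.1 hup] with s h1 h2 hc
      exact h2 (h1 hc.2).2
  let S : ℕ → Set (Steps d) := fun M => {s | ∃ k, (M : ℤ) ≤ lam (pos s k) ∧
    ∀ j ≤ k, 0 ≤ lam (pos s j)}
  have hSm : ∀ M, MeasurableSet (S M) := by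
    intro M
    have : S M = ⋃ k, ((fun s => pos s k) ⁻¹' {y | (M : ℤ) ≤ lam y} ∩
      ⋂ j ∈ Finset.range (k + 1), (fun s => pos s j) ⁻¹' {y | 0 ≤ lam y}) := by
      ext s; simp [S]
    rw [this]
    exact MeasurableSet.iUnion fun k => (measurable_pos k MeasurableSet.of_discrete).inter
      (Finset.measurableSet_biInter _ fun j _ => measurable_pos j MeasurableSet.of_discrete)
  have hanti : Antitone S := by
    rintro M N hMN s ⟨k, hk, hk'⟩
    exact ⟨k, le_trans (by exact_mod_cast hMN) hk, hk'⟩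
  have hlim := tendsto_measure_iInter_atTop (μ := stepAnn μ) (fun M => (hSm M).nullMeasurableSet)
    hanti ⟨0, measure_ne_top _ _⟩
  have h0 : stepAnn μ (⋂ M, S M) = 0 := by
    refine measure_eq_zero_iff_ae_notMem.2 ?_
    filter_upwards [hnull] with s hs hc
    rw [Set.mem_iInter] at hc
    refine hs ⟨fun j => ?_, fun K => ?_⟩
    · obtain ⟨B, hB⟩ := ((Finset.range j).image fun i => lam (pos s i)).bddAbove
      obtain ⟨k, hk, hk'⟩ := hc (B.toNat + 1)
      have hjk : j ≤ k := by
        by_contra h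
        have h1 : lam (pos s k) ≤ B := hB (by simpa using ⟨k, not_le.1 h, rfl⟩)
        have h2 := Int.self_le_toNat B
        push_cast at hk
        omega
      rw [hφ, castHom_apply]
      exact_mod_cast hk' j hjk
    · obtain ⟨k, hk, -⟩ := hc (⌈K⌉.toNat + 1)
      refine ⟨k, ?_⟩
      have h2 := Int.self_le_toNat ⌈K⌉
      have h3 : ⌈K⌉ < lam (pos s k) := by push_cast at hk; omega
      rw [hφ, castHom_apply]
      exact lt_of_le_of_lt (Int.le_ceil K) (by exact_mod_cast h3)
  rw [h0] at hlim
  refine tendsto_of_tendsto_of_tendsto_of_le_of_le tendsto_const_nhds hlim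
    (fun _ => zero_le) (fun M => measure_mono ?_)
  rintro s ⟨k, hk, hk'⟩
  rw [zero_add] at hk
  refine ⟨k, hk, fun j hj => ?_⟩
  rcases hj.lt_or_eq with h | h
  · have := hk' j h
    rw [zero_add] at this
    exact not_lt.1 fun hc => this (Or.inl hc)
  · rw [h]; exact le_trans (Int.natCast_nonneg M) hk

/-- The annealed probability that the walk is at the site `w` when it first goes below its starting
level. -/
noncomputable def exitProb (lam : Lattice d →+ ℤ) (w : Lattice d) : ENNReal :=
  stepAnn μ ({_s | lam w < 0} ∩ EnterBefore {z | lam z < 0} {w} 0)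

lemma tsum_exitProb_le (lam : Lattice d →+ ℤ) : ∑' w, exitProb μ lam w ≤ 1 := by
  unfold exitProb
  rw [← measure_iUnion]
  · exact prob_le_one
  · intro w w' hne
    rw [Function.onFun, Set.disjoint_left]
    rintro s ⟨h1, k, hk, hk'⟩ ⟨g1, l, hl, hl'⟩
    simp only [zero_add, Set.mem_singleton_iff, Set.mem_ofPred_eq] at *
    rcases lt_trichotomy k l with h | h | h
    · exact hl' k h (by rw [hk]; exact h1)
    · exact hne (by rw [← hk, ← hl, h])
    · exact hk' l h (by rw [hl]; exact g1)
  · exact fun w => (MeasurableSet.const _).inter (measurableSet_enterBefore _ _ _)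

/-- The annealed law of the entrance point, by translation invariance. -/
lemma lintegral_stopKer_le (A B : Set (Lattice d))
    (n : ℕ) (y : Lattice d) {E : Set (Steps d)} (hE : MeasurableSet E)
    (hsub : EnterBefore A B y ⊆ E) :
    ∫⁻ ω, ∑' z, stopKer A (fun _ _ => 1) n ω y z * B.indicator (fun _ => 1) z ∂envLaw μ ≤
      stepAnn μ E := by
  rw [← lintegral_stepLaw_translate μ y hE]
  exact lintegral_mono fun ω => (sum_stopKer_le_stepLaw B n ω y).trans (measure_mono hsub)

end

/-! ### Decoupling from the environment below -/

section

variable {d : ℕ}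

lemma dependsOn_mul {f g : Env d → ENNReal} {U : Set (Lattice d)} (hf : DependsOn f U)
    (hg : DependsOn g U) : DependsOn (fun ω => f ω * g ω) U := fun ω ω' h => by
  simp only [hf h, hg h]

lemma tsum_mul_le_sum_add_tsum {ι : Type*} (Z : Finset ι) {K low g : ι → ENNReal}
    (hK : ∀ w, K w ≤ 1) (hg : ∀ w, g w ≤ 1) :
    ∑' w, K w * (low w * g w) ≤ ∑ w ∈ Z, low w * g w + ∑' w : {w // w ∉ Z}, K w * low w := by
  refine (ENNReal.sum_add_tsum_compl Z fun w => K w * (low w * g w)).symm.le.trans ?_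
  refine add_le_add (Finset.sum_le_sum fun w _ => mul_le_of_le_one_left' (hK _))
    (ENNReal.tsum_le_tsum fun w => ?_)
  gcongr
  exact mul_le_of_le_one_right' (hg _)

/-- The decomposition `climb_le_above`, where the end points of the excursion outside a finite set
are given up. -/
lemma climb_le_split {lam : Lattice d →+ ℤ} {m : ℤ} {M : ℕ} (n a : ℕ) (ω : Env d) {y : Lattice d}
    (hy : lam y = m) (Z : Finset (Lattice d)) :
    climb lam m M n a ω y ≤
      ∑' z, stopKer {z | lam z < m ∨ m + M ≤ lam z} (fun _ _ => 1) n ω y z *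
        {z | m + M ≤ lam z}.indicator (fun _ => 1) z +
      ∑ w ∈ Z, (if lam w < 0 then 1 else 0) * climb lam m M n a ω (y + w) +
      ∑' w : {w // w ∉ Z}, stopKer {z | lam z < m ∨ m + M ≤ lam z} (fun _ _ => 1) n ω y (y + w) *
        (if lam w < 0 then 1 else 0) := by
  classical
  have hK1 := fun z => (ENNReal.le_tsum z).trans
    (tsum_stopKer_le (A := {z | lam z < m ∨ m + M ≤ lam z}) (fun _ _ => le_rfl) n ω y)
  have h0 := climb_le_above (lam := lam) (m := m) (M := M) (ω := ω) n a y
  have hmem : ∀ z ∉ {z | lam z < m ∨ m + M ≤ lam z},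
      stopKer {z | lam z < m ∨ m + M ≤ lam z} (fun _ _ => 1) n ω y z = 0 :=
    fun z hz => stopKer_eq_zero hz
  generalize stopKer {z | lam z < m ∨ m + M ≤ lam z} (fun _ _ => 1) n ω y = K at *
  have h1 : climb lam m M n a ω y ≤ ∑' z, K z * {z | m + M ≤ lam z}.indicator (fun _ => 1) z +
      ∑' z, K z * ((if lam (z - y) < 0 then 1 else 0) * climb lam m M n a ω z) := by
    rw [← ENNReal.tsum_add]
    refine h0.trans (ENNReal.tsum_le_tsum fun z => ?_)
    rw [← mul_add]
    by_cases hz : z ∈ {z | lam z < m ∨ m + M ≤ lam z}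
    · gcongr
      rcases hz with hz | hz
      · have : lam (z - y) < 0 := by rw [map_sub]; omega
        rw [if_pos this, one_mul]
        exact le_add_left le_rfl
      · refine (climb_le_one n a z).trans (le_add_right ?_)
        rw [Set.indicator_of_mem (show z ∈ {z | m + M ≤ lam z} from hz)]
    · rw [hmem z hz, zero_mul]; exact zero_le
  have h2 : ∑' z, K z * ((if lam (z - y) < 0 then 1 else 0) * climb lam m M n a ω z) =
      ∑' w, K (y + w) * ((if lam w < 0 then 1 else 0) * climb lam m M n a ω (y + w)) := by
    rw [← (Equiv.addLeft y).tsum_eq]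
    simp
  rw [h2] at h1
  have h3 := tsum_mul_le_sum_add_tsum Z (K := fun w => K (y + w))
    (low := fun w => if lam w < 0 then 1 else 0) (g := fun w => climb lam m M n a ω (y + w))
    (fun w => hK1 _) (fun w => climb_le_one n a _)
  rw [add_assoc]
  exact h1.trans (add_le_add le_rfl h3)

section
variable (μ : Measure (ProbabilityMeasure (UnitStep d))) [IsProbabilityMeasure μ]

/-- If the integral of `g y` against functions of the environment below the level `m` is at most
`η` times their own integral, for all `y` at the level `m`, then the same holds for the average of
`g` at the entrance in the half-space above the level `m`. -/
lemma lintegral_enter_le {lam : Lattice d →+ ℤ} (hlam : ∀ e : UnitStep d, |lam e.1| ≤ 1) {m : ℤ}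
    {c : Lattice d → Lattice d → ENNReal} {n : ℕ} {x : Lattice d}
    (hx : lam x ≤ m) {g : Env d → Lattice d → ENNReal} (hg : ∀ y, Measurable fun ω => g ω y)
    {η : ENNReal} (H : ∀ y, lam y = m → ∀ f : Env d → ENNReal, Measurable f →
      DependsOn f {z | lam z < m} → ∫⁻ ω, f ω * g ω y ∂envLaw μ ≤ η * ∫⁻ ω, f ω ∂envLaw μ)
    {f : Env d → ENNReal} (hf : Measurable f) (hfd : DependsOn f {z | lam z < m}) :
    ∫⁻ ω, f ω * ∑' y, stopKer {z | m ≤ lam z} c n ω x y * g ω y ∂envLaw μ ≤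
      η * ∫⁻ ω, f ω * ∑' y, stopKer {z | m ≤ lam z} c n ω x y ∂envLaw μ := by
  have hK := fun y => measurable_stopKer (A := {z | m ≤ lam z}) (c := c) n x y
  simp_rw [← ENNReal.tsum_mul_left]
  rw [lintegral_tsum (f := fun y ω => f ω * (stopKer {z | m ≤ lam z} c n ω x y * g ω y))
      fun y => (hf.mul ((hK y).mul (hg y))).aemeasurable,
    lintegral_tsum (f := fun y ω => f ω * stopKer {z | m ≤ lam z} c n ω x y)
      fun y => (hf.mul (hK y)).aemeasurable, ← ENNReal.tsum_mul_left]
  refine ENNReal.tsum_le_tsum fun y => ?_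
  by_cases hy : lam y = m
  · simp_rw [← mul_assoc]
    refine H y hy _ (hf.mul (hK y)) (dependsOn_mul hfd ?_)
    have : {z | lam z < m} = {z | m ≤ lam z}ᶜ := by ext; simp
    rw [this]
    exact stopKer_dependsOn n x y
  · have : ∀ ω, stopKer {z | m ≤ lam z} c n ω x y = 0 := fun ω => by
      by_contra h
      exact hy (stopKer_level hlam hx h)
    simp [this]

end

variable [NeZero d] (μ : Measure (ProbabilityMeasure (UnitStep d))) [IsProbabilityMeasure μ]

/-- The inductive step of the decoupling argument `climb_bound`: each excursion above the level `m`
ends within a finite set of sites up to a small probability, hence conditioning on its end point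
costs a bounded factor only. -/
lemma climb_step {lam : Lattice d →+ ℤ} (hup : stepAnn μ (Up (castHom lam)) = 0)
    {ε : ENNReal} (hε : ε ≠ 0) :
    ∃ ε' : ENNReal, ε' ≠ 0 ∧ ∃ M₀ : ℕ, ∀ M ≥ M₀, ∀ (m : ℤ) (n a : ℕ),
      (∀ z, lam z < m → ∀ f : Env d → ENNReal, Measurable f → DependsOn f {z | lam z < m} →
        ∫⁻ ω, f ω * climb lam m M n a ω z ∂envLaw μ ≤ ε' * ∫⁻ ω, f ω ∂envLaw μ) →
      ∀ y, lam y = m → ∀ f : Env d → ENNReal, Measurable f → DependsOn f {z | lam z < m} →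
        ∫⁻ ω, f ω * climb lam m M n a ω y ∂envLaw μ ≤ ε * ∫⁻ ω, f ω ∂envLaw μ := by
  classical
  have hε3 : 0 < ε / 3 := ENNReal.div_pos hε (by simp)
  have htail := ENNReal.tendsto_tsum_compl_atTop_zero (f := exitProb μ lam)
    (ne_top_of_le_ne_top ENNReal.one_ne_top (tsum_exitProb_le μ lam))
  -- the excursions that end outside `Z` and those that end above the level `m + M` cost `ε / 3`
  -- each
  obtain ⟨Z, hZ⟩ := (htail.eventually (gt_mem_nhds hε3)).exists
  obtain ⟨M₀, hM₀⟩ := eventually_atTop.1 ((tendsto_escape μ hup).eventually (gt_mem_nhds hε3))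
  have hKt : (Z.card + 1 : ENNReal) ≠ ⊤ := by simp
  refine ⟨ε / 3 / (Z.card + 1), (ENNReal.div_pos hε3.ne' hKt).ne', M₀, ?_⟩
  intro M hM m n a H y hy f hf hfd
  set A : Set (Lattice d) := {z | lam z < m ∨ m + M ≤ lam z} with hA
  set K : Env d → Lattice d → ENNReal := fun ω z => stopKer A (fun _ _ => 1) n ω y z with hK
  have hKm : ∀ z, Measurable fun ω => K ω z := fun z => measurable_stopKer n y z
  have hKd : ∀ z, DependsOn (fun ω => K ω z) Aᶜ := fun z => stopKer_dependsOn n y z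
  have hdisj : Disjoint {z : Lattice d | lam z < m} Aᶜ :=
    Set.disjoint_left.2 fun z hz hz' => hz' (Or.inl hz)
  let top : Lattice d → ENNReal := {z | m + M ≤ lam z}.indicator fun _ => 1
  let low : Lattice d → ENNReal := fun w => if lam w < 0 then 1 else 0
  let q : Env d → ENNReal := fun ω => ∑' z, K ω z * top z
  have hqm : Measurable q := Measurable.tsum fun z => (hKm z).mul_const _
  have hqd : DependsOn q Aᶜ := fun ω ω' h => tsum_congr fun z => by
    rw [show K ω z = K ω' z from hKd z h]
  have hpt : ∀ ω, f ω * climb lam m M n a ω y ≤ f ω * q ω +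
      ∑ w ∈ Z, f ω * (low w * climb lam m M n a ω (y + w)) +
      ∑' w : {w // w ∉ Z}, f ω * (K ω (y + w) * low w) := by
    intro ω
    have h1 := mul_le_mul_right (climb_le_split (M := M) n a ω hy Z) (f ω)
    rw [mul_add, mul_add, Finset.mul_sum, ← ENNReal.tsum_mul_left (a := f ω)
      (f := fun w : {w // w ∉ Z} => K ω (y + w) * low w)] at h1
    exact h1
  -- the excursion only sees the environment above the level `m`, hence is independent of `f`
  have hsub1 : EnterBefore A {z | m + M ≤ lam z} y ⊆
      EnterBefore {z | lam z < 0 ∨ (M : ℤ) ≤ lam z} {z | (M : ℤ) ≤ lam z} 0 := by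
    rintro s ⟨k, hk, hk'⟩
    refine ⟨k, ?_, fun j hj hc => hk' j hj ?_⟩
    · simp only [Set.mem_ofPred_eq, map_add, zero_add, hy] at hk ⊢; omega
    · simp only [hA, Set.mem_ofPred_eq, map_add, zero_add, hy] at hc ⊢; omega
  have hI1 : ∫⁻ ω, f ω * q ω ∂envLaw μ ≤ ε / 3 * ∫⁻ ω, f ω ∂envLaw μ := by
    rw [lintegral_mul_of_dependsOn μ hf hqm hfd hqd hdisj, mul_comm]
    gcongr
    exact (lintegral_stopKer_le μ A _ n y (measurableSet_enterBefore _ _ _) hsub1).trans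
      (hM₀ M hM).le
  have hI2 : ∑ w ∈ Z, ∫⁻ ω, f ω * (low w * climb lam m M n a ω (y + w)) ∂envLaw μ ≤
      ε / 3 * ∫⁻ ω, f ω ∂envLaw μ := by
    calc _ ≤ ∑ w ∈ Z, ε / 3 / (Z.card + 1) * ∫⁻ ω, f ω ∂envLaw μ := by
          refine Finset.sum_le_sum fun w _ => ?_
          by_cases hw : lam w < 0
          · simp only [low, hw, if_true, one_mul]
            exact H _ (by rw [map_add]; omega) f hf hfd
          · simp [low, hw]
      _ = Z.card * (ε / 3 / (Z.card + 1)) * ∫⁻ ω, f ω ∂envLaw μ := by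
          rw [Finset.sum_const, nsmul_eq_mul, mul_assoc]
      _ ≤ (Z.card + 1) * (ε / 3 / (Z.card + 1)) * ∫⁻ ω, f ω ∂envLaw μ := by
          gcongr; exact le_self_add
      _ ≤ _ := by gcongr; exact ENNReal.mul_div_le
  have hI3 : ∑' w : {w // w ∉ Z}, ∫⁻ ω, f ω * (K ω (y + w) * low w) ∂envLaw μ ≤
      ε / 3 * ∫⁻ ω, f ω ∂envLaw μ := by
    calc _ ≤ ∑' w : {w // w ∉ Z}, exitProb μ lam w * ∫⁻ ω, f ω ∂envLaw μ := by
          refine ENNReal.tsum_le_tsum fun w => ?_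
          by_cases hw : lam w.1 < 0
          · simp only [low, hw, if_true, mul_one]
            rw [lintegral_mul_of_dependsOn μ hf (hKm _) hfd (hKd _) hdisj, mul_comm]
            gcongr
            have h4 := lintegral_stopKer_le μ A {y + w.1} n y
              ((MeasurableSet.const (lam w.1 < 0)).inter
                (measurableSet_enterBefore {z | lam z < 0} {w.1} 0)) (by
              rintro s ⟨k, hk, hk'⟩
              refine ⟨hw, k, ?_, fun j hj hc => hk' j hj ?_⟩
              · simpa using hk
              · simp only [hA, Set.mem_ofPred_eq, map_add, zero_add, hy] at hc ⊢; omega)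
            refine le_trans (lintegral_mono fun ω => ?_) h4
            refine le_trans ?_ (ENNReal.le_tsum (y + w.1))
            simp [hK]
          · simp [low, hw]
      _ = (∑' w : {w // w ∉ Z}, exitProb μ lam w) * ∫⁻ ω, f ω ∂envLaw μ := ENNReal.tsum_mul_right
      _ ≤ _ := by gcongr
  calc ∫⁻ ω, f ω * climb lam m M n a ω y ∂envLaw μ
      ≤ ∫⁻ ω, f ω * q ω + ∑ w ∈ Z, f ω * (low w * climb lam m M n a ω (y + w)) +
          ∑' w : {w // w ∉ Z}, f ω * (K ω (y + w) * low w) ∂envLaw μ := lintegral_mono hpt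
    _ = ∫⁻ ω, f ω * q ω ∂envLaw μ +
          ∑ w ∈ Z, ∫⁻ ω, f ω * (low w * climb lam m M n a ω (y + w)) ∂envLaw μ +
          ∑' w : {w // w ∉ Z}, ∫⁻ ω, f ω * (K ω (y + w) * low w) ∂envLaw μ := by
        have hm2 : ∀ w, Measurable fun ω => f ω * (low w * climb lam m M n a ω (y + w)) :=
          fun w => hf.mul ((measurable_climb n a _).const_mul _)
        have hm3 : ∀ w : {w // w ∉ Z}, Measurable fun ω => f ω * (K ω (y + w) * low w) :=
          fun w => hf.mul ((hKm _).mul_const _)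
        have hm4 : Measurable fun ω =>
            ∑ w ∈ Z, f ω * (low w * climb lam m M n a ω (y + w)) :=
          Finset.measurable_sum _ fun w _ => hm2 w
        rw [lintegral_add_left (f := fun ω => f ω * q ω +
            ∑ w ∈ Z, f ω * (low w * climb lam m M n a ω (y + w))) ((hf.mul hqm).add hm4),
          lintegral_add_left (f := fun ω => f ω * q ω) (hf.mul hqm),
          lintegral_finsetSum (f := fun w ω => f ω * (low w * climb lam m M n a ω (y + w))) _
            fun w _ => hm2 w,
          lintegral_tsum (f := fun (w : {w // w ∉ Z}) ω => f ω * (K ω (y + w) * low w))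
            fun w => (hm3 w).aemeasurable]
    _ ≤ ε / 3 * ∫⁻ ω, f ω ∂envLaw μ + ε / 3 * ∫⁻ ω, f ω ∂envLaw μ +
          ε / 3 * ∫⁻ ω, f ω ∂envLaw μ := add_le_add (add_le_add hI1 hI2) hI3
    _ = ε * ∫⁻ ω, f ω ∂envLaw μ := by
        rw [← add_mul, ← add_mul, ENNReal.add_thirds]

/-- Decoupling: whatever the environment below the level `m` is, a walk that crosses from below to
this level at most `a` times is unlikely to climb to a much higher level. -/
lemma climb_bound {lam : Lattice d →+ ℤ} (hlam : ∀ e : UnitStep d, |lam e.1| ≤ 1)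
    (hup : stepAnn μ (Up (castHom lam)) = 0) (a : ℕ) {ε : ENNReal} (hε : ε ≠ 0) :
    ∃ M₀ : ℕ, ∀ M ≥ M₀, ∀ (m : ℤ) (n : ℕ) (y : Lattice d), lam y = m →
      ∀ f : Env d → ENNReal, Measurable f → DependsOn f {z | lam z < m} →
        ∫⁻ ω, f ω * climb lam m M n a ω y ∂envLaw μ ≤ ε * ∫⁻ ω, f ω ∂envLaw μ := by
  -- Below the level `m`, the walk spends a crossing on its way back to this level, whatever
  -- environment it sees there: the weight of the way back is absorbed in the function `f`.
  induction a generalizing ε with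
  | zero =>
    obtain ⟨ε', hε', M₀, H⟩ := climb_step μ hup hε
    refine ⟨M₀, fun M hM m n => H M hM m n 0 fun z hz f hf hfd => ?_⟩
    have h0 : ∀ ω, climb lam m M n 0 ω z = 0 := fun ω =>
      le_antisymm ((climb_le_below n 0 hz).trans (by simp)) zero_le
    simp [h0]
  | succ a ih =>
    obtain ⟨ε', hε', M₀, H⟩ := climb_step μ hup hε
    obtain ⟨M₁, hM₁⟩ := ih hε'
    refine ⟨max M₀ M₁, fun M hM m n => H M (le_of_max_le_left hM) m n (a + 1)
      fun z hz f hf hfd => ?_⟩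
    have h1 := lintegral_enter_le μ hlam (c := fun _ _ => 1) (n := n) hz.le
      (g := fun ω y => climb lam m M n a ω y) (fun y => measurable_climb n a y)
      (fun y hy => hM₁ M (le_of_max_le_right hM) m n y hy) hf hfd
    refine le_trans (lintegral_mono fun ω => ?_) (h1.trans ?_)
    · gcongr
      simpa using climb_le_below n (a + 1) hz
    · gcongr with ω
      exact mul_le_of_le_one_right' (tsum_stopKer_le (fun _ _ => le_rfl) n ω z)

end

/-! ### Penalized crossings over many blocks of levels -/

section

variable {d : ℕ}

/-- The weight of a step from `x` to `y`: a crossing from below the level `m` to this level is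
penalized by the factor one half. -/
noncomputable def cross (lam : Lattice d →+ ℤ) (m : ℤ) (x y : Lattice d) : ENNReal :=
  if lam x < m ∧ m ≤ lam y then 2⁻¹ else 1

lemma cross_le_one (lam : Lattice d →+ ℤ) (m : ℤ) (x y : Lattice d) : cross lam m x y ≤ 1 := by
  rw [cross]
  split_ifs
  · exact ENNReal.inv_le_one.2 one_le_two
  · exact le_rfl

/-- The mean of `2⁻ᴺ` at the time when the level `m + M` is reached, where `N` is the number of
crossings of the level `m`, is estimated by distinguishing whether `N` is larger than `a`. -/
lemma tsum_stopKer_cross_le {lam : Lattice d →+ ℤ} {m : ℤ} {M : ℕ} (n a : ℕ) (ω : Env d)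
    (x : Lattice d) : ∑' y, stopKer {z | m + M ≤ lam z} (cross lam m) n ω x y ≤
      climb lam m M n a ω x + 2⁻¹ ^ (a + 1) := by
  have key : ∑' y, stopKer {z | m + M ≤ lam z} (cross lam m) n ω x y * 1 ≤
      climb lam m M n a ω x + 2⁻¹ ^ (a + 1) := by
    induction n generalizing a x with
    | zero =>
      by_cases hx : m + M ≤ lam x
      · rw [tsum_stopKer_of_mem (A := {z | m + M ≤ lam z}) hx fun _ => 1, climb_of_le hx]
        exact le_self_add
      · simp [stopKer_zero (A := {z | m + M ≤ lam z}) hx]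
    | succ n ih =>
      by_cases hx : m + M ≤ lam x
      · rw [tsum_stopKer_of_mem (A := {z | m + M ≤ lam z}) hx fun _ => 1, climb_of_le hx]
        exact le_self_add
      rw [tsum_stopKer_succ (A := {z | m + M ≤ lam z}) hx, climb_succ hx]
      have h1 : (2⁻¹ : ENNReal) ^ (a + 1) =
          ∑ e : UnitStep d, stepProb ω x e * 2⁻¹ ^ (a + 1) := by
        rw [← Finset.sum_mul, sum_stepProb, one_mul]
      rw [h1, ← Finset.sum_add_distrib]
      refine Finset.sum_le_sum fun e _ => ?_
      rw [← mul_add]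
      gcongr
      by_cases hc : lam x < m ∧ m ≤ lam (x + e.1)
      · rw [if_pos hc, cross, if_pos hc]
        rcases a with _ | a
        · rw [if_pos rfl, zero_add, zero_add, pow_one]
          refine mul_le_of_le_one_right' ?_
          simpa using tsum_stopKer_le (A := {z | m + M ≤ lam z}) (cross_le_one lam m) n ω (x + e.1)
        · rw [if_neg (Nat.succ_ne_zero a), Nat.add_sub_cancel]
          calc _ ≤ 2⁻¹ * (climb lam m M n a ω (x + e.1) + 2⁻¹ ^ (a + 1)) := by
                gcongr; exact ih a (x + e.1)
            _ ≤ _ := by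
                rw [mul_add, ← pow_succ']
                gcongr
                exact mul_le_of_le_one_left' (ENNReal.inv_le_one.2 one_le_two)
      · rw [if_neg hc, cross, if_neg hc, one_mul]
        exact ih a (x + e.1)
  simpa using key

/-- The quenched mean of `2⁻ᴺ` at the time when the walk from `x` reaches the level `m + J * M`,
when at most `n` steps are allowed for each of the `J` blocks of `M` levels; here `N` counts the
crossings of each level `m + j * M`, `j < J`, between the first visits of this level and of the
next one. -/
noncomputable def chain (lam : Lattice d →+ ℤ) (M : ℕ) :
    ℕ → ℕ → Env d → Lattice d → ℤ → ENNReal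
  | 0, _, _, _, _ => 1
  | J + 1, n, ω, x, m => ∑' y, stopKer {z | m + M ≤ lam z} (cross lam m) n ω x y *
      chain lam M J n ω y (m + M)

lemma measurable_chain (lam : Lattice d →+ ℤ) (M J n : ℕ) (x : Lattice d) (m : ℤ) :
    Measurable fun ω => chain lam M J n ω x m := by
  induction J generalizing x m with
  | zero => exact measurable_const
  | succ J ih => exact Measurable.tsum fun y => (measurable_stopKer n x y).mul (ih y _)

variable (μ : Measure (ProbabilityMeasure (UnitStep d))) [IsProbabilityMeasure μ]

/-- Each of the `J` blocks of levels contributes a factor `η`, since the weight of the path up to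
the beginning of a block only involves the environment below it. -/
lemma lintegral_mul_chain_le {lam : Lattice d →+ ℤ} (hlam : ∀ e : UnitStep d, |lam e.1| ≤ 1)
    {M : ℕ} {η : ENNReal}
    (H : ∀ (m : ℤ) (n : ℕ) (y : Lattice d), lam y = m →
      ∀ f : Env d → ENNReal, Measurable f → DependsOn f {z | lam z < m} →
        ∫⁻ ω, f ω * ∑' z, stopKer {z | m + M ≤ lam z} (cross lam m) n ω y z ∂envLaw μ ≤
          η * ∫⁻ ω, f ω ∂envLaw μ) (J n : ℕ) {m : ℤ} {x : Lattice d} (hx : lam x = m)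
    (f : Env d → ENNReal) (hf : Measurable f) (hfd : DependsOn f {z | lam z < m}) :
    ∫⁻ ω, f ω * chain lam M J n ω x m ∂envLaw μ ≤ η ^ J * ∫⁻ ω, f ω ∂envLaw μ := by
  induction J generalizing m x f with
  | zero => simp [chain]
  | succ J ih =>
    have hM : (0 : ℤ) ≤ M := Int.natCast_nonneg M
    have h1 := lintegral_enter_le μ hlam (m := m + M) (c := cross lam m) (n := n) (x := x)
      (by omega) (g := fun ω y => chain lam M J n ω y (m + M))
      (fun y => measurable_chain lam M J n y _) (fun y hy f hf hfd => ih hy f hf hfd) hf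
      (hfd.mono fun z (hz : lam z < m) => show lam z < m + M by omega)
    refine h1.trans ?_
    rw [pow_succ, mul_assoc]
    gcongr
    exact H m n x hx f hf hfd

/-- The same bound from a starting point inside the first block, which contributes no factor. -/
lemma lintegral_chain_le {lam : Lattice d →+ ℤ} (hlam : ∀ e : UnitStep d, |lam e.1| ≤ 1)
    {M : ℕ} {η : ENNReal}
    (H : ∀ (m : ℤ) (n : ℕ) (y : Lattice d), lam y = m →
      ∀ f : Env d → ENNReal, Measurable f → DependsOn f {z | lam z < m} →
        ∫⁻ ω, f ω * ∑' z, stopKer {z | m + M ≤ lam z} (cross lam m) n ω y z ∂envLaw μ ≤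
          η * ∫⁻ ω, f ω ∂envLaw μ) (J n : ℕ) {m : ℤ} {x : Lattice d} (hx : lam x ≤ m + M) :
    ∫⁻ ω, chain lam M (J + 1) n ω x m ∂envLaw μ ≤ η ^ J := by
  have h1 := lintegral_enter_le μ hlam (m := m + M) (c := cross lam m) (n := n) (x := x)
      hx (g := fun ω y => chain lam M J n ω y (m + M))
      (fun y => measurable_chain lam M J n y _)
      (fun y hy f hf hfd => lintegral_mul_chain_le μ hlam H J n hy f hf hfd) (f := fun _ => 1)
      measurable_const (fun _ _ _ => rfl)
  simp only [one_mul] at h1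
  refine h1.trans (mul_le_of_le_one_right' ?_)
  calc _ ≤ ∫⁻ _, 1 ∂envLaw μ := lintegral_mono fun ω => tsum_stopKer_le (cross_le_one lam m) n ω x
    _ = 1 := by simp

variable [NeZero d]

/-- Whatever the environment below the level `m` is, `2⁻ᴺ` has a small mean, where `N` is the number
of crossings of the level `m` before the level `m + M`. -/
lemma exists_cross_bound {lam : Lattice d →+ ℤ} (hlam : ∀ e : UnitStep d, |lam e.1| ≤ 1)
    (hup : stepAnn μ (Up (castHom lam)) = 0) {η : ENNReal} (hη : η ≠ 0) :
    ∃ M₀ : ℕ, ∀ M ≥ M₀, ∀ (m : ℤ) (n : ℕ) (y : Lattice d), lam y = m →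
      ∀ f : Env d → ENNReal, Measurable f → DependsOn f {z | lam z < m} →
        ∫⁻ ω, f ω * ∑' z, stopKer {z | m + M ≤ lam z} (cross lam m) n ω y z ∂envLaw μ ≤
          η * ∫⁻ ω, f ω ∂envLaw μ := by
  have hη2 : 0 < η / 2 := ENNReal.half_pos hη
  obtain ⟨a, ha⟩ := ENNReal.exists_inv_two_pow_lt hη2.ne'
  obtain ⟨M₀, hM₀⟩ := climb_bound μ hlam hup a hη2.ne'
  refine ⟨M₀, fun M hM m n y hy f hf hfd => ?_⟩
  calc ∫⁻ ω, f ω * ∑' z, stopKer {z | m + M ≤ lam z} (cross lam m) n ω y z ∂envLaw μ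
      ≤ ∫⁻ ω, f ω * climb lam m M n a ω y + η / 2 * f ω ∂envLaw μ := by
        refine lintegral_mono fun ω => ?_
        rw [mul_comm (η / 2), ← mul_add]
        gcongr
        refine (tsum_stopKer_cross_le n a ω y).trans ?_
        gcongr
        refine le_trans ?_ ha.le
        rw [pow_succ]
        exact mul_le_of_le_one_right' (ENNReal.inv_le_one.2 one_le_two)
    _ = ∫⁻ ω, f ω * climb lam m M n a ω y ∂envLaw μ + η / 2 * ∫⁻ ω, f ω ∂envLaw μ := by
        rw [lintegral_add_right _ (hf.const_mul _), lintegral_const_mul _ hf]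
    _ ≤ η / 2 * ∫⁻ ω, f ω ∂envLaw μ + η / 2 * ∫⁻ ω, f ω ∂envLaw μ := by
        gcongr; exact hM₀ M hM m n y hy f hf hfd
    _ = η * ∫⁻ ω, f ω ∂envLaw μ := by rw [← add_mul, ENNReal.add_halves]

end

/-! ### No positive speed without transience -/

section

variable {d : ℕ}

/-- Along a walk started at `x`, the weight `2⁻ᴺ` if the level `m + J * M` is reached within `n`
steps, and zero otherwise; here `N` counts the crossings of each level `m + j * M`, `j < J`, between
the first visits of this level and of the next one. -/
noncomputable def pathChain (lam : Lattice d →+ ℤ) (M : ℕ) :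
    ℕ → ℕ → Lattice d → ℤ → Steps d → ENNReal
  | _, 0, _, _, _ => 1
  | 0, _ + 1, _, _, _ => 0
  | n + 1, J + 1, x, m, s => cross lam m x (x + (s 0).1) *
      if m + M ≤ lam (x + (s 0).1) then pathChain lam M n J (x + (s 0).1) (m + M) (shift 1 s)
      else pathChain lam M n (J + 1) (x + (s 0).1) m (shift 1 s)

lemma pathChain_zero_right (lam : Lattice d →+ ℤ) (M n : ℕ) (x : Lattice d) (m : ℤ)
    (s : Steps d) : pathChain lam M n 0 x m s = 1 := by cases n <;> rfl

lemma measurable_pathChain (lam : Lattice d →+ ℤ) (M n J : ℕ) (x : Lattice d) (m : ℤ) :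
    Measurable (pathChain lam M n J x m) := by
  induction n generalizing J x m with
  | zero => cases J <;> exact measurable_const
  | succ n ih =>
    cases J with
    | zero => exact measurable_const
    | succ J =>
      let G : UnitStep d → Steps d → ENNReal := fun e s => cross lam m x (x + e.1) *
        if m + M ≤ lam (x + e.1) then pathChain lam M n J (x + e.1) (m + M) s
        else pathChain lam M n (J + 1) (x + e.1) m s
      have hG : ∀ e, Measurable (G e) := fun e => by
        refine Measurable.const_mul ?_ _
        split_ifs
        · exact ih _ _ _
        · exact ih _ _ _
      have h : Measurable (Function.uncurry G) := measurable_from_prod_countable_right hG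
      exact h.comp ((measurable_pi_apply 0).prodMk (measurable_shift 1))

lemma pathChain_mono (lam : Lattice d →+ ℤ) (M n J : ℕ) (x : Lattice d) (m : ℤ) (s : Steps d) :
    pathChain lam M n J x m s ≤ pathChain lam M (n + 1) J x m s := by
  induction n generalizing J x m s with
  | zero =>
    cases J with
    | zero => exact le_rfl
    | succ J => exact zero_le
  | succ n ih =>
    cases J with
    | zero => exact le_rfl
    | succ J =>
      rw [pathChain, pathChain]
      gcongr
      split_ifs
      · exact ih _ _ _ _
      · exact ih _ _ _ _

/-- The level `m + J * M` is reached by each of several walks with different base levels `m`: when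
these are pairwise incongruent modulo `M`, a step is a crossing for at most one of them, and
hence the total number of crossings is at most the number of steps. -/
lemma exists_sum_le_pathChain {lam : Lattice d →+ ℤ} (hlam : ∀ e : UnitStep d, |lam e.1| ≤ 1)
    {M : ℕ} (hM : 1 ≤ M) {ι : Type*} [Fintype ι] (n : ℕ) (x : Lattice d) (s : Steps d)
    (J : ι → ℕ) (m : ι → ℤ) (hm : ∀ i j, m i ≡ m j [ZMOD M] → i = j)
    (hx : ∀ i, J i ≠ 0 → lam x < m i + M)
    (hreach : ∃ k ≤ n, ∀ i, m i + J i * M ≤ lam (x + pos s k)) :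
    ∃ N : ι → ℕ, ∑ i, N i ≤ n ∧ ∀ i, 2⁻¹ ^ N i ≤ pathChain lam M n (J i) x (m i) s := by
  classical
  have hdone : ∀ (x : Lattice d) (s : Steps d) (J : ι → ℕ) (m : ι → ℤ),
      (∀ i, J i ≠ 0 → lam x < m i + M) → (∀ i, m i + J i * M ≤ lam (x + pos s 0)) →
      ∀ i, J i = 0 := by
    intro x s J m hx hreach i
    by_contra h
    have h1 := hx i h
    have h2 := hreach i
    have h3 : (1 : ℤ) * M ≤ J i * M := by
      gcongr; exact_mod_cast Nat.one_le_iff_ne_zero.2 h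
    simp only [pos_zero, add_zero] at h2
    omega
  obtain ⟨k, hk, hreach⟩ := hreach
  induction n generalizing x s J m k with
  | zero =>
    obtain rfl : k = 0 := by omega
    refine ⟨fun _ => 0, by simp, fun i => ?_⟩
    have hJ := hdone x s J m hx hreach i
    rw [hJ, pathChain_zero_right, pow_zero]
  | succ n ih =>
    rcases k with _ | k
    · refine ⟨fun _ => 0, by simp, fun i => ?_⟩
      have hJ := hdone x s J m hx hreach i
      rw [hJ, pathChain_zero_right, pow_zero]
    set x' := x + (s 0).1 with hx'
    have hstep : lam x' ≤ lam x + 1 := by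
      rw [hx', map_add]
      have := (abs_le.1 (hlam (s 0))).2
      omega
    -- the indices whose current block ends at this step
    let up : ι → Prop := fun i => J i ≠ 0 ∧ m i + M ≤ lam x'
    have hI := ih x' (shift 1 s) (fun i => if up i then J i - 1 else J i)
      (fun i => if up i then m i + M else m i) (fun i j hij => hm i j ?_) (fun i hi => ?_) k
      (by omega) (fun i => ?_)
    · obtain ⟨N, hN, hN'⟩ := hI
      -- a crossed base level is the new level of the walk, hence is the same for all indices
      let cr : ι → Prop := fun i => lam x < m i ∧ m i ≤ lam x'
      refine ⟨fun i => N i + if cr i then 1 else 0, ?_, fun i => ?_⟩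
      · rw [Finset.sum_add_distrib]
        refine add_le_add hN ?_
        rw [Finset.sum_boole]
        have h1 : (Finset.univ.filter cr).card ≤ 1 := by
          refine Finset.card_le_one.2 fun i hi j hj => hm i j ?_
          have hi := (Finset.mem_filter.1 hi).2
          have hj := (Finset.mem_filter.1 hj).2
          have : m i = m j := by
            have h1 := hi.1
            have h2 := hi.2
            have h3 := hj.1
            have h4 := hj.2
            omega
          rw [this]
        exact_mod_cast h1
      · rcases hJ : J i with _ | K
        · rw [pathChain_zero_right]
          exact pow_le_one₀ zero_le (ENNReal.inv_le_one.2 one_le_two)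
        · have h1 := hN' i
          have h2 : (2⁻¹ : ENNReal) ^ (if cr i then 1 else 0) = cross lam (m i) x x' := by
            rw [cross]
            by_cases hc : cr i
            · rw [if_pos hc, if_pos hc, pow_one]
            · rw [if_neg hc, if_neg hc, pow_zero]
          rw [pow_add, h2, mul_comm, pathChain, ← hx']
          gcongr
          by_cases hu : m i + M ≤ lam x'
          · have : up i := ⟨by omega, hu⟩
            simpa only [if_pos this, if_pos hu, hJ, Nat.add_sub_cancel] using h1
          · have : ¬ up i := fun h => hu h.2
            simpa only [if_neg this, if_neg hu, hJ] using h1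
    · have h1 : ∀ i, (if up i then m i + M else m i) ≡ m i [ZMOD M] := fun i => by
        split_ifs
        · exact Int.add_modEq_right
        · rfl
      exact (h1 i).symm.trans (hij.trans (h1 j))
    · by_cases hu : up i
      · have h1 := hx i hu.1
        simp only [if_pos hu]
        omega
      · simp only [if_neg hu] at hi ⊢
        by_contra hc
        exact hu ⟨hi, not_lt.1 hc⟩
    · have h1 := hreach i
      rw [pos_succ', ← add_assoc] at h1
      by_cases hu : up i
      · simp only [if_pos hu]
        have h2 : ((J i - 1 : ℕ) : ℤ) = J i - 1 := by
          have := hu.1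
          omega
        rw [h2]
        refine le_trans (le_of_eq ?_) h1
        ring
      · simpa only [if_neg hu] using h1

variable [NeZero d]

/-- The quenched mean of `pathChain` is at most `chain`, which allows `n` steps for each block
instead of `n` steps altogether. -/
lemma lintegral_pathChain_le {lam : Lattice d →+ ℤ} (hlam : ∀ e : UnitStep d, |lam e.1| ≤ 1)
    {M : ℕ} (hM : 1 ≤ M) (n J : ℕ) (ω : Env d) {x : Lattice d} {m : ℤ} (hx : lam x < m + M) :
    ∫⁻ s, pathChain lam M n J x m s ∂stepLaw (translate x ω) ≤ chain lam M J n ω x m := by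
  induction J generalizing x m with
  | zero => simp [pathChain_zero_right, chain]
  | succ J ih =>
    rw [chain]
    have hF := le_tsum_stopKer (A := {z | m + M ≤ lam z}) (c := cross lam m) (ω := ω)
      (F := fun n x => if m + M ≤ lam x then
          ∫⁻ s, pathChain lam M n J x (m + M) s ∂stepLaw (translate x ω) else
          ∫⁻ s, pathChain lam M n (J + 1) x m s ∂stepLaw (translate x ω))
      (fun n x => ?_) (fun x hx => ?_) (fun n x hx => ?_) n x
    · rw [if_neg (not_le.2 hx)] at hF
      refine hF.trans (ENNReal.tsum_le_tsum fun y => ?_)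
      by_cases h0 : stopKer {z | m + M ≤ lam z} (cross lam m) n ω x y = 0
      · rw [h0, zero_mul, zero_mul]
      have hy : lam y = m + M := stopKer_level hlam hx.le h0
      rw [if_pos hy.ge]
      gcongr
      exact ih (by omega)
    · split_ifs
      · exact lintegral_mono fun s => pathChain_mono lam M n J x _ s
      · exact lintegral_mono fun s => pathChain_mono lam M n (J + 1) x _ s
    · rw [if_neg (show ¬ m + M ≤ lam x from hx)]
      simp [pathChain]
    · rw [if_neg (show ¬ m + M ≤ lam x from hx)]
      have h1 := lintegral_stepLaw_markov (translate x ω) (g := fun e s =>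
        cross lam m x (x + e.1) *
          if m + M ≤ lam (x + e.1) then pathChain lam M n J (x + e.1) (m + M) s
          else pathChain lam M n (J + 1) (x + e.1) m s) (fun e => by
            refine Measurable.const_mul ?_ _
            split_ifs
            · exact measurable_pathChain _ _ _ _ _ _
            · exact measurable_pathChain _ _ _ _ _ _)
      refine h1.le.trans (Finset.sum_le_sum fun e _ => ?_)
      have h2 : stepProb (translate x ω) 0 e = stepProb ω x e := by simp [stepProb, translate]
      rw [h2, translate_translate]
      gcongr
      split_ifs
      · rw [lintegral_const_mul _ (measurable_pathChain _ _ _ _ _ _)]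
      · rw [lintegral_const_mul _ (measurable_pathChain _ _ _ _ _ _)]

variable (μ : Measure (ProbabilityMeasure (UnitStep d))) [IsProbabilityMeasure μ]

lemma lintegral_stepAnn {f : Steps d → ENNReal} (hf : Measurable f) :
    ∫⁻ s, f s ∂stepAnn μ = ∫⁻ ω, ∫⁻ s, f s ∂stepLaw ω ∂envLaw μ := by
  have hm : Measurable fun q : Env d × (ℕ → Lattice d) => stepsOf q.2 :=
    measurable_stepsOf.comp measurable_snd
  rw [stepAnn, lintegral_map hf hm, annealedLaw,
    Measure.lintegral_compProd (f := fun q => f (stepsOf q.2)) (hf.comp hm)]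
  refine lintegral_congr fun ω => ?_
  rw [stepLaw, lintegral_map hf measurable_stepsOf]
  rfl

/-- Reaching the level `(J + 1) * M` fast means that one of the `M` residues modulo `M` sees few
crossings. -/
lemma stepAnn_reach_le {lam : Lattice d →+ ℤ} (hlam : ∀ e : UnitStep d, |lam e.1| ≤ 1)
    {M : ℕ} (hM : 1 ≤ M) {η : ENNReal}
    (H : ∀ (m : ℤ) (n : ℕ) (y : Lattice d), lam y = m →
      ∀ f : Env d → ENNReal, Measurable f → DependsOn f {z | lam z < m} →
        ∫⁻ ω, f ω * ∑' z, stopKer {z | m + M ≤ lam z} (cross lam m) n ω y z ∂envLaw μ ≤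
          η * ∫⁻ ω, f ω ∂envLaw μ) (B J : ℕ) :
    2⁻¹ ^ B * stepAnn μ {s | ∃ k ≤ B * M, (J + 1) * M ≤ lam (pos s k)} ≤ M * η ^ J := by
  set E : Set (Steps d) := {s | ∃ k ≤ B * M, ((J : ℤ) + 1) * M ≤ lam (pos s k)} with hE
  have hEm : MeasurableSet E := by
    have : E = ⋃ k ∈ Finset.range (B * M + 1),
        (fun s => pos s k) ⁻¹' {y | ((J : ℤ) + 1) * M ≤ lam y} := by
      ext s; simp [hE]
    rw [this]
    exact Finset.measurableSet_biUnion _ fun k _ => measurable_pos k MeasurableSet.of_discrete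
  -- the base levels `-(M - 1), …, 0` represent all residues and are at most `M - 1` below the start
  let m : Fin M → ℤ := fun i => i + 1 - M
  let P : Steps d → ENNReal := fun s => ∑ i, pathChain lam M (B * M) (J + 1) 0 (m i) s
  have hPm : Measurable P := Finset.measurable_sum _ fun i _ => measurable_pathChain _ _ _ _ _ _
  have h1 : ∀ s ∈ E, 2⁻¹ ^ B ≤ P s := by
    intro s hs
    obtain ⟨k, hk, hs⟩ := hs
    have hI := exists_sum_le_pathChain hlam hM (B * M) 0 s (fun _ => J + 1) m
      (fun i j hij => ?_) (fun i _ => ?_) ⟨k, hk, fun i => ?_⟩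
    · obtain ⟨N, hN, hN'⟩ := hI
      have : ∃ i ∈ (Finset.univ : Finset (Fin M)), N i ≤ B := by
        have : NeZero M := ⟨by omega⟩
        refine Finset.exists_le_of_sum_le (g := fun _ => B) Finset.univ_nonempty ?_
        simpa [mul_comm] using hN
      obtain ⟨i, hi, hNi⟩ := this
      calc (2⁻¹ : ENNReal) ^ B ≤ 2⁻¹ ^ N i :=
            pow_le_pow_of_le_one zero_le (ENNReal.inv_le_one.2 one_le_two) hNi
        _ ≤ _ := (hN' i).trans (Finset.single_le_sum
            (f := fun i => pathChain lam M (B * M) (J + 1) 0 (m i) s) (fun _ _ => zero_le) hi)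
    · have h2 : ((i : ℕ) : ℤ) ≡ ((j : ℕ) : ℤ) [ZMOD M] := by
        have := (hij.add_right (M : ℤ)).add_right (-1)
        simpa [m] using this
      have h3 := Int.natCast_modEq_iff.1 h2
      exact Fin.ext (Nat.ModEq.eq_of_lt_of_lt h3 i.2 j.2)
    · simp only [map_zero, m]; omega
    · rw [zero_add]
      refine le_trans ?_ hs
      have := i.2
      simp only [m]
      push_cast
      linarith [show ((i : ℕ) : ℤ) + 1 ≤ M by omega]
  calc 2⁻¹ ^ B * stepAnn μ E = ∫⁻ s, E.indicator (fun _ => 2⁻¹ ^ B) s ∂stepAnn μ := by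
        rw [lintegral_indicator_const hEm]
    _ ≤ ∫⁻ s, P s ∂stepAnn μ := lintegral_mono fun s => by
        by_cases hs : s ∈ E
        · rw [Set.indicator_of_mem hs]; exact h1 s hs
        · rw [Set.indicator_of_notMem hs]; exact zero_le
    _ = ∑ i, ∫⁻ s, pathChain lam M (B * M) (J + 1) 0 (m i) s ∂stepAnn μ :=
        lintegral_finsetSum _ fun i _ => measurable_pathChain _ _ _ _ _ _
    _ ≤ ∑ i : Fin M, η ^ J := by
        refine Finset.sum_le_sum fun i _ => ?_
        have hi : lam 0 < m i + M := by simp only [map_zero, m]; omega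
        refine le_trans ?_ (lintegral_chain_le μ hlam H J (B * M) hi.le)
        rw [lintegral_stepAnn μ (measurable_pathChain _ _ _ _ _ _)]
        refine lintegral_mono fun ω => ?_
        simpa [translate_zero] using lintegral_pathChain_le hlam hM (B * M) (J + 1) ω hi
    _ = M * η ^ J := by simp

/-- If the walk almost surely does not go to infinity in a direction, then it has no positive speed
in this direction. -/
lemma speed_nonpos_of_up_null {lam : Lattice d →+ ℤ} (hlam : ∀ e : UnitStep d, |lam e.1| ≤ 1)
    (hup : stepAnn μ (Up (castHom lam)) = 0) :
    ∀ᵐ s ∂stepAnn μ, ∀ ε : ℝ, 0 < ε → ∀ᶠ n : ℕ in atTop, (lam (pos s n) : ℝ) ≤ ε * n := by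
  have key : ∀ C : ℕ, 1 ≤ C → ∀ᵐ s ∂stepAnn μ, ∃ K : ℝ, ∀ᶠ n : ℕ in atTop,
      (lam (pos s n) : ℝ) ≤ n / C + K := by
    intro C hC
    -- `η ^ J` makes up for the factor `2 ^ (C * J)` lost in `stepAnn_reach_le`, with `2⁻¹ ^ J` left
    have hη : (2⁻¹ : ENNReal) ^ (C + 1) ≠ 0 := by simp
    obtain ⟨M₀, hM₀⟩ := exists_cross_bound μ hlam hup hη
    set M := M₀ + 1 with hMdef
    have hb : ∀ J : ℕ, stepAnn μ {s | ∃ k ≤ C * J * M, ((J : ℤ) + 1) * M ≤ lam (pos s k)} ≤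
        M * 2⁻¹ ^ J := by
      intro J
      have h1 := stepAnn_reach_le μ hlam (by omega) (hM₀ M (by omega)) (C * J) J
      have h2 : (M : ENNReal) * (2⁻¹ ^ (C + 1)) ^ J = 2⁻¹ ^ (C * J) * (M * 2⁻¹ ^ J) := by
        rw [← pow_mul, add_mul, one_mul, pow_add]; ring
      rw [h2] at h1
      exact (ENNReal.mul_le_mul_iff_right (by simp) (by simp)).1 h1
    have hs := measure_limsup_atTop_eq_zero (μ := stepAnn μ)
      (s := fun J : ℕ => {s | ∃ k ≤ C * J * M, ((J : ℤ) + 1) * M ≤ lam (pos s k)}) (by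
        refine ne_top_of_le_ne_top ?_ (ENNReal.tsum_le_tsum hb)
        rw [ENNReal.tsum_mul_left, ENNReal.tsum_geometric]
        exact ENNReal.mul_ne_top (by simp) (by simp))
    filter_upwards [measure_eq_zero_iff_ae_notMem.1 hs] with s hs
    rw [mem_limsup_iff_frequently_mem] at hs
    obtain ⟨J₀, hJ₀⟩ := eventually_atTop.1 (not_frequently.1 hs)
    refine ⟨2 * M, eventually_atTop.2 ⟨C * M * J₀, fun n hn => ?_⟩⟩
    have hCM : 0 < C * M := by positivity
    set J := n / (C * M) + 1 with hJ
    have h1 : J₀ ≤ J := by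
      have : J₀ ≤ n / (C * M) := (Nat.le_div_iff_mul_le hCM).2 (by rw [mul_comm]; exact hn)
      omega
    have h2 : n ≤ C * J * M := by
      have := Nat.lt_mul_div_succ n hCM
      calc n ≤ C * M * (n / (C * M) + 1) := this.le
        _ = C * J * M := by rw [hJ]; ring
    have h3 : lam (pos s n) < ((J : ℤ) + 1) * M := by
      by_contra hc
      exact hJ₀ J h1 ⟨n, h2, not_lt.1 hc⟩
    have h4 : ((n / (C * M) : ℕ) : ℝ) ≤ n / (C * M : ℕ) := Nat.cast_div_le
    have hC' : (0 : ℝ) < C := by exact_mod_cast hC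
    have hM' : (0 : ℝ) < M := by positivity
    have h5 : (lam (pos s n) : ℝ) < ((J : ℝ) + 1) * M := by exact_mod_cast h3
    refine h5.le.trans ?_
    calc ((J : ℝ) + 1) * M = ((n / (C * M) : ℕ) : ℝ) * M + 2 * M := by
          rw [hJ]; push_cast; ring
      _ ≤ (n / (C * M : ℕ) : ℝ) * M + 2 * M := by gcongr
      _ = n / C + 2 * M := by push_cast; field_simp
  filter_upwards [ae_all_iff.2 fun C => ae_all_iff.2 (key C)] with s hs ε hε
  obtain ⟨C, hC⟩ := exists_nat_gt (2 / ε)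
  have hC0 : (0 : ℝ) < C := lt_trans (by positivity) hC
  obtain ⟨K, hK⟩ := hs C (by exact_mod_cast hC0)
  obtain ⟨n₀, hn₀⟩ := exists_nat_gt (2 * K / ε)
  filter_upwards [hK, eventually_ge_atTop n₀] with n hn hn'
  have h1 : (n : ℝ) / C ≤ ε / 2 * n := by
    rw [div_le_iff₀ hC0]
    have : 1 ≤ ε / 2 * C := by
      rw [div_lt_iff₀ hε] at hC
      linarith
    nlinarith [Nat.cast_nonneg (α := ℝ) n]
  have h2 : K ≤ ε / 2 * n := by
    have : (n₀ : ℝ) ≤ n := by exact_mod_cast hn'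
    rw [div_lt_iff₀ hε] at hn₀
    nlinarith
  linarith

end

/-! ### The velocity -/

section

variable {d : ℕ}

/-- The walk has the asymptotic velocity `v`. -/
def HasVelocity (s : Steps d) (v : Fin d → ℝ) : Prop :=
  Tendsto (fun (n : ℕ) (i : Fin d) => coordHom i (pos s n) / n) atTop (𝓝 v)

lemma HasVelocity.unique {s : Steps d} {v w : Fin d → ℝ} (hv : HasVelocity s v)
    (hw : HasVelocity s w) : v = w := tendsto_nhds_unique hv hw

lemma hasVelocity_shift {m : ℕ} {s : Steps d} {v : Fin d → ℝ} :
    HasVelocity (shift m s) v ↔ HasVelocity s v := by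
  simp only [HasVelocity, tendsto_pi_nhds, tendsto_speed_shift]

lemma measurable_velocity_seq (n : ℕ) :
    Measurable fun (s : Steps d) (i : Fin d) => coordHom i (pos s n) / n :=
  measurable_pi_lambda _ fun i => (measurable_hom (coordHom i) n).div_const _

lemma measurableSet_hasVelocity {U : Set (Fin d → ℝ)} (hU : MeasurableSet U) :
    MeasurableSet {s : Steps d | ∃ v ∈ U, HasVelocity s v} := by
  classical
  set S : Set (Steps d) := {s | ∃ v, HasVelocity s v} with hS
  have hSm : MeasurableSet S :=
    measurableSet_exists_tendsto fun n => measurable_velocity_seq n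
  -- the velocity where it exists, extended by zero
  have hV : ∀ s : Steps d, ∃ v : Fin d → ℝ, if s ∈ S then HasVelocity s v else v = 0 := by
    intro s
    by_cases hs : s ∈ S
    · obtain ⟨v, hv⟩ := hs
      exact ⟨v, by rwa [if_pos ⟨v, hv⟩]⟩
    · exact ⟨0, by rw [if_neg hs]⟩
  choose V hV using hV
  have hVm : Measurable V := by
    refine measurable_of_tendsto_metrizable
      (fun n => (measurable_velocity_seq n).indicator hSm) (tendsto_pi_nhds.2 fun s => ?_)
    have h := hV s
    by_cases hs : s ∈ S
    · rw [if_pos hs] at h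
      simp only [Set.indicator_of_mem hs]
      exact h
    · rw [if_neg hs] at h
      simp only [Set.indicator_of_notMem hs, h]
      exact tendsto_const_nhds
  have h : {s : Steps d | ∃ v ∈ U, HasVelocity s v} = S ∩ V ⁻¹' U := by
    ext s
    constructor
    · rintro ⟨v, hv, hs⟩
      have h1 := hV s
      rw [if_pos ⟨v, hs⟩] at h1
      exact ⟨⟨v, hs⟩, by rwa [Set.mem_preimage, h1.unique hs]⟩
    · rintro ⟨hs, hv⟩
      have h1 := hV s
      rw [if_pos hs] at h1
      exact ⟨V s, hv, h1⟩
  rw [h]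
  exact hSm.inter (hVm hU)

/-- The inner product with the vector `ℓ`. -/
def dotHom (ℓ : Fin d → ℝ) : Lattice d →+ ℝ where
  toFun x := toReal x ⬝ᵥ ℓ
  map_zero' := by simp [toReal, dotProduct]
  map_add' x y := by simp [toReal, dotProduct, add_mul, Finset.sum_add_distrib]

lemma dotHom_apply (ℓ : Fin d → ℝ) (x : Lattice d) : dotHom ℓ x = toReal x ⬝ᵥ ℓ := rfl

lemma HasVelocity.tendsto_dotHom {s : Steps d} {v : Fin d → ℝ} (h : HasVelocity s v)
    (ℓ : Fin d → ℝ) : Tendsto (fun n : ℕ => dotHom ℓ (pos s n) / n) atTop (𝓝 (v ⬝ᵥ ℓ)) := by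
  have h1 : Tendsto (fun n : ℕ => ∑ i, coordHom i (pos s n) / n * ℓ i) atTop
      (𝓝 (∑ i, v i * ℓ i)) :=
    tendsto_finsetSum _ fun i _ => (tendsto_pi_nhds.1 h i).mul_const _
  refine h1.congr fun n => ?_
  rw [dotHom_apply, dotProduct, Finset.sum_div]
  exact Finset.sum_congr rfl fun i _ => by rw [coordHom_apply, toReal]; ring

lemma HasVelocity.mem_up {s : Steps d} {v : Fin d → ℝ} (h : HasVelocity s v) {ℓ : Fin d → ℝ}
    (hℓ : 0 < v ⬝ᵥ ℓ) : s ∈ Up (dotHom ℓ) := by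
  have h1 := (h.tendsto_dotHom ℓ).pos_mul_atTop hℓ tendsto_natCast_atTop_atTop
  refine h1.congr' ?_
  filter_upwards [eventually_ne_atTop 0] with n hn
  exact div_mul_cancel₀ _ (by exact_mod_cast hn)

lemma neg_dotHom (ℓ : Fin d → ℝ) : -dotHom ℓ = dotHom (-ℓ) := by
  ext; simp [dotHom_apply]

lemma abs_coord_le_one (i : Fin d) (e : UnitStep d) : |e.1 i| ≤ 1 := by
  obtain ⟨j, h | h⟩ := e.2 <;> rw [h] <;> by_cases hij : i = j <;> simp [hij]

variable [NeZero d] (μ : Measure (ProbabilityMeasure (UnitStep d))) [IsProbabilityMeasure μ]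

/-- On the event that the walk does not go to infinity in a direction, it has no positive speed in
this direction; if the opposite event has positive probability, the walk is even bounded above. -/
lemma eventually_le_of_notMem_up {lam : Lattice d →+ ℤ} (hlam : ∀ e : UnitStep d, |lam e.1| ≤ 1) :
    ∀ᵐ s ∂stepAnn μ, s ∉ Up (castHom lam) →
      ∀ ε : ℝ, 0 < ε → ∀ᶠ n : ℕ in atTop, (lam (pos s n) : ℝ) ≤ ε * n := by
  by_cases hup : stepAnn μ (Up (castHom lam)) = 0
  · filter_upwards [speed_nonpos_of_up_null μ hlam hup] with s hs _ using hs
  · filter_upwards [up_of_unb μ _ hup] with s hs hn ε hε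
    have h1 : s ∉ Unb (castHom lam) := fun h => hn (hs h)
    simp only [Unb, Set.mem_ofPred_eq, not_forall, not_exists, not_lt] at h1
    obtain ⟨K, hK⟩ := h1
    obtain ⟨n₀, hn₀⟩ := exists_nat_gt (K / ε)
    filter_upwards [eventually_ge_atTop n₀] with n hn'
    have h2 : (n₀ : ℝ) ≤ n := by exact_mod_cast hn'
    rw [div_lt_iff₀ hε] at hn₀
    have := hK n
    rw [castHom_apply] at this
    nlinarith

/-- The speed exists in each direction with steps of height at most one. -/
lemma exists_speed {lam : Lattice d →+ ℤ} (hlam : ∀ e : UnitStep d, |lam e.1| ≤ 1) :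
    ∀ᵐ s ∂stepAnn μ, ∃ v : ℝ, Tendsto (fun n : ℕ => (lam (pos s n) : ℝ) / n) atTop (𝓝 v) := by
  have hlam' : ∀ e : UnitStep d, |(-lam) e.1| ≤ 1 := fun e => by
    rw [AddMonoidHom.neg_apply, abs_neg]; exact hlam e
  filter_upwards [exists_speed_of_up μ hlam, exists_speed_of_up μ hlam',
    eventually_le_of_notMem_up μ hlam, eventually_le_of_notMem_up μ hlam'] with s h1 h2 h3 h4
  by_cases hs : s ∈ Up (castHom lam)
  · exact h1 hs
  by_cases hs' : s ∈ Up (castHom (-lam))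
  · obtain ⟨v, hv⟩ := h2 hs'
    refine ⟨-v, hv.neg.congr fun n => ?_⟩
    rw [AddMonoidHom.neg_apply]
    push_cast
    ring
  refine ⟨0, Metric.tendsto_atTop'.2 fun ε hε => ?_⟩
  obtain ⟨N, hN⟩ := eventually_atTop.1 ((h3 hs _ (half_pos hε)).and (h4 hs' _ (half_pos hε)))
  refine ⟨N, fun n hn => ?_⟩
  have h5 := hN n hn.le
  have hn0 : (0 : ℝ) < n := by exact_mod_cast (Nat.zero_le N).trans_lt hn
  rw [Real.dist_eq, sub_zero, abs_div, abs_of_pos hn0, div_lt_iff₀ hn0, abs_lt]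
  have h6 := h5.2
  rw [AddMonoidHom.neg_apply] at h6
  push_cast at h6
  constructor <;> nlinarith [h5.1]

/-- The limiting velocity exists. -/
lemma ae_exists_hasVelocity : ∀ᵐ s ∂stepAnn μ, ∃ v, HasVelocity s v := by
  have h := fun i : Fin d => exists_speed μ (lam := Pi.evalAddMonoidHom (fun _ => ℤ) i)
    (abs_coord_le_one i)
  filter_upwards [ae_all_iff.2 h] with s hs
  choose v hv using hs
  exact ⟨v, tendsto_pi_nhds.2 hv⟩

/-- The velocity is deterministic on the event that the walk goes to infinity in a given
direction. -/
lemma exists_velocity_on_up (φ : Lattice d →+ ℝ) :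
    ∃ v, ∀ᵐ s ∂stepAnn μ, s ∈ Up φ → HasVelocity s v := by
  have hex := ae_exists_hasVelocity μ
  have hex' : ∀ s : Steps d, ∃ v, (∃ w, HasVelocity s w) → HasVelocity s v := fun s => by
    by_cases h : ∃ w, HasVelocity s w
    · exact ⟨h.choose, fun _ => h.choose_spec⟩
    · exact ⟨0, fun h' => absurd h' h⟩
  choose V hV using hex'
  obtain ⟨v, hv⟩ := Filter.exists_eventuallyEq_const_of_forall_separating
    (l := ae ((stepAnn μ).restrict (Up φ))) (f := V) MeasurableSet (fun U hU => by
      rw [Filter.Eventually, Filter.Eventually]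
      change (∀ᵐ s ∂(stepAnn μ).restrict (Up φ), V s ∈ U) ∨
        ∀ᵐ s ∂(stepAnn μ).restrict (Up φ), V s ∉ U
      rw [ae_restrict_iff' (measurableSet_up φ), ae_restrict_iff' (measurableSet_up φ)]
      by_cases h : ∀ᵐ s ∂stepAnn μ, s ∈ {s | ∃ v ∈ U, HasVelocity s v} → ∀ n, shift n s ∉ Stay φ
      · right
        filter_upwards [h, hex] with s h1 h2 hs hc
        obtain ⟨n, hn⟩ := up_exists_stay hs
        exact h1 ⟨V s, hc, hV s h2⟩ n hn
      · left
        filter_upwards [invariant_of_unb μ φ (measurableSet_hasVelocity hU)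
          (fun n s => by simp only [Set.mem_ofPred_eq, hasVelocity_shift]) h] with s h1 hs
        obtain ⟨v, hv, hvs⟩ := (h1 (up_subset_unb φ hs)).1
        rwa [(hV s ⟨v, hvs⟩).unique hvs])
  refine ⟨v, ?_⟩
  have hv' := (ae_restrict_iff' (measurableSet_up φ)).1 hv
  filter_upwards [hv', hex] with s h1 h2 hs
  have h3 := hV s h2
  rwa [show V s = v from h1 hs] at h3

/-- The velocity of the walk takes the value `u` with positive probability. -/
def IsVelocity (u : Fin d → ℝ) : Prop := ¬ ∀ᵐ s ∂stepAnn μ, ¬ HasVelocity s u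

/-- Two velocities with positive component in a common direction agree, since both make the walk
go to infinity in this direction. -/
lemma IsVelocity.eq_of_dotProduct_pos {u w ℓ : Fin d → ℝ} (hu : IsVelocity μ u)
    (hw : IsVelocity μ w) (hul : 0 < u ⬝ᵥ ℓ) (hwl : 0 < w ⬝ᵥ ℓ) : u = w := by
  obtain ⟨v, hv⟩ := exists_velocity_on_up μ (dotHom ℓ)
  have key : ∀ u, IsVelocity μ u → 0 < u ⬝ᵥ ℓ → u = v := fun u hu hul => by
    by_contra h
    refine hu ?_
    filter_upwards [hv] with s hs hsu
    exact h (hsu.unique (hs (hsu.mem_up hul)))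
  rw [key u hu hul, key w hw hwl]

lemma IsVelocity.up_ne_zero {u ℓ : Fin d → ℝ} (hu : IsVelocity μ u) (hul : 0 < u ⬝ᵥ ℓ) :
    stepAnn μ (Up (dotHom ℓ)) ≠ 0 := fun h => hu <| by
  filter_upwards [measure_eq_zero_iff_ae_notMem.1 h] with s hs hsu using hs (hsu.mem_up hul)

lemma IsVelocity.eq_of_up {u ℓ : Fin d → ℝ} (hu : IsVelocity μ u) (hul : 0 < u ⬝ᵥ ℓ) :
    ∀ᵐ s ∂stepAnn μ, s ∈ Up (dotHom ℓ) → HasVelocity s u := by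
  obtain ⟨v, hv⟩ := exists_velocity_on_up μ (dotHom ℓ)
  have : u = v := by
    by_contra h
    refine hu ?_
    filter_upwards [hv] with s hs hsu
    exact h (hsu.unique (hs (hsu.mem_up hul)))
  rwa [this]

/-- Two distinct nonzero velocities point to opposite half-spaces, hence exclude any other one. -/
lemma IsVelocity.ae_or {u w : Fin d → ℝ} (hu : IsVelocity μ u) (hw : IsVelocity μ w)
    (hu0 : u ≠ 0) (hw0 : w ≠ 0) (huw : u ≠ w) :
    ∀ᵐ s ∂stepAnn μ, HasVelocity s u ∨ HasVelocity s w := by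
  have hpos : ∀ x : Fin d → ℝ, x ≠ 0 → 0 < x ⬝ᵥ x := fun x hx =>
    (Finset.sum_nonneg fun i _ => mul_self_nonneg (x i)).lt_of_ne
      fun h => hx (dotProduct_self_eq_zero.1 h.symm)
  have huu := hpos u hu0
  have hww := hpos w hw0
  have h1 : w ⬝ᵥ u < 0 := by
    by_contra h
    refine huw (hu.eq_of_dotProduct_pos μ hw (ℓ := u + w) ?_ ?_)
    · rw [dotProduct_add, dotProduct_comm u w]; linarith
    · rw [dotProduct_add]; linarith
  have h2 : 0 < w ⬝ᵥ (-u) := by rw [dotProduct_neg]; linarith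
  have h3 := up_or_down μ (dotHom u) (hu.up_ne_zero μ huu)
    (by rw [neg_dotHom]; exact hw.up_ne_zero μ h2)
  filter_upwards [h3, hu.eq_of_up μ huu, hw.eq_of_up μ h2] with s h h4 h5
  rw [neg_dotHom] at h
  exact h.imp h4 h5

/-- The velocity has at most two values. -/
lemma exists_two_velocities :
    ∃ v₁ v₂ : Fin d → ℝ, ∀ᵐ s ∂stepAnn μ, HasVelocity s v₁ ∨ HasVelocity s v₂ := by
  by_cases h2 : ∃ u w, IsVelocity μ u ∧ IsVelocity μ w ∧ u ≠ 0 ∧ w ≠ 0 ∧ u ≠ w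
  · obtain ⟨u, w, hu, hw, hu0, hw0, huw⟩ := h2
    exact ⟨u, w, hu.ae_or μ hw hu0 hw0 huw⟩
  have h1 : ∃ u, ∀ w, IsVelocity μ w → w = 0 ∨ w = u := by
    by_cases h : ∃ u, IsVelocity μ u ∧ u ≠ 0
    · obtain ⟨u, hu, hu0⟩ := h
      refine ⟨u, fun w hw => ?_⟩
      by_contra! hc
      exact h2 ⟨u, w, hu, hw, hu0, hc.1, hc.2.symm⟩
    · refine ⟨0, fun w hw => Or.inl ?_⟩
      by_contra hc
      exact h ⟨w, hw, hc⟩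
  obtain ⟨u, hu⟩ := h1
  refine ⟨0, u, ?_⟩
  -- a nonzero velocity has a nonzero coordinate, hence is one of finitely many vectors
  choose v hv using fun ℓ : Fin d → ℝ => exists_velocity_on_up μ (dotHom ℓ)
  have h3 : ∀ ℓ : Fin d → ℝ, ∀ᵐ s ∂stepAnn μ, s ∈ Up (dotHom ℓ) →
      HasVelocity s 0 ∨ HasVelocity s u := fun ℓ => by
    by_cases h : IsVelocity μ (v ℓ)
    · filter_upwards [hv ℓ] with s hs hup
      rcases hu _ h with h | h
      · exact Or.inl (h ▸ hs hup)
      · exact Or.inr (h ▸ hs hup)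
    · filter_upwards [hv ℓ, not_not.1 h] with s hs hs' hup using absurd (hs hup) hs'
  filter_upwards [ae_exists_hasVelocity μ, ae_all_iff.2 fun i : Fin d => h3 (Pi.single i 1),
    ae_all_iff.2 fun i : Fin d => h3 (-Pi.single i 1)] with s ⟨w, hw⟩ hp hm
  by_cases hw0 : w = 0
  · exact Or.inl (hw0 ▸ hw)
  obtain ⟨i, hi⟩ := Function.ne_iff.1 hw0
  rcases lt_or_gt_of_ne hi with h | h
  · exact hm i (hw.mem_up (by rw [dotProduct_neg, dotProduct_single_one]; simpa using h))
  · exact hp i (hw.mem_up (by rw [dotProduct_single_one]; simpa using h))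

/-- The speed in the direction `ℓ` vanishes unless the walk goes to infinity in this direction or
in the opposite one. -/
lemma exists_speed_indicator (ℓ : Fin d → ℝ) :
    ∃ a b : ℝ, ∀ᵐ s ∂stepAnn μ, Tendsto (fun n : ℕ => (toReal (pos s n) ⬝ᵥ ℓ) / (n : ℝ)) atTop
      (𝓝 ((Aplus ℓ).indicator (fun _ => a) (pos s) +
        (Aminus ℓ).indicator (fun _ => b) (pos s))) := by
  obtain ⟨v, hv⟩ := exists_velocity_on_up μ (dotHom ℓ)
  obtain ⟨w, hw⟩ := exists_velocity_on_up μ (dotHom (-ℓ))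
  refine ⟨v ⬝ᵥ ℓ, w ⬝ᵥ ℓ, ?_⟩
  filter_upwards [ae_exists_hasVelocity μ, hv, hw] with s ⟨u, hu⟩ hv hw
  have hminus : pos s ∈ Aminus ℓ ↔ s ∈ Up (dotHom (-ℓ)) := by
    rw [← neg_dotHom]
    exact tendsto_neg_atTop_iff.symm
  by_cases hs : pos s ∈ Aplus ℓ
  · have hs' : pos s ∉ Aminus ℓ := fun h => hs.not_tendsto disjoint_atTop_atBot h
    rw [Set.indicator_of_mem hs, Set.indicator_of_notMem hs', add_zero]
    exact (hv hs).tendsto_dotHom ℓ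
  by_cases hs' : pos s ∈ Aminus ℓ
  · rw [Set.indicator_of_notMem hs, Set.indicator_of_mem hs', zero_add]
    exact (hw (hminus.1 hs')).tendsto_dotHom ℓ
  rw [Set.indicator_of_notMem hs, Set.indicator_of_notMem hs', add_zero]
  have h0 : u ⬝ᵥ ℓ = 0 := by
    refine le_antisymm (not_lt.1 fun h => hs (hu.mem_up h)) (not_lt.1 fun h => hs' ?_)
    exact hminus.2 (hu.mem_up (by rw [dotProduct_neg]; linarith))
  rw [← h0]
  exact hu.tendsto_dotHom ℓ

end

end RWRE

theorem mainTheorem3 (d : ℕ) (hd : 2 ≤ d)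
    (μ : Measure (ProbabilityMeasure (RWRE.UnitStep d))) [IsProbabilityMeasure μ] :
    (∃ vplus vminus : (Fin d → ℝ) → ℝ, ∀ ℓ : Fin d → ℝ, ℓ ≠ 0 →
      ∀ᵐ p ∂(RWRE.annealedLaw μ),
        Tendsto (fun n : ℕ => (RWRE.toReal (p.2 n) ⬝ᵥ ℓ) / (n : ℝ)) atTop
          (𝓝 ((RWRE.Aplus ℓ).indicator (fun _ => vplus ℓ) p.2 +
            (RWRE.Aminus ℓ).indicator (fun _ => vminus ℓ) p.2))) ∧
    (∃ v₁ v₂ : Fin d → ℝ, ∀ᵐ p ∂(RWRE.annealedLaw μ),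
      ∃ v : Fin d → ℝ, (v = v₁ ∨ v = v₂) ∧
        Tendsto (fun n : ℕ => (n : ℝ)⁻¹ • RWRE.toReal (p.2 n)) atTop (𝓝 v)) := by
  have : NeZero d := ⟨by omega⟩
  refine ⟨?_, ?_⟩
  · choose a b hab using RWRE.exists_speed_indicator μ
    exact ⟨a, b, fun ℓ _ => RWRE.annealedLaw_ae μ (p := fun X => Tendsto (fun n : ℕ =>
      (RWRE.toReal (X n) ⬝ᵥ ℓ) / (n : ℝ)) atTop (𝓝 ((RWRE.Aplus ℓ).indicator (fun _ => a ℓ) X +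
        (RWRE.Aminus ℓ).indicator (fun _ => b ℓ) X))) (hab ℓ)⟩
  · obtain ⟨v₁, v₂, h⟩ := RWRE.exists_two_velocities μ
    refine ⟨v₁, v₂, RWRE.annealedLaw_ae μ (p := fun X => ∃ v : Fin d → ℝ, (v = v₁ ∨ v = v₂) ∧
      Tendsto (fun n : ℕ => (n : ℝ)⁻¹ • RWRE.toReal (X n)) atTop (𝓝 v)) ?_⟩
    have hvel : ∀ (s : RWRE.Steps d) (v : Fin d → ℝ), RWRE.HasVelocity s v →
        Tendsto (fun n : ℕ => (n : ℝ)⁻¹ • RWRE.toReal (RWRE.pos s n)) atTop (𝓝 v) := by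
      refine fun s v hs => hs.congr fun n => funext fun i => ?_
      rw [RWRE.coordHom_apply, Pi.smul_apply, RWRE.toReal, smul_eq_mul, div_eq_inv_mul]
    filter_upwards [h] with s hs
    rcases hs with hs | hs
    · exact ⟨v₁, Or.inl rfl, hvel s v₁ hs⟩
    · exact ⟨v₂, Or.inr rfl, hvel s v₂ hs⟩
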